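/- For each $n\ge 0$ let $\mathbf d^{(n)}=(d_i^{(n)})_{i=1}^n$ be a sequence of non-negative integers with even sum, and assume that, as $n\to\infty$, $$\sum_{i=1}^n d_i^{(n)}=\Theta(n),\qquad \sum_{i=1}^n \bigl(d_i^{(n)}\bigr)^2=O(n),\qquad \max_{1\le i\le n} d_i^{(n)}=o\bigl(n^{1/2}\bigr).$$ Let $G(n,\mathbf d)$ be uniformly distributed on the set of simple graphs with vertex set $[n]=\{1,\dots,n\}$ in which every vertex $i$ has degree $d_i^{(n)}$. Let $\hat G(n,\mathbf d)$ be the switched configuration model, a random simple graph with the same degrees, constructed as follows. Give each vertex $i$ a set of $d_i^{(n)}$ half-edges, and let $\Gamma_0$ be a uniformly random configuration, i.e. a uniformly random perfect matching of the half-edges; its pairs are called edges, and it projects to a multigraph on $[n]$. An edge is bad if it is a loop or is parallel to another edge. As long as the current configuration has a bad edge, choose a bad edge $\{a,b\}$ by some fixed rule (which may be random and may depend on the past switchings), choose one of the other edges uniformly at random, order its half-edges uniformly at random as $(c,e)$, and replace the two edges $\{a,b\}$ and $\{c,e\}$ by $\{a,e\}$ and $\{c,b\}$. When there is no bad edge left,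 $\hat G(n,\mathbf d)$ is the simple graph to which the configuration projects; if the process never terminates, restart it with a new independent uniformly random configuration. The result below holds for every choice of the rule. (Both random graphs are considered for those $n$ for which some simple graph has degree sequence $\mathbf d^{(n)}$; for other $n$, $G(n,\mathbf d)$ and $\hat G(n,\mathbf d)$ may be arbitrary random graphs on $[n]$.) For each $n$ let $f_n$ be any function from the simple graphs on $[n]$ to a fixed metric space (for example $\mathbb R$), and put $X_n=f_n\bigl(G(n,\mathbf d)\bigr)$ and $\hat X_n=f_n\bigl(\hat G(n,\mathbf d)\bigr)$. (i) If $a$ is a constant such that $\hat X_n\to a$ in probability as $n\to\infty$, then also $X_n\to a$ in probability. (ii) More generally, if $Y$ is a random variable such that $\hat X_n\to Y$ in distribution as $n\to\infty$, then also $X_n\to Y$ in distribution. -/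

import Mathlib

open MeasureTheory ProbabilityTheory Filter Topology Asymptotics
open scoped ENNReal

namespace ConfigModel

/-- `H` is a simple graph on the vertex set `Fin n` in which vertex `i` has degree `d i`. -/
def HasDegrees {n : ℕ} (d : Fin n → ℕ) (H : SimpleGraph (Fin n)) : Prop :=
  ∀ i, (H.neighborSet i).ncard = d i

/-- The degree sequence `d` is graphic: some simple graph has it. -/
def IsGraphic {n : ℕ} (d : Fin n → ℕ) : Prop :=
  ∃ H : SimpleGraph (Fin n), HasDegrees d H

/-- The half-edges: vertex `i` has the `d i` half-edges `⟨i, 0⟩, …, ⟨i, d i - 1⟩`. -/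
abbrev HalfEdge {n : ℕ} (d : Fin n → ℕ) : Type := Σ i : Fin n, Fin (d i)

/-- A configuration: a perfect matching of the half-edges, given as the fixed-point free
involution that sends a half-edge to its partner. The edges are the pairs `{a, σ a}`. -/
abbrev Config {n : ℕ} (d : Fin n → ℕ) : Type :=
  {σ : Equiv.Perm (HalfEdge d) // ∀ a, σ (σ a) = a ∧ σ a ≠ a}

variable {n : ℕ} {d : Fin n → ℕ}

/-- The edge `{a, σ a}` of the configuration `σ` is bad: it is a loop, or it is parallel to
another edge `{c, σ c}`. -/
def IsBad (σ : Config d) (a : HalfEdge d) : Prop :=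
  (σ.1 a).1 = a.1 ∨
    ∃ c, c ≠ a ∧ c ≠ σ.1 a ∧ c.1 = a.1 ∧ (σ.1 c).1 = (σ.1 a).1

/-- A configuration is simple if it has no bad edge. -/
def IsSimple (σ : Config d) : Prop := ∀ a, ¬ IsBad σ a

/-- The graph on `Fin n` to which a configuration projects (as a simple graph; it will only be
used for simple configurations, where the projected multigraph is a simple graph). -/
def toGraph (σ : Config d) : SimpleGraph (Fin n) where
  Adj i j := i ≠ j ∧ ∃ a : HalfEdge d, a.1 = i ∧ (σ.1 a).1 = j
  symm := ⟨by
    rintro i j ⟨hij, a, hi, hj⟩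
    exact ⟨hij.symm, σ.1 a, hj, by rw [(σ.2 a).1]; exact hi⟩⟩
  loopless := ⟨fun _ h => h.1 rfl⟩

/-- Switching the edges `{a, σ a}` and `{c, σ c}`: they are replaced by `{a, σ c}` and
`{c, σ a}`. (Conjugating by the transposition of `σ a` and `σ c` exchanges the partners of
`a` and `c`.) -/
def switch (σ : Config d) (a c : HalfEdge d) : Config d :=
  ⟨Equiv.swap (σ.1 a) (σ.1 c) * σ.1 * Equiv.swap (σ.1 a) (σ.1 c), by
    intro x
    refine ⟨?_, ?_⟩
    · simp [Equiv.Perm.mul_apply, (σ.2 _).1]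
    · intro h
      apply (σ.2 (Equiv.swap (σ.1 a) (σ.1 c) x)).2
      simpa [Equiv.Perm.mul_apply, Equiv.swap_apply_eq_iff] using h⟩

/-- The switchings made so far, the most recent one first: the configuration before the switching,
a half-edge `a` of the bad edge, and the first half-edge `c` of the other (ordered) edge. -/
abbrev History {n : ℕ} (d : Fin n → ℕ) : Type :=
  List (Config d × HalfEdge d × HalfEdge d)

/-- A rule for choosing a bad edge of a configuration that is not simple. The choice may be random,
and it may depend on the switchings made so far. The chosen edge is given by one of
its two half-edges; which of the two has no influence on the law of the switching. -/
structure BadEdgeRule {n : ℕ} (d : Fin n → ℕ) where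
  choose : History d → (σ : Config d) → ¬ IsSimple σ → PMF (HalfEdge d)
  isBad_of_mem_support : ∀ (h : History d) (σ : Config d) (hσ : ¬ IsSimple σ),
    ∀ a ∈ (choose h σ hσ).support, IsBad σ a

/-- The half-edges outside the edge `{a, σ a}`. Choosing one of them uniformly at random amounts to
choosing another edge uniformly at random together with a random order of its two half-edges. -/
def otherHalfEdges (σ : Config d) (a : HalfEdge d) : Finset (HalfEdge d) :=
  Finset.univ.filter fun c => c ≠ a ∧ c ≠ σ.1 a

open Classical in
/-- One step of the switching process. A simple configuration is left as it is; otherwise a bad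
edge is chosen by the rule and switched with a uniformly random other edge in random order.
(If there is no other edge, nothing can be done and the process never terminates.) -/
noncomputable def step (R : BadEdgeRule d) (s : History d × Config d) :
    PMF (History d × Config d) :=
  if hs : IsSimple s.2 then PMF.pure s
  else (R.choose s.1 s.2 hs).bind fun a =>
    if hc : (otherHalfEdges s.2 a).Nonempty then
      (PMF.uniformOfFinset (otherHalfEdges s.2 a) hc).map fun c =>
        ((s.2, a, c) :: s.1, switch s.2 a c)
    else PMF.pure s

/-- The state of the switching process after `k` steps, started at the configuration `σ`. -/
noncomputable def run (R : BadEdgeRule d) (σ : Config d) : ℕ → PMF (History d × Config d)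
  | 0 => PMF.pure ([], σ)
  | k + 1 => (run R σ k).bind (step R)

/-- The probability that the switching process, started at a uniformly random configuration,
terminates with the simple graph `H`. (Simple configurations are absorbing, so the supremum
over the number `k` of steps is the limit as `k → ∞`.) -/
noncomputable def endProb (R : BadEdgeRule d) (H : SimpleGraph (Fin n)) : ℝ≥0∞ :=
  ∑' σ : Config d, (Nat.card (Config d) : ℝ≥0∞)⁻¹ *
    ⨆ k : ℕ, (run R σ k).toOuterMeasure {s | IsSimple s.2 ∧ toGraph s.2 = H}

/-- The probability that the switching process, started at a uniformly random configuration,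
never terminates. -/
noncomputable def failProb (R : BadEdgeRule d) : ℝ≥0∞ :=
  1 - ∑' H : SimpleGraph (Fin n), endProb R H

/-- The probability that the construction finally yields `H`, where the process is restarted with a
new random configuration whenever it does not terminate: `m` failed rounds are followed by a
round that terminates with `H`. -/
noncomputable def switchedProb (R : BadEdgeRule d) (H : SimpleGraph (Fin n)) : ℝ≥0∞ :=
  ∑' m : ℕ, failProb R ^ m * endProb R H

/-- The distribution of the switched configuration model, as a measure on simple graphs. -/
noncomputable def switchedLaw (R : BadEdgeRule d) : Measure (SimpleGraph (Fin n)) :=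
  Measure.sum fun H => switchedProb R H • Measure.dirac H

/-- The uniform distribution on the simple graphs with degree sequence `d`. -/
noncomputable def uniformLaw {n : ℕ} (d : Fin n → ℕ) : Measure (SimpleGraph (Fin n)) :=
  uniformOn {H | HasDegrees d H}

/-- Convergence in probability to a constant `a`, for random elements `X n` of a metric space that
may be defined on different probability spaces. -/
def TendstoInProbability {Ω : ℕ → Type*} [∀ n, MeasurableSpace (Ω n)]
    (P : ∀ n, Measure (Ω n)) {E : Type*} [MetricSpace E] (X : ∀ n, Ω n → E) (a : E) : Prop :=
  ∀ ε : ℝ, 0 < ε → Tendsto (fun n => P n {ω | ε ≤ dist (X n ω) a}) atTop (𝓝 0)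

end ConfigModel

/-! Write N for the number of half-edges and u for the uniform probability of a set S of graphs.
Both parts follow from one estimate: for all large n, uniformly in S and in the rule, the switched
law gives S mass at least u - ε (`eventually_uniformLaw_le`). Applied to complements as well, this
says that the two laws are close in total variation, so every limit passes from one to the other,
whatever the functions are.

To get rid of the rule, let an adversary choose the bad edges so as to minimise the chance of ending
in S; `value S k σ` is that chance within k steps. It suffices to bound its mean over all
configurations from below. By first moments, most configurations have only single loops and double
edges, and at most K half-edges in them (`sum_badSet_le`, `card_not_nice_le`). In such a
configuration all but o(N) of the switchings at a bad edge are good: they remove one loop or one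
double edge and spoil nothing else (`exists_exceptional`).

Two facts drive the argument. First, the adversary has almost no power: good switchings of different
bad edges commute, and parallel edges are exchanged by a symmetry, so that every choice of the bad
edge gives almost the same value (`switchAvg_value_le`). Secondly, good switchings between
neighbouring classes `niceClass d l m` can be counted from both ends. From above, each configuration
has about N of them at each of its t bad half-edges of the given kind. From below, a configuration
has about the same number of preimages as any other: for loops this is the number of sibling pairs,
up to few failures (`card_loopPairs`); for double edges it is concentrated, by a second moment
computation (`sum_abs_multiTriples_sub_le`). Hence switching carries the uniform distribution on a
class approximately to that on the next one (`step_bound`).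

By induction every class with at most K bad half-edges reaches S with mean probability at least u
minus a small error, because the last class, the simple configurations, projects uniformly onto the
graphs (`card_fibre_eq`). -/

namespace ConfigModel

/-! ### Parallel classes, bad edges and the effect of a good switching -/

section Switching

variable {n : ℕ} {d : Fin n → ℕ}

@[simp] lemma Config.partner_partner (σ : Config d) (a : HalfEdge d) : σ.1 (σ.1 a) = a := (σ.2 a).1

lemma Config.partner_ne (σ : Config d) (a : HalfEdge d) : σ.1 a ≠ a := (σ.2 a).2

lemma Config.partner_eq_iff (σ : Config d) {a b : HalfEdge d} : σ.1 a = b ↔ a = σ.1 b :=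
  ⟨fun h => by rw [← h, σ.partner_partner], fun h => by rw [h, σ.partner_partner]⟩

/-- The half-edges that lie, in the same direction, in edges parallel to that of `a`. -/
def par (σ : Config d) (a : HalfEdge d) : Finset (HalfEdge d) :=
  Finset.univ.filter fun c => c.1 = a.1 ∧ (σ.1 c).1 = (σ.1 a).1

lemma mem_par {σ : Config d} {a c : HalfEdge d} :
    c ∈ par σ a ↔ c.1 = a.1 ∧ (σ.1 c).1 = (σ.1 a).1 := by simp [par]

lemma self_mem_par (σ : Config d) (a : HalfEdge d) : a ∈ par σ a := by simp [mem_par]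

lemma mem_par_comm {σ : Config d} {a c : HalfEdge d} : c ∈ par σ a ↔ a ∈ par σ c := by
  simp only [mem_par]; constructor <;> rintro ⟨h, h'⟩ <;> exact ⟨h.symm, h'.symm⟩

lemma par_eq_of_mem {σ : Config d} {a c : HalfEdge d} (h : c ∈ par σ a) : par σ c = par σ a := by
  rw [mem_par] at h
  ext x; simp [mem_par, h.1, h.2]

lemma partner_mem_par {σ : Config d} {a c : HalfEdge d} (h : c ∈ par σ a) :
    σ.1 c ∈ par σ (σ.1 a) := by
  rw [mem_par] at *; simpa using ⟨h.2, h.1⟩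

lemma card_par_partner (σ : Config d) (a : HalfEdge d) :
    (par σ (σ.1 a)).card = (par σ a).card := by
  refine Finset.card_bij' (fun x _ => σ.1 x) (fun x _ => σ.1 x) ?_ ?_ (by simp) (by simp)
  · intro x hx; simpa using partner_mem_par hx
  · intro x hx; exact partner_mem_par hx

lemma isBad_iff_exists {σ : Config d} {a : HalfEdge d} : IsBad σ a ↔ ∃ c ∈ par σ a, c ≠ a := by
  constructor
  · rintro (h | ⟨c, hc, -, h⟩)
    · exact ⟨σ.1 a, mem_par.2 (by simp [h]), σ.partner_ne a⟩
    · exact ⟨c, mem_par.2 h, hc⟩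
  · rintro ⟨c, hc, hca⟩
    rw [mem_par] at hc
    by_cases h : c = σ.1 a
    · left; rw [← h, hc.1]
    · right; exact ⟨c, hca, h, hc⟩

/-- A loop puts both of its half-edges into `par σ a`. One count therefore treats loops and multiple
edges alike: a single loop and a double edge both give exactly 2. -/
lemma isBad_iff_card {σ : Config d} {a : HalfEdge d} : IsBad σ a ↔ 2 ≤ (par σ a).card := by
  rw [isBad_iff_exists, ← Nat.lt_iff_add_one_le, Finset.one_lt_card_iff_nontrivial]
  constructor
  · rintro ⟨c, hc, hca⟩
    exact ⟨c, hc, a, self_mem_par σ a, hca⟩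
  · intro h
    obtain ⟨c, hc, hca⟩ := h.exists_ne a
    exact ⟨c, hc, hca⟩

lemma eq_of_mem_par {σ : Config d} {a c : HalfEdge d} (ha : ¬ IsBad σ a) (hc : c ∈ par σ a) :
    c = a := by
  by_contra h
  exact ha (isBad_iff_exists.2 ⟨c, hc, h⟩)

lemma isBad_of_mem_par {σ : Config d} {a c : HalfEdge d} (h : c ∈ par σ a) :
    IsBad σ c ↔ IsBad σ a := by
  rw [isBad_iff_card, isBad_iff_card, par_eq_of_mem h]

@[simp] lemma isBad_partner {σ : Config d} {a : HalfEdge d} : IsBad σ (σ.1 a) ↔ IsBad σ a := by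
  rw [isBad_iff_card, isBad_iff_card, card_par_partner]

lemma isBad_of_loop {σ : Config d} {a : HalfEdge d} (h : (σ.1 a).1 = a.1) : IsBad σ a := Or.inl h

/-- The half-edges in bad edges. -/
def badSet (σ : Config d) : Finset (HalfEdge d) :=
  Finset.univ.filter fun a => 2 ≤ (par σ a).card

lemma mem_badSet {σ : Config d} {a : HalfEdge d} : a ∈ badSet σ ↔ IsBad σ a := by
  simp [badSet, isBad_iff_card]

/-- The half-edges in loops. -/
def loops (σ : Config d) : Finset (HalfEdge d) :=
  Finset.univ.filter fun a => (σ.1 a).1 = a.1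

lemma mem_loops {σ : Config d} {a : HalfEdge d} : a ∈ loops σ ↔ (σ.1 a).1 = a.1 := by
  simp [loops]

/-- The half-edges in multiple edges that are not loops. -/
def multiples (σ : Config d) : Finset (HalfEdge d) := badSet σ \ loops σ

lemma mem_multiples {σ : Config d} {a : HalfEdge d} :
    a ∈ multiples σ ↔ IsBad σ a ∧ (σ.1 a).1 ≠ a.1 := by
  simp [multiples, mem_badSet, mem_loops]

lemma loops_subset_badSet (σ : Config d) : loops σ ⊆ badSet σ := fun _ ha =>
  mem_badSet.2 (isBad_of_loop (mem_loops.1 ha))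

lemma card_loops_add_card_multiples (σ : Config d) :
    (loops σ).card + (multiples σ).card = (badSet σ).card := by
  rw [multiples, add_comm, Finset.card_sdiff_add_card_eq_card (loops_subset_badSet σ)]

/-- The configuration has at most single loops and double edges. -/
def Nice (σ : Config d) : Prop := ∀ a, (par σ a).card ≤ 2

instance (σ : Config d) : Decidable (Nice σ) := by unfold Nice; infer_instance

lemma isSimple_iff_badSet {σ : Config d} : IsSimple σ ↔ badSet σ = ∅ := by
  simp [IsSimple, Finset.eq_empty_iff_forall_notMem, mem_badSet]

section Apply

variable {σ : Config d} {a c : HalfEdge d}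

lemma switch_val (x : HalfEdge d) : (switch σ a c).1 x =
    Equiv.swap (σ.1 a) (σ.1 c) (σ.1 (Equiv.swap (σ.1 a) (σ.1 c) x)) := rfl

lemma switch_apply_left (h2 : c ≠ σ.1 a) : (switch σ a c).1 a = σ.1 c := by
  rw [switch_val, Equiv.swap_apply_of_ne_of_ne (σ.partner_ne a).symm, Equiv.swap_apply_left]
  intro h; exact h2 ((σ.partner_eq_iff.1 h.symm))

lemma switch_apply_right (h2 : c ≠ σ.1 a) : (switch σ a c).1 c = σ.1 a := by
  rw [switch_val, Equiv.swap_apply_of_ne_of_ne h2 (σ.partner_ne c).symm, Equiv.swap_apply_right]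

lemma switch_apply_partner_left (h2 : c ≠ σ.1 a) : (switch σ a c).1 (σ.1 a) = c := by
  rw [← switch_apply_right h2, Config.partner_partner]

lemma switch_apply_partner_right (h2 : c ≠ σ.1 a) : (switch σ a c).1 (σ.1 c) = a := by
  rw [← switch_apply_left h2, Config.partner_partner]

lemma switch_apply_of_ne {x : HalfEdge d} (h1 : x ≠ a) (h2 : x ≠ σ.1 a) (h3 : x ≠ c)
    (h4 : x ≠ σ.1 c) : (switch σ a c).1 x = σ.1 x := by
  rw [switch_val, Equiv.swap_apply_of_ne_of_ne h2 h4, Equiv.swap_apply_of_ne_of_ne]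
  · exact fun h => h1 (σ.1.injective h)
  · exact fun h => h3 (σ.1.injective h)

lemma switch_switch (h2 : c ≠ σ.1 a) : switch (switch σ a c) a c = σ := by
  apply Subtype.ext; ext1 x
  rw [switch_val, switch_apply_left h2, switch_apply_right h2, switch_val,
    Equiv.swap_comm (σ.1 c), Equiv.swap_apply_self, Equiv.swap_apply_self]

end Apply

/-- Both sides create the edges `{a, c}` and `{σ a, σ c}`. This carries statements about one end of
a switching over to the other end. -/
lemma switch_partner (σ : Config d) (a c : HalfEdge d) :
    switch σ (σ.1 a) c = switch σ a (σ.1 c) := by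
  apply Subtype.ext; ext1 x
  rw [switch_val, switch_val, σ.partner_partner, σ.partner_partner]
  by_cases h2 : c = a
  · subst h2; rw [Equiv.swap_comm]
  by_cases h3 : c = σ.1 a
  · subst h3; simp
  have h4 : σ.1 a ≠ σ.1 c := fun h => h2 (σ.1.injective h).symm
  have h5 : a ≠ σ.1 c := fun h => h3 (by rw [h, σ.partner_partner])
  have h6 := σ.partner_ne a
  have h7 := σ.partner_ne c
  by_cases x1 : x = a
  · subst x1
    rw [Equiv.swap_apply_left, σ.partner_partner, Equiv.swap_apply_of_ne_of_ne h2 h7.symm,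
      Equiv.swap_apply_of_ne_of_ne h6.symm (Ne.symm h2), Equiv.swap_apply_left]
  by_cases x2 : x = σ.1 c
  · subst x2
    rw [Equiv.swap_apply_right, Equiv.swap_apply_of_ne_of_ne h6 h4,
      Equiv.swap_apply_of_ne_of_ne h4.symm h7, σ.partner_partner, Equiv.swap_apply_right]
  by_cases x3 : x = σ.1 a
  · subst x3
    rw [Equiv.swap_apply_of_ne_of_ne h6 h4, σ.partner_partner, Equiv.swap_apply_left,
      Equiv.swap_apply_left, Equiv.swap_apply_of_ne_of_ne h4.symm h7]
  by_cases x4 : x = c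
  · subst x4
    rw [Equiv.swap_apply_of_ne_of_ne h2 h7.symm, Equiv.swap_apply_right, Equiv.swap_apply_right,
      σ.partner_partner, Equiv.swap_apply_of_ne_of_ne h6.symm (Ne.symm h2)]
  rw [Equiv.swap_apply_of_ne_of_ne x1 x2, Equiv.swap_apply_of_ne_of_ne x3 x4,
    Equiv.swap_apply_of_ne_of_ne, Equiv.swap_apply_of_ne_of_ne]
  · exact fun h => x1 (σ.1.injective h)
  · exact fun h => x2 (by rw [← h, σ.partner_partner])
  · exact fun h => x3 (by rw [← h, σ.partner_partner])
  · exact fun h => x4 (σ.1.injective h)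

/-- Two switchings of disjoint pairs of edges commute. -/
lemma switch_comm {σ : Config d} {a c b e : HalfEdge d}
    (h1 : b ≠ a) (h2 : b ≠ σ.1 a) (h3 : b ≠ c) (h4 : b ≠ σ.1 c)
    (h5 : e ≠ a) (h6 : e ≠ σ.1 a) (h7 : e ≠ c) (h8 : e ≠ σ.1 c) :
    switch (switch σ a c) b e = switch (switch σ b e) a c := by
  have i : ∀ {x y : HalfEdge d}, x ≠ y → σ.1 x ≠ σ.1 y := fun h h' => h (σ.1.injective h')
  have i' : ∀ {x y : HalfEdge d}, x ≠ σ.1 y → σ.1 x ≠ y := fun h h' => h (σ.partner_eq_iff.1 h')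
  have hb' := switch_apply_of_ne (σ := σ) h1 h2 h3 h4
  have he' := switch_apply_of_ne (σ := σ) h5 h6 h7 h8
  have ha' := switch_apply_of_ne (σ := σ) (a := b) (c := e) (x := a) h1.symm (i' h2).symm h5.symm
    (i' h6).symm
  have hc' := switch_apply_of_ne (σ := σ) (a := b) (c := e) (x := c) h3.symm (i' h4).symm h7.symm
    (i' h8).symm
  apply Subtype.ext; ext1 x
  have key : Commute (Equiv.swap (σ.1 a) (σ.1 c)) (Equiv.swap (σ.1 b) (σ.1 e)) := by
    have : Equiv.Perm.Disjoint (Equiv.swap (σ.1 a) (σ.1 c)) (Equiv.swap (σ.1 b) (σ.1 e)) := by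
      intro y
      by_cases hy : y = σ.1 a ∨ y = σ.1 c
      · right
        apply Equiv.swap_apply_of_ne_of_ne
        · rintro rfl; rcases hy with hy | hy
          · exact i h1 hy
          · exact i h3 hy
        · rintro rfl; rcases hy with hy | hy
          · exact i h5 hy
          · exact i h7 hy
      · push Not at hy
        left; exact Equiv.swap_apply_of_ne_of_ne hy.1 hy.2
    exact this.commute
  have k2 : ∀ y, Equiv.swap (σ.1 a) (σ.1 c) (Equiv.swap (σ.1 b) (σ.1 e) y) =
      Equiv.swap (σ.1 b) (σ.1 e) (Equiv.swap (σ.1 a) (σ.1 c) y) := fun y =>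
    congrArg (fun p : Equiv.Perm (HalfEdge d) => p y) key.eq
  rw [switch_val (σ := switch σ a c), switch_val (σ := switch σ b e), ha', hc', hb', he',
    switch_val, switch_val, k2, k2]

/-- The switching of `{a, σ a}` with `{c, σ c}` removes exactly one loop or one double edge, and
creates no bad edge. -/
structure GoodSwitch (σ : Config d) (a c : HalfEdge d) : Prop where
  ne_left : c ≠ a
  ne_right : c ≠ σ.1 a
  not_bad : ¬ IsBad σ c
  card_par : (par σ a).card = 2
  not_bad_left : ¬ IsBad (switch σ a c) a
  not_bad_right : ¬ IsBad (switch σ a c) c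

namespace GoodSwitch

variable {σ : Config d} {a c : HalfEdge d}

lemma isBad (h : GoodSwitch σ a c) : IsBad σ a := isBad_iff_card.2 h.card_par.ge

lemma not_mem (h : GoodSwitch σ a c) {x : HalfEdge d} (hx : IsBad (switch σ a c) x) :
    x ≠ a ∧ x ≠ σ.1 a ∧ x ≠ c ∧ x ≠ σ.1 c := by
  refine ⟨?_, ?_, ?_, ?_⟩
  · rintro rfl; exact h.not_bad_left hx
  · rintro rfl
    rw [← switch_apply_right h.ne_right, isBad_partner] at hx
    exact h.not_bad_right hx
  · rintro rfl; exact h.not_bad_right hx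
  · rintro rfl
    rw [← switch_apply_left h.ne_right, isBad_partner] at hx
    exact h.not_bad_left hx

/-- The new edges are not bad, so an edge that is bad afterwards, and all edges parallel to it, were
left untouched by the switching. -/
lemma par_subset (h : GoodSwitch σ a c) {x : HalfEdge d} (hx : IsBad (switch σ a c) x) :
    par (switch σ a c) x ⊆ par σ x := by
  intro y hy
  have hx' := h.not_mem hx
  have hy' := h.not_mem ((isBad_of_mem_par hy).2 hx)
  rw [mem_par, switch_apply_of_ne hx'.1 hx'.2.1 hx'.2.2.1 hx'.2.2.2,
    switch_apply_of_ne hy'.1 hy'.2.1 hy'.2.2.1 hy'.2.2.2] at hy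
  exact mem_par.2 hy

lemma not_isBad_right (h : GoodSwitch σ a c) {x : HalfEdge d} (hx : IsBad σ x) :
    x ≠ c ∧ x ≠ σ.1 c := by
  constructor
  · rintro rfl; exact h.not_bad hx
  · rintro rfl; exact h.not_bad (isBad_partner.1 hx)

lemma par_eq (h : GoodSwitch σ a c) {x : HalfEdge d} (hx : x ∉ par σ a)
    (hx' : x ∉ par σ (σ.1 a)) (hxb : IsBad σ x) : par (switch σ a c) x = par σ x := by
  have h0 : ∀ y ∈ par σ x, (switch σ a c).1 y = σ.1 y := by
    intro y hy
    have hc := h.not_isBad_right ((isBad_of_mem_par hy).2 hxb)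
    apply switch_apply_of_ne _ _ hc.1 hc.2
    · rintro rfl; exact hx (mem_par_comm.1 hy)
    · rintro rfl; exact hx' (mem_par_comm.1 hy)
  have hxs := h0 x (self_mem_par σ x)
  have hsub : par σ x ⊆ par (switch σ a c) x := by
    intro y hy
    have := h0 y hy
    rw [mem_par, this, hxs]; exact mem_par.1 hy
  apply Finset.Subset.antisymm _ hsub
  apply h.par_subset
  obtain ⟨y, hy, hyx⟩ := isBad_iff_exists.1 hxb
  exact isBad_iff_exists.2 ⟨y, hsub hy, hyx⟩

lemma nice_switch (h : GoodSwitch σ a c) (hσ : Nice σ) : Nice (switch σ a c) := by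
  intro x
  by_cases hx : IsBad (switch σ a c) x
  · exact (Finset.card_le_card (h.par_subset hx)).trans (hσ x)
  · rw [isBad_iff_card] at hx; omega

/-- Needed for counting from below, where σ arises from a nice configuration by a reverse switching:
only the class of `{a, σ a}` is new, and it has size 2. -/
lemma nice_of_switch (h : GoodSwitch σ a c) (hτ : Nice (switch σ a c)) : Nice σ := by
  intro x
  by_cases hxb : IsBad σ x
  · by_cases h1 : x ∈ par σ a
    · rw [par_eq_of_mem h1, h.card_par]
    by_cases h2 : x ∈ par σ (σ.1 a)
    · rw [par_eq_of_mem h2, card_par_partner, h.card_par]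
    rw [← h.par_eq h1 h2 hxb]; exact hτ x
  · rw [isBad_iff_card] at hxb; omega

/-- A good switching removes the edges parallel to `{a, σ a}` from the bad ones. -/
lemma isBad_switch (h : GoodSwitch σ a c) {x : HalfEdge d} : IsBad (switch σ a c) x ↔
    IsBad σ x ∧ x ∉ par σ a ∧ x ∉ par σ (σ.1 a) := by
  constructor
  · intro hx
    have hx' := h.not_mem hx
    have hsub := h.par_subset hx
    obtain ⟨y, hy, hyx⟩ := isBad_iff_exists.1 hx
    have hy' := h.not_mem ((isBad_of_mem_par hy).2 hx)
    refine ⟨isBad_iff_exists.2 ⟨y, hsub hy, hyx⟩, fun hxa => ?_, fun hxa => ?_⟩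
    · have hya : y ∈ par σ a := by rw [← par_eq_of_mem hxa]; exact hsub hy
      -- If x were parallel to a, then x, its surviving parallel y and a itself would be three
      -- members of a class of size 2.
      have : ({x, y, a} : Finset (HalfEdge d)) ⊆ par σ a := by
        intro z hz
        simp only [Finset.mem_insert, Finset.mem_singleton] at hz
        rcases hz with rfl | rfl | rfl
        exacts [hxa, hya, self_mem_par _ _]
      have h3 := Finset.card_le_card this
      rw [h.card_par, Finset.card_eq_three.2 ⟨x, y, a, hyx.symm, hx'.1, hy'.1, rfl⟩] at h3
      omega
    · have hya : y ∈ par σ (σ.1 a) := by rw [← par_eq_of_mem hxa]; exact hsub hy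
      have : ({x, y, σ.1 a} : Finset (HalfEdge d)) ⊆ par σ (σ.1 a) := by
        intro z hz
        simp only [Finset.mem_insert, Finset.mem_singleton] at hz
        rcases hz with rfl | rfl | rfl
        exacts [hxa, hya, self_mem_par _ _]
      have h3 := Finset.card_le_card this
      rw [card_par_partner, h.card_par,
        Finset.card_eq_three.2 ⟨x, y, σ.1 a, hyx.symm, hx'.2.1, hy'.2.1, rfl⟩] at h3
      omega
  · rintro ⟨hxb, h1, h2⟩
    rw [isBad_iff_card, h.par_eq h1 h2 hxb]
    exact isBad_iff_card.1 hxb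

lemma switch_apply_of_isBad (h : GoodSwitch σ a c) {x : HalfEdge d}
    (hx : IsBad (switch σ a c) x) : (switch σ a c).1 x = σ.1 x := by
  obtain ⟨h1, h2, h3, h4⟩ := h.not_mem hx
  exact switch_apply_of_ne h1 h2 h3 h4

lemma loops_switch (h : GoodSwitch σ a c) :
    loops (switch σ a c) = loops σ \ (par σ a ∪ par σ (σ.1 a)) := by
  ext x
  rw [Finset.mem_sdiff, Finset.mem_union, not_or, mem_loops, mem_loops]
  constructor
  · intro hx
    have hb := isBad_of_loop hx
    rw [h.switch_apply_of_isBad hb] at hx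
    exact ⟨hx, (h.isBad_switch.1 hb).2⟩
  · rintro ⟨hx, h1⟩
    rw [h.switch_apply_of_isBad (h.isBad_switch.2 ⟨isBad_of_loop hx, h1⟩)]
    exact hx

lemma badSet_switch (h : GoodSwitch σ a c) :
    badSet (switch σ a c) = badSet σ \ (par σ a ∪ par σ (σ.1 a)) := by
  ext x
  rw [Finset.mem_sdiff, Finset.mem_union, not_or, mem_badSet, mem_badSet, h.isBad_switch]

lemma multiples_switch (h : GoodSwitch σ a c) :
    multiples (switch σ a c) = multiples σ \ (par σ a ∪ par σ (σ.1 a)) := by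
  rw [multiples, multiples, h.badSet_switch, h.loops_switch]
  ext x; simp only [Finset.mem_sdiff]; tauto

lemma card_badSet_switch_le (h : GoodSwitch σ a c) :
    (badSet (switch σ a c)).card ≤ (badSet σ).card := by
  rw [h.badSet_switch]; exact Finset.card_le_card Finset.sdiff_subset

lemma card_loops_of_loop (h : GoodSwitch σ a c) (ha : (σ.1 a).1 = a.1) :
    (loops (switch σ a c)).card + 2 = (loops σ).card ∧
      (multiples (switch σ a c)).card = (multiples σ).card := by
  have h1 : par σ (σ.1 a) = par σ a := par_eq_of_mem (mem_par.2 (by simp [ha]))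
  have h2 : par σ a ⊆ loops σ := by
    intro x hx
    rw [mem_par] at hx; rw [mem_loops, hx.1, hx.2, ha]
  rw [h.loops_switch, h.multiples_switch, h1, Finset.union_self]
  constructor
  · rw [← h.card_par, Finset.card_sdiff_add_card_eq_card h2]
  · rw [Finset.sdiff_eq_self_of_disjoint]
    exact Finset.disjoint_left.2 fun x hx hx' => (Finset.mem_sdiff.1 hx).2 (h2 hx')

lemma card_loops_of_not_loop (h : GoodSwitch σ a c) (ha : (σ.1 a).1 ≠ a.1) :
    (loops (switch σ a c)).card = (loops σ).card ∧
      (multiples (switch σ a c)).card + 4 = (multiples σ).card := by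
  have h0 : Disjoint (par σ a) (par σ (σ.1 a)) := Finset.disjoint_left.2 fun x hx hx' => by
    rw [mem_par] at hx hx'; exact ha (hx'.1.symm.trans hx.1)
  have h4 : (par σ a ∪ par σ (σ.1 a)).card = 4 := by
    rw [Finset.card_union_of_disjoint h0, card_par_partner, h.card_par]
  have h1 : ∀ x ∈ par σ a ∪ par σ (σ.1 a), IsBad σ x ∧ (σ.1 x).1 ≠ x.1 := by
    intro x hx
    rcases Finset.mem_union.1 hx with hx | hx
    · refine ⟨(isBad_of_mem_par hx).2 h.isBad, ?_⟩
      rw [mem_par] at hx; rw [hx.1, hx.2]; exact ha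
    · refine ⟨(isBad_of_mem_par hx).2 (isBad_partner.2 h.isBad), ?_⟩
      rw [mem_par] at hx; rw [hx.1, hx.2]; simpa using ha.symm
  rw [h.loops_switch, h.multiples_switch]
  constructor
  · rw [Finset.sdiff_eq_self_of_disjoint]
    exact Finset.disjoint_left.2 fun x hx hx' => (h1 x hx').2 (mem_loops.1 hx)
  · rw [← h4, Finset.card_sdiff_add_card_eq_card]
    exact fun x hx => mem_multiples.2 (h1 x hx)

end GoodSwitch

end Switching

/-! ### Criteria for a switching, or its reverse, to be good -/

section GoodSwitches

variable {n : ℕ} {d : Fin n → ℕ}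

/-- The vertices `i` and `j` are equal or joined by an edge of the configuration. -/
def Near (σ : Config d) (i j : Fin n) : Prop :=
  i = j ∨ ∃ x : HalfEdge d, x.1 = i ∧ (σ.1 x).1 = j

instance (σ : Config d) (i j : Fin n) : Decidable (Near σ i j) := by unfold Near; infer_instance

lemma switch_swap (σ : Config d) (a c : HalfEdge d) : switch σ c a = switch σ a c := by
  apply Subtype.ext; ext1 x
  rw [switch_val, switch_val, Equiv.swap_comm]

/-- An untouched edge parallel to `{a, σ c}` would make its two vertices near. The other new edge
`{c, σ a}` can be parallel to it only if the edge of c was a loop or parallel to that of a, hence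
bad. -/
lemma not_isBad_switch_left {σ : Config d} {a c : HalfEdge d} (h2 : c ≠ σ.1 a)
    (hc : ¬ IsBad σ c) (hnear : ¬ Near σ a.1 (σ.1 c).1) : ¬ IsBad (switch σ a c) a := by
  rw [isBad_iff_exists]
  rintro ⟨z, hz, hza⟩
  rw [mem_par, switch_apply_left h2] at hz
  obtain ⟨hz1, hz2⟩ := hz
  have hc' : (σ.1 c).1 ≠ c.1 := fun h => hc (isBad_of_loop h)
  have hcp : ∀ w, w.1 = c.1 → (σ.1 w).1 = (σ.1 c).1 → w = c :=
    fun w h h' => eq_of_mem_par hc (mem_par.2 ⟨h, h'⟩)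
  unfold Near at hnear
  push Not at hnear
  by_cases h4 : z = σ.1 c
  · subst h4; exact hnear.1 hz1.symm
  by_cases h3 : z = c
  · subst h3
    rw [switch_apply_right h2] at hz2
    have := hcp a hz1.symm hz2
    exact hza this.symm
  by_cases h1 : z = σ.1 a
  · subst h1
    rw [switch_apply_partner_left h2] at hz2
    exact hc' hz2.symm
  · rw [switch_apply_of_ne hza h1 h3 h4] at hz2
    exact hnear.2 z hz1 hz2

lemma goodSwitch_of_not_near {σ : Config d} {a c : HalfEdge d} (ha : (par σ a).card = 2)
    (hc : ¬ IsBad σ c) (h1 : ¬ Near σ a.1 (σ.1 c).1) (h2 : ¬ Near σ (σ.1 a).1 c.1) :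
    GoodSwitch σ a c := by
  have hab : IsBad σ a := isBad_iff_card.2 ha.ge
  have hca : c ≠ a := by rintro rfl; exact hc hab
  have hca' : c ≠ σ.1 a := by rintro rfl; exact hc (isBad_partner.2 hab)
  refine ⟨hca, hca', hc, ha, not_isBad_switch_left hca' hc h1, ?_⟩
  rw [← isBad_partner, switch_apply_right hca']
  have := not_isBad_switch_left (σ := σ) (a := σ.1 a) (c := σ.1 c)
    (fun h => hca' (σ.1.injective h)) (fun h => hc (isBad_partner.1 h)) (by simpa using h2)
  rwa [switch_partner, σ.partner_partner] at this

/-- Switching is an involution, so the switching back restores the edges of a and c in τ, which are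
not bad. The byproduct `{c, τ a}` must also not be bad, and this is what `hnear` ensures. -/
lemma goodSwitch_switch {τ : Config d} {a c : HalfEdge d} (h1 : c ≠ a) (h2 : c ≠ τ.1 a)
    (ha : ¬ IsBad τ a) (hc : ¬ IsBad τ c) (hnear : ¬ Near τ c.1 (τ.1 a).1)
    (hcard : (par (switch τ a c) a).card = 2) : GoodSwitch (switch τ a c) a c := by
  refine ⟨h1, ?_, ?_, hcard, ?_, ?_⟩
  · rw [switch_apply_left h2]; exact (τ.partner_ne c).symm
  · rw [← switch_swap]
    exact not_isBad_switch_left (fun h => h2 (τ.partner_eq_iff.1 h.symm)) ha hnear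
  · rwa [switch_switch h2]
  · rwa [switch_switch h2]

/-- The condition `hl` keeps the created loop from meeting another one. The condition `htri`
excludes a triangle, whose third side would become parallel to the byproduct `{c, τ a}`. -/
lemma goodSwitch_switch_loop {τ : Config d} {a c : HalfEdge d} (hca : τ.1 c ≠ a)
    (hv : (τ.1 c).1 = a.1) (ha : ¬ IsBad τ a) (hc : ¬ IsBad τ c)
    (hl : ∀ z : HalfEdge d, z.1 = a.1 → (τ.1 z).1 ≠ a.1)
    (htri : ∀ z : HalfEdge d, z.1 = c.1 → (τ.1 z).1 ≠ (τ.1 a).1) :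
    GoodSwitch (switch τ a c) a c := by
  have hloop : (τ.1 a).1 ≠ a.1 := hl a rfl
  have hloopc : (τ.1 c).1 ≠ c.1 := fun h => hc (isBad_of_loop h)
  have h2 : c ≠ τ.1 a := fun h => hca (τ.partner_eq_iff.2 (by rw [← h]))
  have h1 : c ≠ a := by rintro rfl; exact hloop hv
  have hpar : ∀ w, w.1 = a.1 → (τ.1 w).1 = (τ.1 a).1 → w = a :=
    fun w h h' => eq_of_mem_par ha (mem_par.2 ⟨h, h'⟩)
  refine goodSwitch_switch h1 h2 ha hc ?_ ?_
  · rintro (h | ⟨x, hx, hx'⟩)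
    · exact hca (hpar _ hv (by simpa using h))
    · exact htri x hx hx'
  · have : par (switch τ a c) a = {a, τ.1 c} := by
      ext z
      rw [mem_par, switch_apply_left h2, Finset.mem_insert, Finset.mem_singleton]
      constructor
      · rintro ⟨hz1, hz2⟩
        by_contra hz
        push Not at hz
        by_cases h3 : z = c
        · subst h3; exact hloopc (hv.trans hz1.symm)
        by_cases h4 : z = τ.1 a
        · subst h4; exact hloop hz1
        rw [switch_apply_of_ne hz.1 h4 h3 hz.2] at hz2
        exact hl z hz1 (hz2.trans hv)
      · rintro (rfl | rfl)
        · exact ⟨rfl, by rw [switch_apply_left h2]⟩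
        · exact ⟨hv, by rw [switch_apply_partner_right h2, hv]⟩
    rw [this, Finset.card_pair hca.symm]

/-- Here the byproduct `{c, τ a}` is a loop if the three edges form a triangle (`hce`) and is
parallel to an old edge if they lie in a cycle of length four (`hcyc`). The last conclusion
identifies the double edge, so that a' can be recovered from the switched configuration. -/
lemma goodSwitch_switch_multiple {τ : Config d} {a a' c : HalfEdge d} (haa : a ≠ a')
    (hv : a.1 = a'.1) (hca : c ≠ a') (hv' : (τ.1 c).1 = (τ.1 a').1)
    (ha : ¬ IsBad τ a) (ha' : ¬ IsBad τ a') (hc : ¬ IsBad τ c) (hce : c.1 ≠ (τ.1 a).1)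
    (hcyc : ∀ z : HalfEdge d, z.1 = c.1 → (τ.1 z).1 ≠ (τ.1 a).1) :
    GoodSwitch (switch τ a c) a c ∧ (τ.1 c).1 ≠ a.1 ∧ par (switch τ a c) a = {a, a'} := by
  have hloop : (τ.1 a).1 ≠ a.1 := fun h => ha (isBad_of_loop h)
  have hloop' : (τ.1 a').1 ≠ a'.1 := fun h => ha' (isBad_of_loop h)
  have hloopc : (τ.1 c).1 ≠ c.1 := fun h => hc (isBad_of_loop h)
  have h1 : c.1 ≠ a.1 := fun h => hca (eq_of_mem_par ha' (mem_par.2 ⟨h.trans hv, hv'⟩))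
  have h2 : c ≠ τ.1 a := by rintro rfl; exact hce rfl
  have hpar : par (switch τ a c) a = {a, a'} := by
    ext z
    rw [mem_par, switch_apply_left h2, Finset.mem_insert, Finset.mem_singleton]
    constructor
    · rintro ⟨hz1, hz2⟩
      by_contra hz
      push Not at hz
      by_cases h3 : z = c
      · subst h3; exact h1 hz1
      by_cases h4 : z = τ.1 a
      · subst h4; exact hloop hz1
      by_cases h5 : z = τ.1 c
      · subst h5; exact hloop' ((hv'.symm.trans hz1).trans hv)
      rw [switch_apply_of_ne hz.1 h4 h3 h5] at hz2
      exact hz.2 (eq_of_mem_par ha' (mem_par.2 ⟨hz1.trans hv, hz2.trans hv'⟩))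
    · rintro (rfl | rfl)
      · exact ⟨rfl, by rw [switch_apply_left h2]⟩
      · refine ⟨hv.symm, ?_⟩
        rw [switch_apply_of_ne haa.symm _ hca.symm _, hv']
        · rintro rfl; exact hloop hv.symm
        · rintro rfl; apply hloop'; rw [← hv']
  refine ⟨goodSwitch_switch (fun h => h1 (by rw [h])) h2 ha hc ?_ ?_, ?_, hpar⟩
  · rintro (h | ⟨x, hx, hx'⟩)
    · exact hce h
    · exact hcyc x hx hx'
  · rw [hpar, Finset.card_pair haa]
  · rw [hv', hv]; exact hloop'

end GoodSwitches

/-! ### Counting the switchings that fail to be good -/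

section Exceptional

variable {n : ℕ} {d : Fin n → ℕ}

lemma card_halfEdge_fiber (i : Fin n) :
    (Finset.univ.filter fun e : HalfEdge d => e.1 = i).card = d i := by
  rw [show (Finset.univ.filter fun e : HalfEdge d => e.1 = i) =
    Finset.univ.map ⟨fun k : Fin (d i) => (⟨i, k⟩ : HalfEdge d), fun a b h => by simpa using h⟩ from ?_]
  · simp
  · ext ⟨j, k⟩
    simp only [Finset.mem_filter, Finset.mem_univ, true_and, Finset.mem_map]
    constructor
    · rintro rfl; exact ⟨k, rfl⟩
    · rintro ⟨k', h⟩; exact (congrArg Sigma.fst h).symm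

/-- At most `Δ + Δ ^ 2` half-edges are near a given vertex. -/
lemma card_near_le {Δ : ℕ} (hΔ : ∀ i, d i ≤ Δ) (σ : Config d) (i : Fin n) :
    (Finset.univ.filter fun e : HalfEdge d => Near σ i e.1).card ≤ Δ + Δ * Δ := by
  have : (Finset.univ.filter fun e : HalfEdge d => Near σ i e.1) ⊆
      (Finset.univ.filter fun e : HalfEdge d => e.1 = i) ∪
      (Finset.univ.filter fun e : HalfEdge d => e.1 = i).biUnion fun x =>
        Finset.univ.filter fun e : HalfEdge d => e.1 = (σ.1 x).1 := by
    intro e he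
    simp only [Finset.mem_filter, Finset.mem_univ, true_and, Finset.mem_union,
      Finset.mem_biUnion] at he ⊢
    rcases he with he | ⟨x, hx, hx'⟩
    · exact Or.inl he.symm
    · exact Or.inr ⟨x, hx, hx'.symm⟩
  refine (Finset.card_le_card this).trans ((Finset.card_union_le _ _).trans ?_)
  gcongr
  · rw [card_halfEdge_fiber]; exact hΔ i
  · refine (Finset.card_biUnion_le_card_mul _ _ Δ ?_).trans ?_
    · intro x _; rw [card_halfEdge_fiber]; exact hΔ _
    · rw [card_halfEdge_fiber]; exact Nat.mul_le_mul_right _ (hΔ i)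

/-- Besides the bad half-edges, c has to avoid those for which one of the two new edges would join
vertices that are equal or already adjacent. Each of the two new edges excludes at most Δ + Δ²
half-edges. -/
lemma exists_exceptional {Δ K : ℕ} (hΔ : ∀ i, d i ≤ Δ) {σ : Config d} (hσ : Nice σ)
    (hK : (badSet σ).card ≤ K) {a : HalfEdge d} (ha : IsBad σ a) :
    ∃ X : Finset (HalfEdge d), X.card ≤ K + 2 * (Δ + Δ * Δ) ∧ ∀ c ∉ X, GoodSwitch σ a c := by
  refine ⟨badSet σ ∪ ((Finset.univ.filter fun c : HalfEdge d => Near σ a.1 (σ.1 c).1) ∪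
    Finset.univ.filter fun c : HalfEdge d => Near σ (σ.1 a).1 c.1), ?_, ?_⟩
  · refine (Finset.card_union_le _ _).trans (Nat.add_le_add hK
      ((Finset.card_union_le _ _).trans ?_))
    have h1 : (Finset.univ.filter fun c : HalfEdge d => Near σ a.1 (σ.1 c).1).card =
        (Finset.univ.filter fun c : HalfEdge d => Near σ a.1 c.1).card :=
      Finset.card_bij' (fun x _ => σ.1 x) (fun x _ => σ.1 x) (by simp) (by simp) (by simp) (by simp)
    rw [h1]
    have := card_near_le hΔ σ a.1
    have := card_near_le hΔ σ (σ.1 a).1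
    omega
  · intro c hc
    simp only [Finset.mem_union, Finset.mem_filter, Finset.mem_univ, true_and, not_or,
      mem_badSet] at hc
    exact goodSwitch_of_not_near (le_antisymm (hσ a) (isBad_iff_card.1 ha)) hc.1 hc.2.1 hc.2.2

/-- The ordered pairs of distinct half-edges at the same vertex. -/
def siblings (d : Fin n → ℕ) : Finset (HalfEdge d × HalfEdge d) :=
  Finset.univ.filter fun p => p.1 ≠ p.2 ∧ p.1.1 = p.2.1

lemma mem_siblings {p : HalfEdge d × HalfEdge d} :
    p ∈ siblings d ↔ p.1 ≠ p.2 ∧ p.1.1 = p.2.1 := by simp [siblings]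

/-- The pairs `(a, c)` such that switching `τ` at them creates a loop `{a, τ c}`. -/
def loopPairs (τ : Config d) : Finset (HalfEdge d × HalfEdge d) :=
  Finset.univ.filter fun p => τ.1 p.2 ≠ p.1 ∧ (τ.1 p.2).1 = p.1.1

lemma mem_loopPairs {τ : Config d} {p : HalfEdge d × HalfEdge d} :
    p ∈ loopPairs τ ↔ τ.1 p.2 ≠ p.1 ∧ (τ.1 p.2).1 = p.1.1 := by simp [loopPairs]

/-- The number of ways to create a loop does not depend on the configuration, which is why loops
need no concentration estimate. -/
lemma card_loopPairs (τ : Config d) : (loopPairs τ).card = (siblings d).card :=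
  Finset.card_bij' (fun p _ => (p.1, τ.1 p.2)) (fun p _ => (p.1, τ.1 p.2))
    (fun p hp => by rw [mem_loopPairs] at hp; exact mem_siblings.2 ⟨hp.1.symm, hp.2.symm⟩)
    (fun p hp => by
      rw [mem_siblings] at hp
      exact mem_loopPairs.2 ⟨by simpa using hp.1.symm, by simpa using hp.2.symm⟩)
    (by simp) (by simp)

/-- The triples `(a, a', c)` such that switching `τ` at `(a, c)` creates an edge `{a, τ c}`
parallel to the edge of `a'`. -/
def multiTriples (τ : Config d) : Finset (HalfEdge d × HalfEdge d × HalfEdge d) :=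
  Finset.univ.filter fun p => p.1 ≠ p.2.1 ∧ p.1.1 = p.2.1.1 ∧ p.2.2 ≠ p.2.1 ∧
    (τ.1 p.2.2).1 = (τ.1 p.2.1).1

lemma mem_multiTriples {τ : Config d} {p : HalfEdge d × HalfEdge d × HalfEdge d} :
    p ∈ multiTriples τ ↔ p.1 ≠ p.2.1 ∧ p.1.1 = p.2.1.1 ∧ p.2.2 ≠ p.2.1 ∧
    (τ.1 p.2.2).1 = (τ.1 p.2.1).1 := by simp [multiTriples]

/-- The triangles of `τ`. -/
def triangles (τ : Config d) :
    Finset ((HalfEdge d × HalfEdge d) × (HalfEdge d × HalfEdge d) × (HalfEdge d × HalfEdge d)) :=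
  (siblings d ×ˢ siblings d ×ˢ siblings d).filter fun t =>
    (t.1.1.1 ≠ t.2.1.1.1 ∧ t.2.1.1.1 ≠ t.2.2.1.1 ∧ t.2.2.1.1 ≠ t.1.1.1) ∧
    τ.1 t.1.2 = t.2.1.1 ∧ τ.1 t.2.1.2 = t.2.2.1 ∧ τ.1 t.2.2.2 = t.1.1

/-- The cycles of length four of `τ`. -/
def fourCycles (τ : Config d) :
    Finset ((HalfEdge d × HalfEdge d) × (HalfEdge d × HalfEdge d) × (HalfEdge d × HalfEdge d) ×
      (HalfEdge d × HalfEdge d)) :=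
  (siblings d ×ˢ siblings d ×ˢ siblings d ×ˢ siblings d).filter fun t =>
    (t.1.1.1 ≠ t.2.1.1.1 ∧ t.1.1.1 ≠ t.2.2.1.1.1 ∧ t.1.1.1 ≠ t.2.2.2.1.1 ∧
      t.2.1.1.1 ≠ t.2.2.1.1.1 ∧ t.2.1.1.1 ≠ t.2.2.2.1.1 ∧ t.2.2.1.1.1 ≠ t.2.2.2.1.1) ∧
    τ.1 t.1.2 = t.2.1.1 ∧ τ.1 t.2.1.2 = t.2.2.1.1 ∧ τ.1 t.2.2.1.2 = t.2.2.2.1 ∧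
      τ.1 t.2.2.2.2 = t.1.1

lemma card_biUnion_badSet_le {K m : ℕ} {τ : Config d} (hK : (badSet τ).card ≤ K)
    {κ : Type*} [DecidableEq κ] (f : HalfEdge d → Finset κ) (h : ∀ x, (f x).card ≤ m) :
    ((badSet τ).biUnion f).card ≤ K * m :=
  (Finset.card_biUnion_le_card_mul _ _ m fun x _ => h x).trans (Nat.mul_le_mul_right _ hK)

/-- The half-edges at a vertex. -/
def halfEdgesAt (d : Fin n → ℕ) (i : Fin n) : Finset (HalfEdge d) :=
  Finset.univ.filter fun e : HalfEdge d => e.1 = i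

lemma mem_halfEdgesAt {i : Fin n} {e : HalfEdge d} : e ∈ halfEdgesAt d i ↔ e.1 = i := by
  simp [halfEdgesAt]

lemma card_halfEdgesAt (i : Fin n) : (halfEdgesAt d i).card = d i := card_halfEdge_fiber i

-- A pair fails only if the edge of a or of c is bad, if there is already a loop at the vertex of a,
-- or if a triangle is present. A bad half-edge is responsible for at most Δ² pairs in each of the
-- first three cases.
open Classical in
lemma card_bad_loopPairs_le {Δ K : ℕ} (hΔ : ∀ i, d i ≤ Δ) {τ : Config d}
    (hK : (badSet τ).card ≤ K) :
    ((loopPairs τ).filter fun p => ¬ GoodSwitch (switch τ p.1 p.2) p.1 p.2).card ≤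
      3 * (K * (Δ * Δ)) + (triangles τ).card := by
  have hΔ' : ∀ i, (halfEdgesAt d i).card ≤ Δ := fun i => (card_halfEdgesAt i).trans_le (hΔ i)
  have h1 := card_biUnion_badSet_le hK
    (fun a => (halfEdgesAt d a.1).image fun b => (a, τ.1 b))
    (fun x => (Finset.card_image_le.trans (hΔ' _)).trans (Nat.le_mul_self Δ))
  have h2 := card_biUnion_badSet_le hK
    (fun c => (halfEdgesAt d (τ.1 c).1).image fun a => (a, c))
    (fun x => (Finset.card_image_le.trans (hΔ' _)).trans (Nat.le_mul_self Δ))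
  have h3 := card_biUnion_badSet_le hK
    (fun z => (halfEdgesAt d z.1 ×ˢ halfEdgesAt d z.1).image fun p => (p.1, τ.1 p.2))
    (fun x => Finset.card_image_le.trans
      ((Finset.card_product _ _).trans_le (Nat.mul_le_mul (hΔ' _) (hΔ' _))))
  have h4 : ((triangles τ).image fun t => (t.1.1, t.2.1.1)).card ≤ _ := Finset.card_image_le
  refine (Finset.card_le_card (fun p hp => ?_)).trans
    ((Finset.card_union_le _ _).trans (Nat.add_le_add ((Finset.card_union_le _ _).trans
      (Nat.add_le_add ((Finset.card_union_le _ _).trans (Nat.add_le_add h1 h2)) h3)) h4) |>.trans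
      (by omega))
  obtain ⟨a, c⟩ := p
  simp only [Finset.mem_filter, mem_loopPairs] at hp
  obtain ⟨⟨hne, hv⟩, hg⟩ := hp
  simp only [Finset.mem_union, Finset.mem_biUnion, Finset.mem_image, Finset.mem_product,
    mem_badSet, mem_halfEdgesAt]
  by_contra hcon
  simp only [not_or] at hcon
  obtain ⟨⟨⟨n1, n2⟩, n3⟩, n4⟩ := hcon
  have ha : ¬ IsBad τ a := fun h => n1 ⟨a, h, τ.1 c, hv, by simp⟩
  have hc : ¬ IsBad τ c := fun h => n2 ⟨c, h, a, hv.symm, rfl⟩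
  have hloop : (τ.1 a).1 ≠ a.1 := fun h => ha (isBad_of_loop h)
  have hloopc : (τ.1 c).1 ≠ c.1 := fun h => hc (isBad_of_loop h)
  refine hg (goodSwitch_switch_loop hne hv ha hc (fun z hz hz' => n3 ?_) (fun z hz hz' => n4 ?_))
  · exact ⟨z, isBad_of_loop (hz'.trans hz.symm), (a, τ.1 c), ⟨hz.symm, hv.trans hz.symm⟩, by simp⟩
  · refine ⟨((a, τ.1 c), (c, z), (τ.1 z, τ.1 a)), ?_, rfl⟩
    simp only [triangles, Finset.mem_filter, Finset.mem_product, mem_siblings,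
      Config.partner_partner, and_true]
    refine ⟨⟨⟨hne.symm, hv.symm⟩, ⟨?_, hz.symm⟩, ?_, hz'⟩, ?_, ?_, ?_⟩
    · rintro rfl; exact hloop (hz'.symm.trans hv)
    · intro h
      have := τ.1.injective h
      subst this
      exact hloopc (hv.trans hz)
    · exact fun h => hloopc (hv.trans h)
    · intro h
      exact hne (eq_of_mem_par ha (mem_par.2 ⟨hv, by simpa using h.trans hz'⟩))
    · exact fun h => hloop (hz'.symm.trans h)

-- A triple fails only if one of its three edges is bad or if these edges lie in a triangle or a
-- cycle of length four. A bad half-edge in one of the three positions leaves at most Δ² choices for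
-- the other two.
open Classical in
lemma card_bad_multiTriples_le {Δ K : ℕ} (hΔ : ∀ i, d i ≤ Δ) {τ : Config d}
    (hK : (badSet τ).card ≤ K) :
    ((multiTriples τ).filter fun p => ¬ (GoodSwitch (switch τ p.1 p.2.2) p.1 p.2.2 ∧
      (τ.1 p.2.2).1 ≠ p.1.1 ∧ par (switch τ p.1 p.2.2) p.1 = {p.1, p.2.1})).card ≤
      3 * (K * (Δ * Δ)) + ((triangles τ).card + (fourCycles τ).card) := by
  have hΔ' : ∀ i, (halfEdgesAt d i).card ≤ Δ := fun i => (card_halfEdgesAt i).trans_le (hΔ i)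
  have hΔ2 : ∀ i (f : HalfEdge d → Fin n),
      ((halfEdgesAt d i).sigma fun a => halfEdgesAt d (f a)).card ≤ Δ * Δ := by
    intro i f
    rw [Finset.card_sigma]
    exact (Finset.sum_le_card_nsmul _ _ Δ fun x _ => hΔ' _).trans
      (by rw [smul_eq_mul]; exact Nat.mul_le_mul_right _ (hΔ' _))
  have h1 := card_biUnion_badSet_le hK
    (fun a => ((halfEdgesAt d a.1).sigma fun a' => halfEdgesAt d (τ.1 a').1).image
      fun p => (a, p.1, τ.1 p.2)) (fun x => Finset.card_image_le.trans (hΔ2 _ _))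
  have h2 := card_biUnion_badSet_le hK
    (fun a' => ((halfEdgesAt d a'.1).sigma fun _ => halfEdgesAt d (τ.1 a').1).image
      fun p => (p.1, a', τ.1 p.2)) (fun x => Finset.card_image_le.trans (hΔ2 _ _))
  have h3 := card_biUnion_badSet_le hK
    (fun c => ((halfEdgesAt d (τ.1 c).1).sigma fun f => halfEdgesAt d (τ.1 f).1).image
      fun p => (p.2, τ.1 p.1, c)) (fun x => Finset.card_image_le.trans (hΔ2 _ _))
  have h4 : ((triangles τ).image fun t => (t.1.1, t.1.2, t.2.2.1)).card ≤ _ :=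
    Finset.card_image_le
  have h5 : ((fourCycles τ).image fun t => (t.1.1, t.1.2, t.2.2.1.1)).card ≤ _ :=
    Finset.card_image_le
  refine (Finset.card_le_card (fun p hp => ?_)).trans
    ((Finset.card_union_le _ _).trans (Nat.add_le_add ((Finset.card_union_le _ _).trans
      (Nat.add_le_add ((Finset.card_union_le _ _).trans (Nat.add_le_add h1 h2)) h3))
      ((Finset.card_union_le _ _).trans (Nat.add_le_add h4 h5))) |>.trans (by omega))
  obtain ⟨a, a', c⟩ := p
  simp only [Finset.mem_filter, mem_multiTriples] at hp
  obtain ⟨⟨haa, hv, hca, hv'⟩, hg⟩ := hp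
  simp only [Finset.mem_union, Finset.mem_biUnion, Finset.mem_image, Finset.mem_sigma,
    mem_badSet, mem_halfEdgesAt]
  by_contra hcon
  simp only [not_or] at hcon
  obtain ⟨⟨⟨n1, n2⟩, n3⟩, n4, n5⟩ := hcon
  have ha : ¬ IsBad τ a := fun h => n1 ⟨a, h, ⟨a', τ.1 c⟩, ⟨hv.symm, hv'⟩, by simp⟩
  have ha' : ¬ IsBad τ a' := fun h => n2 ⟨a', h, ⟨a, τ.1 c⟩, ⟨hv, hv'⟩, by simp⟩
  have hc : ¬ IsBad τ c := fun h => n3 ⟨c, h, ⟨τ.1 a', a⟩, ⟨hv'.symm, by simpa using hv⟩, by simp⟩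
  have hloop : (τ.1 a).1 ≠ a.1 := fun h => ha (isBad_of_loop h)
  have hloop' : (τ.1 a').1 ≠ a'.1 := fun h => ha' (isBad_of_loop h)
  have hloopc : (τ.1 c).1 ≠ c.1 := fun h => hc (isBad_of_loop h)
  have hac : c.1 ≠ a.1 := fun h => hca (eq_of_mem_par ha' (mem_par.2 ⟨h.trans hv, hv'⟩))
  have hef : (τ.1 a).1 ≠ (τ.1 a').1 := fun h => haa (eq_of_mem_par ha' (mem_par.2 ⟨hv, h⟩))
  have hcf : (τ.1 a').1 ≠ c.1 := fun h => hloopc (hv'.trans h)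
  have hne : τ.1 a' ≠ τ.1 c := fun h => hca (τ.1.injective h).symm
  by_cases hce : c.1 = (τ.1 a).1
  · apply n4
    refine ⟨((a, a'), (τ.1 a', τ.1 c), (c, τ.1 a)), ?_, rfl⟩
    simp only [triangles, Finset.mem_filter, Finset.mem_product, mem_siblings,
      Config.partner_partner, and_true]
    refine ⟨⟨⟨haa, hv⟩, ⟨hne, hv'.symm⟩, ?_, hce⟩, ?_, hcf, hac⟩
    · rintro rfl; apply hloop'; rw [← hv', Config.partner_partner, hv]
    · exact fun h => hloop' (h.symm.trans hv)
  refine hg (goodSwitch_switch_multiple haa hv hca hv' ha ha' hc hce fun z hz hz' => n5 ?_)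
  refine ⟨((a, a'), (τ.1 a', τ.1 c), (c, z), (τ.1 z, τ.1 a)), ?_, rfl⟩
  simp only [fourCycles, Finset.mem_filter, Finset.mem_product, mem_siblings,
      Config.partner_partner, and_true]
  refine ⟨⟨⟨haa, hv⟩, ⟨hne, hv'.symm⟩, ⟨?_, hz.symm⟩, ?_, hz'⟩, ?_, hac.symm, ?_, hcf, ?_, ?_⟩
  · rintro rfl; exact hef (hz'.symm.trans hv')
  · intro h
    have := τ.1.injective h
    subst this
    exact hac hz.symm
  · exact fun h => hloop' (h.symm.trans hv)
  · exact fun h => hloop (hz'.symm.trans h.symm)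
  · exact fun h => hef (hz'.symm.trans h.symm)
  · exact fun h => hce (h.trans hz')

end Exceptional

/-! ### The adversarial value and its near independence of the chosen edge -/

section Value

variable {n : ℕ} {d : Fin n → ℕ}

/-- Relabelling the half-edges of a configuration. -/
def relabel (π : Equiv.Perm (HalfEdge d)) (σ : Config d) : Config d :=
  ⟨π * σ.1 * π⁻¹, fun x => by
    refine ⟨by simp [Equiv.Perm.mul_apply], fun h => σ.partner_ne (π⁻¹ x) ?_⟩
    simp only [Equiv.Perm.mul_apply] at h
    rw [Equiv.Perm.eq_inv_iff_eq]; exact h⟩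

lemma relabel_val (π : Equiv.Perm (HalfEdge d)) (σ : Config d) (x : HalfEdge d) :
    (relabel π σ).1 (π x) = π (σ.1 x) := by
  simp [relabel, Equiv.Perm.mul_apply]

lemma switch_relabel (π : Equiv.Perm (HalfEdge d)) (σ : Config d) (a c : HalfEdge d) :
    switch (relabel π σ) (π a) (π c) = relabel π (switch σ a c) := by
  apply Subtype.ext; ext1 x
  obtain ⟨y, rfl⟩ := π.surjective x
  rw [relabel_val, switch_val, switch_val, relabel_val, relabel_val, π.injective.swap_apply,
    relabel_val, π.injective.swap_apply]

lemma isBad_relabel {π : Equiv.Perm (HalfEdge d)} (hπ : ∀ x, (π x).1 = x.1) {σ : Config d}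
    {a : HalfEdge d} : IsBad (relabel π σ) (π a) ↔ IsBad σ a := by
  rw [isBad_iff_exists, isBad_iff_exists]
  constructor
  · rintro ⟨c, hc, hne⟩
    obtain ⟨c, rfl⟩ := π.surjective c
    rw [mem_par, relabel_val, relabel_val, hπ, hπ, hπ, hπ] at hc
    exact ⟨c, mem_par.2 hc, fun h => hne (by rw [h])⟩
  · rintro ⟨c, hc, hne⟩
    refine ⟨π c, ?_, fun h => hne (π.injective h)⟩
    rw [mem_par, relabel_val, relabel_val, hπ, hπ, hπ, hπ]
    exact mem_par.1 hc

lemma isSimple_relabel {π : Equiv.Perm (HalfEdge d)} (hπ : ∀ x, (π x).1 = x.1) {σ : Config d} :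
    IsSimple (relabel π σ) ↔ IsSimple σ := by
  simp only [IsSimple]
  rw [← π.forall_congr_right]
  simp only [isBad_relabel hπ]

lemma toGraph_relabel {π : Equiv.Perm (HalfEdge d)} (hπ : ∀ x, (π x).1 = x.1) (σ : Config d) :
    toGraph (relabel π σ) = toGraph σ := by
  ext i j
  simp only [toGraph]
  rw [← π.exists_congr_right]
  simp only [relabel_val, hπ]

lemma mem_otherHalfEdges {σ : Config d} {a c : HalfEdge d} :
    c ∈ otherHalfEdges σ a ↔ c ≠ a ∧ c ≠ σ.1 a := by simp [otherHalfEdges]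

lemma card_otherHalfEdges (σ : Config d) (a : HalfEdge d) :
    ((otherHalfEdges σ a).card : ℝ) = (Fintype.card (HalfEdge d) : ℝ) - 2 := by
  have h1 : otherHalfEdges σ a = Finset.univ \ {a, σ.1 a} := by
    ext c; simp [mem_otherHalfEdges]
  have h2 : ({a, σ.1 a} : Finset (HalfEdge d)).card = 2 := Finset.card_pair (σ.partner_ne a).symm
  have h3 := Finset.card_sdiff_add_card_eq_card (Finset.subset_univ {a, σ.1 a})
  rw [← h1, h2, Finset.card_univ] at h3
  rw [← h3]; push_cast; ring

/-- The mean of `F` after switching the edge of `a` with a random other edge. -/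
noncomputable def switchAvg (F : Config d → ℝ) (σ : Config d) (a : HalfEdge d) : ℝ :=
  ((Fintype.card (HalfEdge d) : ℝ) - 2)⁻¹ * ∑ c ∈ otherHalfEdges σ a, F (switch σ a c)

lemma switchAvg_nonneg {F : Config d → ℝ} (h : ∀ σ, 0 ≤ F σ) (σ : Config d)
    (a : HalfEdge d) : 0 ≤ switchAvg F σ a := by
  unfold switchAvg
  rw [← card_otherHalfEdges σ a]
  exact mul_nonneg (by positivity) (Finset.sum_nonneg fun _ _ => h _)

lemma switchAvg_le_one {F : Config d → ℝ} (h : ∀ σ, F σ ≤ 1) (σ : Config d)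
    (a : HalfEdge d) : switchAvg F σ a ≤ 1 := by
  unfold switchAvg
  rw [← card_otherHalfEdges σ a]
  refine (mul_le_mul_of_nonneg_left (Finset.sum_le_sum fun c _ => h (switch σ a c))
    (by positivity)).trans ?_
  rw [Finset.sum_const, nsmul_eq_mul, mul_one]
  exact inv_mul_le_one

lemma switchAvg_partner (F : Config d → ℝ) (σ : Config d) (a : HalfEdge d) :
    switchAvg F σ (σ.1 a) = switchAvg F σ a := by
  unfold switchAvg
  congr 1
  refine Finset.sum_bij' (fun c _ => σ.1 c) (fun c _ => σ.1 c) ?_ ?_ (by simp) (by simp) ?_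
  · intro c hc
    rw [mem_otherHalfEdges] at *
    exact ⟨fun h => hc.1 (by simp [← h]), fun h => hc.2 (by simpa using h)⟩
  · intro c hc
    rw [mem_otherHalfEdges] at *
    exact ⟨fun h => hc.1 (σ.1.injective h), fun h => hc.2 (σ.1.injective h)⟩
  · intro c _
    rw [switch_partner]

lemma switchAvg_relabel {F : Config d → ℝ} {π : Equiv.Perm (HalfEdge d)}
    (hF : ∀ σ, F (relabel π σ) = F σ) (σ : Config d) (a : HalfEdge d) :
    switchAvg F (relabel π σ) (π a) = switchAvg F σ a := by
  unfold switchAvg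
  congr 1
  symm
  refine Finset.sum_bij' (fun c _ => π c) (fun c _ => π⁻¹ c) ?_ ?_ (by simp) (by simp) ?_
  · intro c hc
    rw [mem_otherHalfEdges] at *
    rw [relabel_val]
    exact ⟨fun h => hc.1 (π.injective h), fun h => hc.2 (π.injective h)⟩
  · intro c hc
    rw [mem_otherHalfEdges] at *
    rw [relabel_val] at hc
    exact ⟨fun h => hc.1 (by simp [← h]), fun h => hc.2 (by simp [← h])⟩
  · intro c _
    rw [switch_relabel, hF]

/-- Exchanging two parallel edges, end by end, is a relabelling within vertices that fixes σ and
maps x to y. -/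
lemma switchAvg_of_mem_par {F : Config d → ℝ}
    (hF : ∀ (π : Equiv.Perm (HalfEdge d)), (∀ x, (π x).1 = x.1) → ∀ σ, F (relabel π σ) = F σ)
    {σ : Config d} {x y : HalfEdge d} (hy : y ∈ par σ x) :
    switchAvg F σ y = switchAvg F σ x := by
  by_cases h1 : y = x
  · rw [h1]
  by_cases h2 : y = σ.1 x
  · rw [h2, switchAvg_partner]
  have h3 : σ.1 y ≠ x := fun h => h2 (σ.partner_eq_iff.1 h)
  have h4 : σ.1 y ≠ σ.1 x := fun h => h1 (σ.1.injective h)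
  have hx := σ.partner_ne x
  have hyy := σ.partner_ne y
  rw [mem_par] at hy
  set π : Equiv.Perm (HalfEdge d) := Equiv.swap x y * Equiv.swap (σ.1 x) (σ.1 y) with hπdef
  have hπ : ∀ z, (π z).1 = z.1 := by
    intro z
    rw [hπdef, Equiv.Perm.mul_apply]
    have e1 : ∀ w, (Equiv.swap x y w).1 = w.1 := by
      intro w; rw [Equiv.swap_apply_def]; split_ifs with h h' <;> simp_all
    have e2 : ∀ w, (Equiv.swap (σ.1 x) (σ.1 y) w).1 = w.1 := by
      intro w; rw [Equiv.swap_apply_def]; split_ifs with h h' <;> simp_all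
    rw [e1, e2]
  have p1 : π x = y := by
    rw [hπdef, Equiv.Perm.mul_apply, Equiv.swap_apply_of_ne_of_ne hx.symm h3.symm,
      Equiv.swap_apply_left]
  have p2 : π y = x := by
    rw [hπdef, Equiv.Perm.mul_apply, Equiv.swap_apply_of_ne_of_ne h2 hyy.symm,
      Equiv.swap_apply_right]
  have p3 : π (σ.1 x) = σ.1 y := by
    rw [hπdef, Equiv.Perm.mul_apply, Equiv.swap_apply_left, Equiv.swap_apply_of_ne_of_ne h3 hyy]
  have p4 : π (σ.1 y) = σ.1 x := by
    rw [hπdef, Equiv.Perm.mul_apply, Equiv.swap_apply_right,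
      Equiv.swap_apply_of_ne_of_ne hx (Ne.symm h2)]
  have p5 : ∀ w, w ≠ x → w ≠ y → w ≠ σ.1 x → w ≠ σ.1 y → π w = w := by
    intro w w1 w2 w3 w4
    rw [hπdef, Equiv.Perm.mul_apply, Equiv.swap_apply_of_ne_of_ne w3 w4,
      Equiv.swap_apply_of_ne_of_ne w1 w2]
  have hσ : relabel π σ = σ := by
    apply Subtype.ext; ext1 z
    obtain ⟨w, rfl⟩ := π.surjective z
    rw [relabel_val]
    by_cases w1 : w = x
    · subst w1; rw [p1, p3]
    by_cases w2 : w = y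
    · subst w2; rw [p2, p4]
    by_cases w3 : w = σ.1 x
    · subst w3; rw [p3, Config.partner_partner, Config.partner_partner, p1]
    by_cases w4 : w = σ.1 y
    · subst w4; rw [p4, Config.partner_partner, Config.partner_partner, p2]
    rw [p5 w w1 w2 w3 w4, p5]
    · exact fun h => w3 ((σ.partner_eq_iff.1 h))
    · exact fun h => w4 ((σ.partner_eq_iff.1 h))
    · exact fun h => w1 (σ.1.injective h)
    · exact fun h => w2 (σ.1.injective h)
  calc switchAvg F σ y = switchAvg F (relabel π σ) (π x) := by rw [hσ, p1]
    _ = switchAvg F σ x := switchAvg_relabel (hF π hπ) σ x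

open Classical in
/-- A lower bound, valid for every rule, for the probability that the process started at `σ` ends
within `k` steps with a graph in `S`: the bad edge is chosen by an adversary. -/
noncomputable def value (S : Set (SimpleGraph (Fin n))) : ℕ → Config d → ℝ
  | 0, σ => if IsSimple σ ∧ toGraph σ ∈ S then 1 else 0
  | k + 1, σ => if IsSimple σ then (if toGraph σ ∈ S then 1 else 0)
      else ⨅ a : {a // IsBad σ a}, switchAvg (value S k) σ a.1

variable {S : Set (SimpleGraph (Fin n))}

open Classical in
lemma value_of_isSimple {σ : Config d} (h : IsSimple σ) (k : ℕ) :
    value S k σ = if toGraph σ ∈ S then 1 else 0 := by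
  cases k <;> simp [value, h]

lemma value_zero_of_not_isSimple {σ : Config d} (h : ¬ IsSimple σ) : value S 0 σ = 0 := by
  simp [value, h]

lemma exists_isBad {σ : Config d} (h : ¬ IsSimple σ) : ∃ a, IsBad σ a := by
  simpa [IsSimple] using h

lemma not_isSimple {σ : Config d} {a : HalfEdge d} (h : IsBad σ a) : ¬ IsSimple σ :=
  fun h' => h' a h

lemma value_succ_le {σ : Config d} {a : HalfEdge d} (ha : IsBad σ a) (k : ℕ) :
    value S (k + 1) σ ≤ switchAvg (value S k) σ a := by
  rw [value, if_neg (not_isSimple ha)]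
  exact ciInf_le (Set.finite_range _).bddBelow (⟨a, ha⟩ : {a // IsBad σ a})

lemma exists_value_succ_eq {σ : Config d} (h : ¬ IsSimple σ) (k : ℕ) :
    ∃ a, IsBad σ a ∧ value S (k + 1) σ = switchAvg (value S k) σ a := by
  obtain ⟨a₀, h₀⟩ := exists_isBad h
  have : Nonempty {a // IsBad σ a} := ⟨⟨a₀, h₀⟩⟩
  obtain ⟨⟨a, ha⟩, h'⟩ := exists_eq_ciInf_of_finite
    (f := fun a : {a // IsBad σ a} => switchAvg (value S k) σ a.1)
  exact ⟨a, ha, by rw [value, if_neg h]; exact h'.symm⟩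

lemma value_nonneg (k : ℕ) (σ : Config d) : 0 ≤ value S k σ := by
  induction k generalizing σ with
  | zero => unfold value; split_ifs <;> norm_num
  | succ k ih =>
    by_cases h : IsSimple σ
    · rw [value_of_isSimple h]; split_ifs <;> norm_num
    · obtain ⟨a, -, h'⟩ := exists_value_succ_eq (S := S) h k
      rw [h']; exact switchAvg_nonneg ih σ a

lemma value_le_one (k : ℕ) (σ : Config d) : value S k σ ≤ 1 := by
  induction k generalizing σ with
  | zero => unfold value; split_ifs <;> norm_num
  | succ k ih =>
    by_cases h : IsSimple σ
    · rw [value_of_isSimple h]; split_ifs <;> norm_num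
    · obtain ⟨a, -, h'⟩ := exists_value_succ_eq (S := S) h k
      rw [h']; exact switchAvg_le_one ih σ a

/-- Relabelling within vertices does not change the multigraph, and an optimal choice of the
adversary can be transported in either direction. -/
lemma value_relabel (k : ℕ) {π : Equiv.Perm (HalfEdge d)} (hπ : ∀ x, (π x).1 = x.1)
    (σ : Config d) : value S k (relabel π σ) = value S k σ := by
  induction k generalizing σ with
  | zero =>
    by_cases h : IsSimple σ
    · rw [value_of_isSimple h, value_of_isSimple ((isSimple_relabel hπ).2 h), toGraph_relabel hπ]
    · rw [value_zero_of_not_isSimple h,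
        value_zero_of_not_isSimple fun h' => h ((isSimple_relabel hπ).1 h')]
  | succ k ih =>
    by_cases h : IsSimple σ
    · rw [value_of_isSimple h, value_of_isSimple ((isSimple_relabel hπ).2 h), toGraph_relabel hπ]
    · have h' : ¬ IsSimple (relabel π σ) := fun h' => h ((isSimple_relabel hπ).1 h')
      apply le_antisymm
      · obtain ⟨a, ha, he⟩ := exists_value_succ_eq (S := S) h k
        rw [he, ← switchAvg_relabel ih]
        exact value_succ_le ((isBad_relabel hπ).2 ha) k
      · obtain ⟨a, ha, he⟩ := exists_value_succ_eq (S := S) h' k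
        obtain ⟨a, rfl⟩ := π.surjective a
        rw [he, switchAvg_relabel ih]
        exact value_succ_le ((isBad_relabel hπ).1 ha) k

lemma switchAvg_value_of_mem_par {σ : Config d} {x y : HalfEdge d} (k : ℕ) (hy : y ∈ par σ x) :
    switchAvg (value S k) σ y = switchAvg (value S k) σ x :=
  switchAvg_of_mem_par (fun _ hπ σ => value_relabel k hπ σ) hy

/-- All half-edges but a few give good switchings. -/
def MostlyGood (d : Fin n → ℕ) (K m : ℕ) : Prop :=
  ∀ σ : Config d, Nice σ → (badSet σ).card ≤ K → ∀ a, IsBad σ a →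
    ∃ X : Finset (HalfEdge d), X.card ≤ m ∧ ∀ c ∉ X, GoodSwitch σ a c

lemma sum_le_of_exceptional {ι : Type*} [DecidableEq ι] (s X : Finset ι) (f g : ι → ℝ)
    (hf : ∀ i ∈ s, f i ≤ 1) (hg : ∀ i ∈ s, i ∉ X → f i ≤ g i) :
    ∑ i ∈ s, f i ≤ X.card + ∑ i ∈ s \ X, g i := by
  rw [← Finset.sum_inter_add_sum_sdiff s X f]
  apply add_le_add
  · refine (Finset.sum_le_card_nsmul _ _ 1 fun i hi => hf i (Finset.mem_inter.1 hi).1).trans ?_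
    rw [nsmul_eq_mul, mul_one]
    exact_mod_cast Finset.card_le_card Finset.inter_subset_right
  · exact Finset.sum_le_sum fun i hi => hg i (Finset.mem_sdiff.1 hi).1 (Finset.mem_sdiff.1 hi).2

/-- After switching x, the adversary does no better than by switching y next, so the left side is at
most the mean over both switchings. These commute, and in the order y, x the induction hypothesis
replaces the forced choice of x by the adversary's best choice, at cost D. The exceptional c cost m,
and for every other c the exceptional c' cost m + 2. -/
lemma switchAvg_le_of_disjoint {K m : ℕ} (hG : MostlyGood d K m) (k : ℕ) {D : ℝ} (hD : 0 ≤ D)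
    (ih : ∀ σ : Config d, Nice σ → (badSet σ).card ≤ K → ∀ x, IsBad σ x →
      switchAvg (value S k) σ x ≤ value S (k + 1) σ + D)
    (hN : 2 < Fintype.card (HalfEdge d))
    {σ : Config d} (hσ : Nice σ) (hK : (badSet σ).card ≤ K) {x y : HalfEdge d}
    (hx : IsBad σ x) (hy : IsBad σ y) (h1 : y ∉ par σ x) (h2 : y ∉ par σ (σ.1 x)) :
    switchAvg (value S (k + 1)) σ x ≤ switchAvg (value S (k + 1)) σ y +
      (D + (2 * m + 2) / ((Fintype.card (HalfEdge d) : ℝ) - 2)) := by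
  obtain ⟨X, hXm, hX⟩ := hG σ hσ hK x hx
  obtain ⟨Y, hYm, hY⟩ := hG σ hσ hK y hy
  have h1' : x ∉ par σ y := fun h => h1 (mem_par_comm.1 h)
  have h2' : x ∉ par σ (σ.1 y) := fun h => h2 (by
    have := partner_mem_par (mem_par_comm.1 h); rwa [Config.partner_partner] at this)
  set N : ℝ := (Fintype.card (HalfEdge d) : ℝ) - 2 with hNdef
  have hNpos : 0 < N := by
    have : (2 : ℝ) < Fintype.card (HalfEdge d) := by exact_mod_cast hN
    rw [hNdef]; linarith
  have hO : ∀ (σ : Config d) a, ((otherHalfEdges σ a).card : ℝ) = N := card_otherHalfEdges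
  have key : ∀ c ∉ X, ∀ c' ∉ Y, c' ≠ c → c' ≠ σ.1 c →
      switch (switch σ x c) y c' = switch (switch σ y c') x c := by
    intro c hc c' hc' e1 e2
    have g := hX c hc
    have g' := hY c' hc'
    have hyb := g.not_mem (g.isBad_switch.2 ⟨hy, h1, h2⟩)
    exact switch_comm hyb.1 hyb.2.1 hyb.2.2.1 hyb.2.2.2
      (g'.not_isBad_right hx).1.symm (g'.not_isBad_right (isBad_partner.2 hx)).1.symm e1 e2
  -- A good switching at x keeps the bad edge of y, so the second partner ranges over the same set
  -- whatever the first one was.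
  have oth : ∀ c ∉ X, otherHalfEdges (switch σ x c) y = otherHalfEdges σ y := by
    intro c hc
    have g := hX c hc
    unfold otherHalfEdges
    rw [g.switch_apply_of_isBad (g.isBad_switch.2 ⟨hy, h1, h2⟩)]
  have oth' : ∀ c ∉ Y, otherHalfEdges (switch σ y c) x = otherHalfEdges σ x := by
    intro c hc
    have g := hY c hc
    unfold otherHalfEdges
    rw [g.switch_apply_of_isBad (g.isBad_switch.2 ⟨hx, h1', h2'⟩)]
  -- the upper bound
  have up : ∑ c ∈ otherHalfEdges σ x, value S (k + 1) (switch σ x c) ≤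
      m + ∑ c ∈ otherHalfEdges σ x \ X, N⁻¹ * ∑ c' ∈ otherHalfEdges σ y,
        value S k (switch (switch σ x c) y c') := by
    refine (sum_le_of_exceptional _ X _ (fun c => N⁻¹ * ∑ c' ∈ otherHalfEdges σ y,
        value S k (switch (switch σ x c) y c')) (fun _ _ => value_le_one _ _) ?_).trans ?_
    · intro c _ hc
      have g := hX c hc
      have := value_succ_le (S := S) (g.isBad_switch.2 ⟨hy, h1, h2⟩) k
      rwa [switchAvg, oth c hc] at this
    · gcongr
  -- the lower bound
  have low : ∑ c' ∈ otherHalfEdges σ y \ Y, N⁻¹ * ∑ c ∈ otherHalfEdges σ x,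
      value S k (switch (switch σ y c') x c) ≤
      ∑ c' ∈ otherHalfEdges σ y, value S (k + 1) (switch σ y c') + N * D := by
    have e1 : ∑ c' ∈ otherHalfEdges σ y \ Y, N⁻¹ * ∑ c ∈ otherHalfEdges σ x,
        value S k (switch (switch σ y c') x c) ≤
        ∑ c' ∈ otherHalfEdges σ y \ Y, (value S (k + 1) (switch σ y c') + D) := by
      refine Finset.sum_le_sum fun c' hc' => ?_
      rw [Finset.mem_sdiff] at hc'
      have g := hY c' hc'.2
      have := ih (switch σ y c') (g.nice_switch hσ) (g.card_badSet_switch_le.trans hK) x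
        (g.isBad_switch.2 ⟨hx, h1', h2'⟩)
      rwa [switchAvg, oth' c' hc'.2] at this
    have e2 : ∑ c' ∈ otherHalfEdges σ y \ Y, (value S (k + 1) (switch σ y c') + D) ≤
        ∑ c' ∈ otherHalfEdges σ y, (value S (k + 1) (switch σ y c') + D) :=
      Finset.sum_le_sum_of_subset_of_nonneg Finset.sdiff_subset fun _ _ _ =>
        add_nonneg (value_nonneg _ _) hD
    refine e1.trans (e2.trans_eq ?_)
    rw [Finset.sum_add_distrib, Finset.sum_const, nsmul_eq_mul, hO]
  -- the comparison
  have mid : ∑ c ∈ otherHalfEdges σ x \ X, ∑ c' ∈ otherHalfEdges σ y,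
        value S k (switch (switch σ x c) y c') ≤ N * (m + 2) +
      ∑ c' ∈ otherHalfEdges σ y \ Y, ∑ c ∈ otherHalfEdges σ x,
        value S k (switch (switch σ y c') x c) := by
    have e1 : ∀ c ∈ otherHalfEdges σ x \ X, ∑ c' ∈ otherHalfEdges σ y,
        value S k (switch (switch σ x c) y c') ≤ (m + 2) + ∑ c' ∈ otherHalfEdges σ y \ Y,
        value S k (switch (switch σ y c') x c) := by
      intro c hc
      rw [Finset.mem_sdiff] at hc
      -- For the switchings to commute, c' must also avoid both half-edges of the edge used by the
      -- first switching; hence the extra 2.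
      refine (sum_le_of_exceptional _ (Y ∪ {c, σ.1 c}) _
        (fun c' => value S k (switch (switch σ y c') x c)) (fun _ _ => value_le_one _ _)
        ?_).trans ?_
      · intro c' _ hc'
        simp only [Finset.mem_union, Finset.mem_insert, Finset.mem_singleton, not_or] at hc'
        rw [key c hc.2 c' hc'.1 hc'.2.1 hc'.2.2]
      · apply add_le_add
        · have : (Y ∪ {c, σ.1 c}).card ≤ m + 2 := (Finset.card_union_le _ _).trans
            (Nat.add_le_add hYm Finset.card_le_two)
          exact_mod_cast this
        · exact Finset.sum_le_sum_of_subset_of_nonneg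
            (Finset.sdiff_subset_sdiff le_rfl Finset.subset_union_left)
            fun _ _ _ => value_nonneg _ _
    refine (Finset.sum_le_sum e1).trans ?_
    rw [Finset.sum_add_distrib, Finset.sum_const, nsmul_eq_mul]
    apply add_le_add
    · rw [← hO σ x]
      gcongr
      exact Finset.sdiff_subset
    · rw [Finset.sum_comm]
      exact Finset.sum_le_sum fun c' _ => Finset.sum_le_sum_of_subset_of_nonneg
        Finset.sdiff_subset fun _ _ _ => value_nonneg _ _
  rw [← Finset.mul_sum] at up low
  have mid' := mul_le_mul_of_nonneg_left mid (inv_nonneg.2 hNpos.le)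
  rw [mul_add, inv_mul_cancel_left₀ hNpos.ne'] at mid'
  have tot : ∑ c ∈ otherHalfEdges σ x, value S (k + 1) (switch σ x c) ≤
      ∑ c' ∈ otherHalfEdges σ y, value S (k + 1) (switch σ y c') + N * D + (2 * m + 2) := by
    linarith
  unfold switchAvg
  rw [← hNdef]
  refine (mul_le_mul_of_nonneg_left tot (inv_nonneg.2 hNpos.le)).trans_eq ?_
  field_simp
  ring

/-- On nice configurations, the choice of the bad edge hardly matters. -/
lemma switchAvg_value_le {K m : ℕ} (hG : MostlyGood d K m) (hN : 2 < Fintype.card (HalfEdge d))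
    (k : ℕ) {σ : Config d} (hσ : Nice σ) (hK : (badSet σ).card ≤ K) {x : HalfEdge d}
    (hx : IsBad σ x) : switchAvg (value S k) σ x ≤ value S (k + 1) σ +
      (k + 1) * ((2 * m + 2) / ((Fintype.card (HalfEdge d) : ℝ) - 2)) := by
  have hNpos : (0 : ℝ) < (Fintype.card (HalfEdge d) : ℝ) - 2 := by
    have : (2 : ℝ) < Fintype.card (HalfEdge d) := by exact_mod_cast hN
    linarith
  have hpos : (0 : ℝ) ≤ (2 * m + 2) / ((Fintype.card (HalfEdge d) : ℝ) - 2) := by positivity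
  induction k generalizing σ x with
  | zero =>
    -- The edge of y is the adversary's choice, with which x is compared.
    obtain ⟨y, hy, he⟩ := exists_value_succ_eq (S := S) (not_isSimple hx) 0
    rw [he]
    by_cases h1 : y ∈ par σ x
    · rw [switchAvg_value_of_mem_par 0 h1]; simpa using hpos
    by_cases h2 : y ∈ par σ (σ.1 x)
    · rw [switchAvg_value_of_mem_par 0 h2, switchAvg_partner]; simpa using hpos
    have h0 := switchAvg_nonneg (value_nonneg (S := S) 0) σ y
    obtain ⟨X, hXm, hX⟩ := hG σ hσ hK x hx
    -- A good switching at x leaves y bad, so with no steps left its value is 0; only exceptional c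
    -- contribute.
    have : ∑ c ∈ otherHalfEdges σ x, value S 0 (switch σ x c) ≤ m := by
      refine (sum_le_of_exceptional _ X _ (fun c => 0) (fun _ _ => value_le_one _ _) ?_).trans ?_
      · intro c _ hc
        rw [value_zero_of_not_isSimple]
        exact not_isSimple ((hX c hc).isBad_switch.2 ⟨hy, h1, h2⟩)
      · simpa using hXm
    have h3 : switchAvg (value S 0) σ x ≤
        (2 * m + 2) / ((Fintype.card (HalfEdge d) : ℝ) - 2) := by
      unfold switchAvg
      rw [div_eq_inv_mul]
      exact mul_le_mul_of_nonneg_left (by linarith [(Nat.cast_nonneg m : (0 : ℝ) ≤ m)])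
        (inv_nonneg.2 hNpos.le)
    push_cast
    linarith
  | succ k ih =>
    obtain ⟨y, hy, he⟩ := exists_value_succ_eq (S := S) (not_isSimple hx) (k + 1)
    rw [he]
    have hpos' : (0 : ℝ) ≤ ((k + 1 : ℕ) + 1) *
      ((2 * m + 2) / ((Fintype.card (HalfEdge d) : ℝ) - 2)) := by positivity
    by_cases h1 : y ∈ par σ x
    · rw [switchAvg_value_of_mem_par _ h1]; linarith
    by_cases h2 : y ∈ par σ (σ.1 x)
    · rw [switchAvg_value_of_mem_par _ h2, switchAvg_partner]; linarith
    refine (switchAvg_le_of_disjoint hG k (D := (k + 1) *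
      ((2 * m + 2) / ((Fintype.card (HalfEdge d) : ℝ) - 2))) (by positivity)
      (fun σ hσ hK x hx => ih hσ hK hx) hN hσ hK hx hy h1 h2).trans_eq ?_
    push_cast; ring

end Value

/-! ### Double counting of good switchings between classes -/

section Classes

variable {n : ℕ} {d : Fin n → ℕ}

/-- The nice configurations with `l` half-edges in loops and `m` half-edges in double edges. -/
def niceClass (d : Fin n → ℕ) (l m : ℕ) : Finset (Config d) :=
  Finset.univ.filter fun σ => Nice σ ∧ (loops σ).card = l ∧ (multiples σ).card = m

lemma mem_niceClass {l m : ℕ} {σ : Config d} : σ ∈ niceClass d l m ↔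
    Nice σ ∧ (loops σ).card = l ∧ (multiples σ).card = m := by simp [niceClass]

lemma card_badSet_of_mem_niceClass {l m : ℕ} {σ : Config d} (h : σ ∈ niceClass d l m) :
    (badSet σ).card = l + m := by
  rw [mem_niceClass] at h
  rw [← card_loops_add_card_multiples, h.2.1, h.2.2]

open Classical in
/-- The good switchings of configurations in `A` at half-edges in `T`. -/
noncomputable def goodSwitches (A : Finset (Config d)) (T : Config d → Finset (HalfEdge d)) :
    Finset (Σ _ : Config d, Σ _ : HalfEdge d, HalfEdge d) :=
  A.sigma fun σ => (T σ).sigma fun a => Finset.univ.filter fun c => GoodSwitch σ a c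

lemma mem_goodSwitches {A : Finset (Config d)} {T : Config d → Finset (HalfEdge d)}
    {x : Σ _ : Config d, Σ _ : HalfEdge d, HalfEdge d} : x ∈ goodSwitches A T ↔
      x.1 ∈ A ∧ x.2.1 ∈ T x.1 ∧ GoodSwitch x.1 x.2.1 x.2.2 := by
  simp [goodSwitches]

lemma card_goodSwitches_ge {K m t : ℕ} (hG : MostlyGood d K m) {A : Finset (Config d)}
    {T : Config d → Finset (HalfEdge d)}
    (hA : ∀ σ ∈ A, Nice σ ∧ (badSet σ).card ≤ K ∧ (T σ).card = t ∧ T σ ⊆ badSet σ) :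
    (A.card : ℝ) * (t * (Fintype.card (HalfEdge d) - m)) ≤ (goodSwitches A T).card := by
  classical
  rw [goodSwitches, Finset.card_sigma, Nat.cast_sum, ← nsmul_eq_mul]
  refine Finset.card_nsmul_le_sum _ _ _ fun σ hσ => ?_
  obtain ⟨h1, h2, h3, h4⟩ := hA σ hσ
  rw [Finset.card_sigma, Nat.cast_sum, ← h3, ← nsmul_eq_mul]
  refine Finset.card_nsmul_le_sum _ _ _ fun a ha => ?_
  obtain ⟨X, hXm, hX⟩ := hG σ h1 h2 a (mem_badSet.1 (h4 ha))
  have : Finset.univ \ X ⊆ Finset.univ.filter fun c => GoodSwitch σ a c := fun c hc => by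
    simp only [Finset.mem_sdiff, Finset.mem_univ, true_and] at hc
    simpa using hX c hc
  have h5 := Finset.card_le_card this
  have h6 := Finset.card_sdiff_add_card_eq_card (Finset.subset_univ X)
  rw [Finset.card_univ] at h6
  rw [sub_le_iff_le_add, ← Nat.cast_add, Nat.cast_le]
  omega

/-- Values are nonnegative, so the sum over good c is at most the sum over all c, which is N - 2
times a mean. That mean is close to the adversarial value for every a, so a may range over all of `T
σ`. -/
lemma sum_goodSwitches_le {K m t k : ℕ} (hG : MostlyGood d K m) {S : Set (SimpleGraph (Fin n))}
    (hN : 2 < Fintype.card (HalfEdge d)) {A : Finset (Config d)}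
    {T : Config d → Finset (HalfEdge d)}
    (hA : ∀ σ ∈ A, Nice σ ∧ (badSet σ).card ≤ K ∧ (T σ).card = t ∧ T σ ⊆ badSet σ) :
    ∑ x ∈ goodSwitches A T, value S k (switch x.1 x.2.1 x.2.2) ≤
      t * (((Fintype.card (HalfEdge d) : ℝ) - 2) * (∑ σ ∈ A, value S (k + 1) σ + A.card *
        ((k + 1) * ((2 * m + 2) / ((Fintype.card (HalfEdge d) : ℝ) - 2))))) := by
  classical
  have hNpos : (0 : ℝ) < (Fintype.card (HalfEdge d) : ℝ) - 2 := by
    have : (2 : ℝ) < Fintype.card (HalfEdge d) := by exact_mod_cast hN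
    linarith
  rw [goodSwitches, Finset.sum_sigma, ← nsmul_eq_mul (A.card), ← Finset.sum_const,
    ← Finset.sum_add_distrib, Finset.mul_sum, Finset.mul_sum]
  refine Finset.sum_le_sum fun σ hσ => ?_
  obtain ⟨h1, h2, h3, h4⟩ := hA σ hσ
  rw [Finset.sum_sigma, ← h3, ← nsmul_eq_mul]
  refine Finset.sum_le_card_nsmul _ _ _ fun a ha => ?_
  have h5 : ∑ c ∈ Finset.univ.filter fun c => GoodSwitch σ a c, value S k (switch σ a c) ≤
      ∑ c ∈ otherHalfEdges σ a, value S k (switch σ a c) := by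
    refine Finset.sum_le_sum_of_subset_of_nonneg (fun c hc => ?_) fun _ _ _ => value_nonneg _ _
    rw [Finset.mem_filter] at hc
    exact mem_otherHalfEdges.2 ⟨hc.2.ne_left, hc.2.ne_right⟩
  have h6 := switchAvg_value_le (S := S) hG hN k h1 h2 (mem_badSet.1 (h4 ha))
  refine h5.trans ?_
  rw [switchAvg, inv_mul_le_iff₀ hNpos] at h6
  exact h6

/-- The number of good switchings that remove a loop. -/
lemma card_goodSwitches_loops_le (l m : ℕ) :
    (goodSwitches (niceClass d (l + 2) m) loops).card ≤
      ∑ τ ∈ niceClass d l m, (loopPairs τ).card := by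
  rw [← Finset.card_sigma]
  refine Finset.card_le_card_of_surjOn
    (fun x => ⟨switch x.1 x.2.1 x.2.2, x.2.1, x.2.2⟩) ?_
  rintro ⟨σ, a, c⟩ hx
  rw [Finset.mem_coe, mem_goodSwitches] at hx
  obtain ⟨hσ, ha, hg⟩ := hx
  rw [mem_niceClass] at hσ
  simp only at hσ ha hg
  rw [mem_loops] at ha
  have hg' := hg.card_loops_of_loop ha
  refine ⟨⟨switch σ a c, a, c⟩, ?_, ?_⟩
  · rw [Finset.mem_coe, Finset.mem_sigma, mem_niceClass, mem_loopPairs]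
    refine ⟨⟨hg.nice_switch hσ.1, by dsimp only; omega, by dsimp only; omega⟩, ?_⟩
    simp only
    rw [switch_apply_right hg.ne_right]
    exact ⟨σ.partner_ne a, ha⟩
  · simp only [switch_switch hg.ne_right]

/-- Pairs whose reverse switching is good inject into the good switchings of the upper class, since
switching twice gives back τ. The remaining pairs are few, and each has value at most 1. -/
lemma sum_loopPairs_le (l m : ℕ) {S : Set (SimpleGraph (Fin n))} {k Δ : ℕ}
    (hΔ : ∀ i, d i ≤ Δ) :
    ∑ τ ∈ niceClass d l m, value S k τ * (loopPairs τ).card ≤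
      ∑ x ∈ goodSwitches (niceClass d (l + 2) m) loops, value S k (switch x.1 x.2.1 x.2.2) +
      ∑ τ ∈ niceClass d l m, ((3 * ((l + m) * (Δ * Δ)) + (triangles τ).card : ℕ) : ℝ) := by
  classical
  set Q := (niceClass d l m).sigma fun τ =>
    (loopPairs τ).filter fun p => GoodSwitch (switch τ p.1 p.2) p.1 p.2 with hQ
  have hne : ∀ x ∈ Q, x.2.2 ≠ x.1.1 x.2.1 := by
    intro x hx h
    rw [hQ, Finset.mem_sigma, Finset.mem_filter, mem_loopPairs] at hx
    exact hx.2.1.1 (x.1.partner_eq_iff.2 h)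
  have hinj : Set.InjOn (fun x : (Σ _ : Config d, HalfEdge d × HalfEdge d) =>
      (⟨switch x.1 x.2.1 x.2.2, x.2.1, x.2.2⟩ :
        Σ _ : Config d, Σ _ : HalfEdge d, HalfEdge d)) Q := by
    rintro ⟨τ, a, c⟩ hx ⟨τ', a', c'⟩ hx' h
    have h1 := hne _ hx
    have h2 := hne _ hx'
    simp only [Sigma.mk.injEq, heq_eq_eq] at h h1 h2
    obtain ⟨h, rfl, rfl⟩ := h
    have := switch_switch h1
    rw [h, switch_switch h2] at this
    rw [this]
  have h1 : ∑ x ∈ Q, value S k x.1 ≤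
      ∑ x ∈ goodSwitches (niceClass d (l + 2) m) loops, value S k (switch x.1 x.2.1 x.2.2) := by
    have : ∑ x ∈ Q, value S k x.1 = ∑ x ∈ Q.image (fun x => (⟨switch x.1 x.2.1 x.2.2, x.2.1, x.2.2⟩ :
        Σ _ : Config d, Σ _ : HalfEdge d, HalfEdge d)), value S k (switch x.1 x.2.1 x.2.2) := by
      rw [Finset.sum_image hinj]
      refine Finset.sum_congr rfl fun x hx => ?_
      simp only
      rw [switch_switch (hne x hx)]
    rw [this]
    refine Finset.sum_le_sum_of_subset_of_nonneg ?_ fun _ _ _ => value_nonneg _ _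
    intro y hy
    obtain ⟨⟨τ, a, c⟩, hx, rfl⟩ := Finset.mem_image.1 hy
    have h1 := hne _ hx
    simp only at h1
    rw [hQ, Finset.mem_sigma, Finset.mem_filter, mem_loopPairs] at hx
    obtain ⟨h2, ⟨h3, h4⟩, h5⟩ := hx
    simp only at h2 h3 h4 h5
    have hl : ((switch τ a c).1 a).1 = a.1 := by rw [switch_apply_left h1, h4]
    have h6 := h5.card_loops_of_loop hl
    rw [switch_switch h1] at h6
    rw [mem_niceClass] at h2
    rw [mem_goodSwitches, mem_niceClass, mem_loops]
    refine ⟨⟨h5.nice_of_switch ?_, by simp only; omega, by simp only; omega⟩, hl, h5⟩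
    rw [switch_switch h1]; exact h2.1
  have h2 : ∑ x ∈ Q, value S k x.1 = ∑ τ ∈ niceClass d l m, value S k τ *
      ((loopPairs τ).filter fun p => GoodSwitch (switch τ p.1 p.2) p.1 p.2).card := by
    rw [hQ, Finset.sum_sigma]
    refine Finset.sum_congr rfl fun τ _ => ?_
    simp only [Finset.sum_const, nsmul_eq_mul, mul_comm]
  rw [h2] at h1
  refine le_trans ?_ (add_le_add_left h1 _)
  rw [← Finset.sum_add_distrib]
  refine Finset.sum_le_sum fun τ hτ => ?_
  have h3 := card_bad_loopPairs_le hΔ (card_badSet_of_mem_niceClass hτ).le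
  have h4 := Finset.card_filter_add_card_filter_not (s := loopPairs τ)
    (fun p => GoodSwitch (switch τ p.1 p.2) p.1 p.2)
  rw [← h4, Nat.cast_add, mul_add]
  gcongr
  exact (mul_le_of_le_one_left (Nat.cast_nonneg _) (value_le_one _ _)).trans (by exact_mod_cast h3)

/-- The number of good switchings that remove a double edge. -/
lemma card_goodSwitches_multiples_le (l m : ℕ) :
    (goodSwitches (niceClass d l (m + 4)) multiples).card ≤
      ∑ τ ∈ niceClass d l m, (multiTriples τ).card := by
  rw [← Finset.card_sigma]
  refine Finset.card_le_card_of_surjOn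
    (fun x => ⟨switch x.1 x.2.1 x.2.2.2, x.2.1, x.2.2.2⟩) ?_
  rintro ⟨σ, a, c⟩ hx
  rw [Finset.mem_coe, mem_goodSwitches] at hx
  obtain ⟨hσ, ha, hg⟩ := hx
  rw [mem_niceClass] at hσ
  simp only at hσ ha hg
  rw [mem_multiples] at ha
  have hg' := hg.card_loops_of_not_loop ha.2
  obtain ⟨a', ha', hne⟩ := isBad_iff_exists.1 ha.1
  have ha'' := mem_par.1 ha'
  have e : (switch σ a c).1 a' = σ.1 a' := by
    have := hg.not_isBad_right ((isBad_of_mem_par ha').2 ha.1)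
    refine switch_apply_of_ne hne ?_ this.1 this.2
    rintro rfl; exact ha.2 ha''.1
  refine ⟨⟨switch σ a c, a, a', c⟩, ?_, ?_⟩
  · rw [Finset.mem_coe, Finset.mem_sigma, mem_niceClass, mem_multiTriples]
    refine ⟨⟨hg.nice_switch hσ.1, by dsimp only; omega, by dsimp only; omega⟩, ?_⟩
    simp only
    rw [switch_apply_right hg.ne_right, e]
    refine ⟨hne.symm, ha''.1.symm, ?_, ha''.2.symm⟩
    exact (hg.not_isBad_right ((isBad_of_mem_par ha').2 ha.1)).1.symm
  · simp only [switch_switch hg.ne_right]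

lemma sum_multiTriples_le (l m : ℕ) {S : Set (SimpleGraph (Fin n))} {k Δ : ℕ}
    (hΔ : ∀ i, d i ≤ Δ) :
    ∑ τ ∈ niceClass d l m, value S k τ * (multiTriples τ).card ≤
      ∑ x ∈ goodSwitches (niceClass d l (m + 4)) multiples, value S k (switch x.1 x.2.1 x.2.2) +
      ∑ τ ∈ niceClass d l m,
        ((3 * ((l + m) * (Δ * Δ)) + ((triangles τ).card + (fourCycles τ).card) : ℕ) : ℝ) := by
  classical
  set Q := (niceClass d l m).sigma fun τ =>
    (multiTriples τ).filter fun p => GoodSwitch (switch τ p.1 p.2.2) p.1 p.2.2 ∧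
      (τ.1 p.2.2).1 ≠ p.1.1 ∧ par (switch τ p.1 p.2.2) p.1 = {p.1, p.2.1} with hQ
  have hne : ∀ x ∈ Q, x.2.2.2 ≠ x.1.1 x.2.1 := by
    intro x hx h
    rw [hQ, Finset.mem_sigma, Finset.mem_filter] at hx
    apply hx.2.2.2.1
    rw [h, Config.partner_partner]
  have hinj : Set.InjOn (fun x : (Σ _ : Config d, HalfEdge d × HalfEdge d × HalfEdge d) =>
      (⟨switch x.1 x.2.1 x.2.2.2, x.2.1, x.2.2.2⟩ :
        Σ _ : Config d, Σ _ : HalfEdge d, HalfEdge d)) Q := by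
    rintro ⟨τ, a, a', c⟩ hx ⟨τ', b, b', c'⟩ hx' h
    have h1 := hne _ hx
    have h2 := hne _ hx'
    simp only [Sigma.mk.injEq, heq_eq_eq] at h h1 h2
    obtain ⟨h, rfl, rfl⟩ := h
    have := switch_switch h1
    rw [h, switch_switch h2] at this
    subst this
    rw [Finset.mem_coe, hQ, Finset.mem_sigma, Finset.mem_filter, mem_multiTriples] at hx hx'
    have h5 := hx.2.2.2.2
    simp only [hx'.2.2.2.2] at h5
    -- The image forgets a', which is recovered as the other member of the parallel class of a.
    have h6 : a' ∈ ({a, b'} : Finset (HalfEdge d)) := by rw [h5]; simp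
    simp only [Finset.mem_insert, Finset.mem_singleton] at h6
    rcases h6 with h6 | h6
    · exact absurd h6.symm hx.2.1.1
    · rw [h6]
  have h1 : ∑ x ∈ Q, value S k x.1 ≤
      ∑ x ∈ goodSwitches (niceClass d l (m + 4)) multiples,
        value S k (switch x.1 x.2.1 x.2.2) := by
    have : ∑ x ∈ Q, value S k x.1 = ∑ x ∈ Q.image (fun x =>
        (⟨switch x.1 x.2.1 x.2.2.2, x.2.1, x.2.2.2⟩ :
        Σ _ : Config d, Σ _ : HalfEdge d, HalfEdge d)), value S k (switch x.1 x.2.1 x.2.2) := by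
      rw [Finset.sum_image hinj]
      refine Finset.sum_congr rfl fun x hx => ?_
      simp only
      rw [switch_switch (hne x hx)]
    rw [this]
    refine Finset.sum_le_sum_of_subset_of_nonneg ?_ fun _ _ _ => value_nonneg _ _
    intro y hy
    obtain ⟨⟨τ, a, a', c⟩, hx, rfl⟩ := Finset.mem_image.1 hy
    have h1 := hne _ hx
    simp only at h1
    rw [hQ, Finset.mem_sigma, Finset.mem_filter, mem_multiTriples] at hx
    obtain ⟨h2, -, h5, h4, -⟩ := hx
    simp only at h2 h4 h5
    have hl : ((switch τ a c).1 a).1 ≠ a.1 := by rw [switch_apply_left h1]; exact h4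
    have h6 := h5.card_loops_of_not_loop hl
    rw [switch_switch h1] at h6
    rw [mem_niceClass] at h2
    rw [mem_goodSwitches, mem_niceClass, mem_multiples]
    refine ⟨⟨h5.nice_of_switch ?_, by simp only; omega, by simp only; omega⟩, ⟨h5.isBad, hl⟩, h5⟩
    rw [switch_switch h1]; exact h2.1
  have h2 : ∑ x ∈ Q, value S k x.1 = ∑ τ ∈ niceClass d l m, value S k τ *
      ((multiTriples τ).filter fun p => GoodSwitch (switch τ p.1 p.2.2) p.1 p.2.2 ∧
      (τ.1 p.2.2).1 ≠ p.1.1 ∧ par (switch τ p.1 p.2.2) p.1 = {p.1, p.2.1}).card := by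
    rw [hQ, Finset.sum_sigma]
    refine Finset.sum_congr rfl fun τ _ => ?_
    simp only [Finset.sum_const, nsmul_eq_mul, mul_comm]
  rw [h2] at h1
  refine le_trans ?_ (add_le_add_left h1 _)
  rw [← Finset.sum_add_distrib]
  refine Finset.sum_le_sum fun τ hτ => ?_
  have h3 := card_bad_multiTriples_le hΔ (card_badSet_of_mem_niceClass hτ).le
  have h4 := Finset.card_filter_add_card_filter_not (s := multiTriples τ)
    (fun p => GoodSwitch (switch τ p.1 p.2.2) p.1 p.2.2 ∧
      (τ.1 p.2.2).1 ≠ p.1.1 ∧ par (switch τ p.1 p.2.2) p.1 = {p.1, p.2.1})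
  rw [← h4, Nat.cast_add, mul_add]
  gcongr
  exact (mul_le_of_le_one_left (Nat.cast_nonneg _) (value_le_one _ _)).trans (by exact_mod_cast h3)

end Classes

/-! ### First moments of short cycles, bad edges and higher multiplicities -/

section Moments

variable {n : ℕ} {d : Fin n → ℕ}

/-- The configurations that contain the edges in a list. -/
def containing (l : List (HalfEdge d × HalfEdge d)) : Finset (Config d) :=
  Finset.univ.filter fun σ => ∀ p ∈ l, σ.1 p.1 = p.2

lemma mem_containing {l : List (HalfEdge d × HalfEdge d)} {σ : Config d} :
    σ ∈ containing l ↔ ∀ p ∈ l, σ.1 p.1 = p.2 := by simp [containing]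

lemma relabel_swap_swap (σ : Config d) (b e : HalfEdge d) :
    relabel (Equiv.swap b e) (relabel (Equiv.swap b e) σ) = σ := by
  apply Subtype.ext
  simp [relabel, mul_assoc]

lemma mem_containing_relabel {l : List (HalfEdge d × HalfEdge d)} {a b e : HalfEdge d}
    (hb : b ∉ l.flatMap fun p => [p.1, p.2]) (he : e ∉ l.flatMap fun p => [p.1, p.2])
    (hab : a ≠ b) (hae : a ≠ e) {σ : Config d} (hσ : σ ∈ containing ((a, b) :: l)) :
    relabel (Equiv.swap b e) σ ∈ containing ((a, e) :: l) := by
  simp only [List.mem_flatMap, List.mem_cons, List.not_mem_nil, or_false, not_exists, not_and,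
    not_or] at hb he
  simp only [mem_containing, List.mem_cons, forall_eq_or_imp] at hσ ⊢
  constructor
  · have := relabel_val (Equiv.swap b e) σ a
    rwa [Equiv.swap_apply_of_ne_of_ne hab hae, hσ.1, Equiv.swap_apply_left] at this
  · intro p hp
    have := relabel_val (Equiv.swap b e) σ p.1
    rwa [hσ.2 p hp, Equiv.swap_apply_of_ne_of_ne (Ne.symm (hb p hp).1) (Ne.symm (he p hp).1),
      Equiv.swap_apply_of_ne_of_ne (Ne.symm (hb p hp).2) (Ne.symm (he p hp).2)] at this

lemma card_containing_eq {l : List (HalfEdge d × HalfEdge d)} {a b e : HalfEdge d}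
    (hb : b ∉ l.flatMap fun p => [p.1, p.2]) (he : e ∉ l.flatMap fun p => [p.1, p.2])
    (hab : a ≠ b) (hae : a ≠ e) :
    (containing ((a, b) :: l)).card = (containing ((a, e) :: l)).card := by
  refine Finset.card_bij' (fun σ _ => relabel (Equiv.swap b e) σ)
    (fun σ _ => relabel (Equiv.swap b e) σ)
    (fun σ hσ => mem_containing_relabel hb he hab hae hσ) (fun σ hσ => ?_)
    (fun σ _ => relabel_swap_swap σ b e) (fun σ _ => relabel_swap_swap σ b e)
  rw [Equiv.swap_comm]
  exact mem_containing_relabel he hb hae hab hσ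

/-- By relabelling symmetry, given the other edges, the partner of a is equally likely to be any
unused half-edge. Every new edge thus costs a factor of about 1/N; the smallest of these counts of
unused half-edges is used for all factors. -/
lemma card_containing_mul_le (l : List (HalfEdge d × HalfEdge d))
    (hl : (l.flatMap fun p => [p.1, p.2]).Nodup) :
    (containing l).card * (Fintype.card (HalfEdge d) - 2 * l.length) ^ l.length ≤
      Fintype.card (Config d) := by
  induction l with
  | nil => simp [containing]
  | cons p l ih =>
    obtain ⟨a, b⟩ := p
    have hlen : (l.flatMap fun p => [p.1, p.2]).length = 2 * l.length := by
      simp [List.length_flatMap, mul_comm]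
    simp only [List.flatMap_cons, List.cons_append, List.nil_append, List.nodup_cons,
      List.mem_cons, not_or] at hl
    obtain ⟨⟨hab, ha⟩, hb, hl⟩ := hl
    have ih := ih hl
    set U := a :: (l.flatMap fun p => [p.1, p.2]) with hU
    set F : Finset (HalfEdge d) := Finset.univ \ U.toFinset with hF
    have hFc : Fintype.card (HalfEdge d) - 2 * (l.length + 1) ≤ F.card := by
      have h1 := Finset.card_sdiff_add_card_eq_card (Finset.subset_univ U.toFinset)
      have h2 : U.toFinset.card ≤ 2 * l.length + 1 := by
        refine (List.toFinset_card_le U).trans ?_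
        rw [hU, List.length_cons, hlen]
      rw [Finset.card_univ, ← hF] at h1
      omega
    have h1 : F.card * (containing ((a, b) :: l)).card ≤ (containing l).card := by
      rw [← smul_eq_mul, ← Finset.sum_const]
      have : ∑ e ∈ F, (containing ((a, b) :: l)).card = ∑ e ∈ F, (containing ((a, e) :: l)).card := by
        refine Finset.sum_congr rfl fun e he => ?_
        simp only [hF, hU, Finset.mem_sdiff, Finset.mem_univ, true_and, List.mem_toFinset,
          List.mem_cons, not_or] at he
        exact card_containing_eq hb he.2 hab (Ne.symm he.1)
      rw [this, ← Finset.card_biUnion]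
      · refine Finset.card_le_card fun σ hσ => ?_
        obtain ⟨e, -, he⟩ := Finset.mem_biUnion.1 hσ
        rw [mem_containing] at he ⊢
        exact fun p hp => he p (List.mem_cons_of_mem _ hp)
      · intro e _ e' _ hne
        refine Finset.disjoint_left.2 fun σ h h' => hne ?_
        rw [mem_containing] at h h'
        exact (h (a, e) List.mem_cons_self).symm.trans (h' (a, e') List.mem_cons_self)
    rw [List.length_cons, pow_succ]
    calc (containing ((a, b) :: l)).card * ((Fintype.card (HalfEdge d) - 2 * (l.length + 1)) ^
          l.length * (Fintype.card (HalfEdge d) - 2 * (l.length + 1)))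
        ≤ (containing ((a, b) :: l)).card * ((Fintype.card (HalfEdge d) - 2 * l.length) ^
          l.length * F.card) := by
          gcongr
          omega
      _ = (F.card * (containing ((a, b) :: l)).card) *
          (Fintype.card (HalfEdge d) - 2 * l.length) ^ l.length := by ring
      _ ≤ (containing l).card * (Fintype.card (HalfEdge d) - 2 * l.length) ^ l.length := by gcongr
      _ ≤ _ := ih

lemma card_containing_single {a b : HalfEdge d} (hab : a ≠ b) :
    (containing [(a, b)]).card * (Fintype.card (HalfEdge d) - 1) = Fintype.card (Config d) := by
  have h1 : (Finset.univ \ {a} : Finset (HalfEdge d)).card = Fintype.card (HalfEdge d) - 1 := by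
    rw [Finset.card_sdiff_of_subset (Finset.subset_univ _), Finset.card_univ,
      Finset.card_singleton]
  rw [mul_comm, ← h1, ← smul_eq_mul, ← Finset.sum_const, ← Finset.card_univ (α := Config d)]
  have : ∑ e ∈ (Finset.univ \ {a} : Finset (HalfEdge d)), (containing [(a, b)]).card =
      ∑ e ∈ (Finset.univ \ {a} : Finset (HalfEdge d)), (containing [(a, e)]).card := by
    refine Finset.sum_congr rfl fun e he => ?_
    simp only [Finset.mem_sdiff, Finset.mem_univ, true_and, Finset.mem_singleton] at he
    exact card_containing_eq (by simp) (by simp) hab (Ne.symm he)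
  rw [this, ← Finset.card_biUnion]
  · congr 1
    refine Finset.eq_univ_of_forall fun σ => Finset.mem_biUnion.2 ⟨σ.1 a, ?_, ?_⟩
    · simpa using σ.partner_ne a
    · simp [mem_containing]
  · intro e _ e' _ hne
    refine Finset.disjoint_left.2 fun σ h h' => hne ?_
    simp only [mem_containing, List.mem_singleton, forall_eq] at h h'
    rw [← h, ← h']

lemma sum_card_containing {α : Type*} (T : Finset α) (L : α → List (HalfEdge d × HalfEdge d)) :
    ∑ τ : Config d, (T.filter fun t => τ ∈ containing (L t)).card =
      ∑ t ∈ T, (containing (L t)).card := by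
  simp_rw [Finset.card_filter]
  rw [Finset.sum_comm]
  refine Finset.sum_congr rfl fun t _ => ?_
  rw [← Finset.card_filter]
  congr 1
  ext τ; simp

/-- A first moment bound. -/
lemma sum_card_containing_le {α : Type*} (T : Finset α) (L : α → List (HalfEdge d × HalfEdge d))
    {k : ℕ} (hk : k ≤ 4) (hN : 16 ≤ Fintype.card (HalfEdge d)) (hlen : ∀ t ∈ T, (L t).length = k)
    (hnd : ∀ t ∈ T, ((L t).flatMap fun p => [p.1, p.2]).Nodup) :
    ∑ τ : Config d, ((T.filter fun t => τ ∈ containing (L t)).card : ℝ) ≤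
      T.card * (2 / (Fintype.card (HalfEdge d) : ℝ)) ^ k * Fintype.card (Config d) := by
  have hN' : (16 : ℝ) ≤ Fintype.card (HalfEdge d) := by exact_mod_cast hN
  rw [← Nat.cast_sum, sum_card_containing, Nat.cast_sum, mul_assoc, ← nsmul_eq_mul]
  refine Finset.sum_le_card_nsmul _ _ _ fun t ht => ?_
  have h := card_containing_mul_le (L t) (hnd t ht)
  rw [hlen t ht] at h
  -- With k ≤ 4 and N ≥ 16, at most half of the half-edges are used up.
  have h1 : ((Fintype.card (HalfEdge d) : ℝ) / 2) ≤ ((Fintype.card (HalfEdge d) - 2 * k : ℕ) : ℝ) := by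
    rw [Nat.cast_sub (by omega)]
    have : (k : ℝ) ≤ 4 := by exact_mod_cast hk
    push_cast; linarith
  have h2 : ((containing (L t)).card : ℝ) * ((Fintype.card (HalfEdge d) : ℝ) / 2) ^ k ≤
      Fintype.card (Config d) := by
    refine le_trans ?_ (Nat.cast_le.2 h)
    push_cast
    gcongr
  rw [← inv_div, inv_pow, ← div_eq_inv_mul, le_div_iff₀ (by positivity)]
  exact h2

variable {M : ℝ} {Δ : ℕ}

/-- A triangle is given by three sibling pairs, at most (M N)³ choices, and its three edges occur
with probability at most (2 / N)³. -/
lemma sum_triangles_le (hN : 16 ≤ Fintype.card (HalfEdge d))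
    (hG : ((siblings d).card : ℝ) ≤ M * Fintype.card (HalfEdge d)) :
    ∑ τ : Config d, ((triangles τ).card : ℝ) ≤ (2 * M) ^ 3 * Fintype.card (Config d) := by
  have hN' : (0 : ℝ) < Fintype.card (HalfEdge d) := by
    have : 0 < Fintype.card (HalfEdge d) := by omega
    exact_mod_cast this
  have h := sum_card_containing_le (k := 3) ((siblings d ×ˢ siblings d ×ˢ siblings d).filter fun t =>
    (t.1.1.1 ≠ t.2.1.1.1 ∧ t.2.1.1.1 ≠ t.2.2.1.1 ∧ t.2.2.1.1 ≠ t.1.1.1))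
    (fun t => [(t.1.2, t.2.1.1), (t.2.1.2, t.2.2.1), (t.2.2.2, t.1.1)]) (by norm_num) hN
    (fun t _ => rfl) ?_
  · refine le_trans (Finset.sum_le_sum fun τ _ => ?_) (h.trans ?_)
    · rw [Nat.cast_le]
      refine Finset.card_le_card fun t ht => ?_
      simp only [triangles, Finset.mem_filter, mem_containing, List.mem_cons, List.not_mem_nil,
        or_false, forall_eq_or_imp, forall_eq] at ht ⊢
      exact ⟨⟨ht.1, ht.2.1⟩, ht.2.2⟩
    · gcongr
      calc _ ≤ ((siblings d).card : ℝ) ^ 3 * (2 / (Fintype.card (HalfEdge d) : ℝ)) ^ 3 := by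
            gcongr
            have := Finset.card_filter_le (siblings d ×ˢ siblings d ×ˢ siblings d) fun t =>
              (t.1.1.1 ≠ t.2.1.1.1 ∧ t.2.1.1.1 ≠ t.2.2.1.1 ∧ t.2.2.1.1 ≠ t.1.1.1)
            simp only [Finset.card_product] at this
            calc _ ≤ (((siblings d).card * ((siblings d).card * (siblings d).card) : ℕ) : ℝ) := by
                  exact_mod_cast this
              _ = _ := by push_cast; ring
        _ = (2 * ((siblings d).card / (Fintype.card (HalfEdge d) : ℝ))) ^ 3 := by
            rw [← mul_pow]; congr 1; ring
        _ ≤ _ := by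
            gcongr
            rwa [div_le_iff₀ hN']
  · rintro ⟨⟨a, b⟩, ⟨c, e⟩, ⟨f, g⟩⟩ ht
    simp only [Finset.mem_filter, Finset.mem_product, mem_siblings] at ht
    obtain ⟨⟨⟨h1, h2⟩, ⟨h3, h4⟩, h5, h6⟩, h7, h8, h9⟩ := ht
    simp
    and_intros <;> grind

lemma sum_fourCycles_le (hN : 16 ≤ Fintype.card (HalfEdge d))
    (hG : ((siblings d).card : ℝ) ≤ M * Fintype.card (HalfEdge d)) :
    ∑ τ : Config d, ((fourCycles τ).card : ℝ) ≤ (2 * M) ^ 4 * Fintype.card (Config d) := by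
  have hN' : (0 : ℝ) < Fintype.card (HalfEdge d) := by
    have : 0 < Fintype.card (HalfEdge d) := by omega
    exact_mod_cast this
  set T := (siblings d ×ˢ siblings d ×ˢ siblings d ×ˢ siblings d).filter fun t =>
    (t.1.1.1 ≠ t.2.1.1.1 ∧ t.1.1.1 ≠ t.2.2.1.1.1 ∧ t.1.1.1 ≠ t.2.2.2.1.1 ∧
      t.2.1.1.1 ≠ t.2.2.1.1.1 ∧ t.2.1.1.1 ≠ t.2.2.2.1.1 ∧ t.2.2.1.1.1 ≠ t.2.2.2.1.1) with hT
  have h := sum_card_containing_le (k := 4) T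
    (fun t => [(t.1.2, t.2.1.1), (t.2.1.2, t.2.2.1.1), (t.2.2.1.2, t.2.2.2.1), (t.2.2.2.2, t.1.1)])
    (by norm_num) hN (fun t _ => rfl) ?_
  · refine le_trans (Finset.sum_le_sum fun τ _ => ?_) (h.trans ?_)
    · rw [Nat.cast_le]
      refine Finset.card_le_card fun t ht => ?_
      simp only [hT, fourCycles, Finset.mem_filter, mem_containing, List.mem_cons,
        List.not_mem_nil, or_false, forall_eq_or_imp, forall_eq] at ht ⊢
      exact ⟨⟨ht.1, ht.2.1⟩, ht.2.2⟩
    · gcongr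
      calc _ ≤ ((siblings d).card : ℝ) ^ 4 * (2 / (Fintype.card (HalfEdge d) : ℝ)) ^ 4 := by
            gcongr
            have : T.card ≤ _ := Finset.card_filter_le _ _
            simp only [Finset.card_product] at this
            calc _ ≤ (((siblings d).card * ((siblings d).card *
                  ((siblings d).card * (siblings d).card)) : ℕ) : ℝ) := by
                  exact_mod_cast this
              _ = _ := by push_cast; ring
        _ = (2 * ((siblings d).card / (Fintype.card (HalfEdge d) : ℝ))) ^ 4 := by
            rw [← mul_pow]; congr 1; ring
        _ ≤ _ := by
            gcongr
            rwa [div_le_iff₀ hN']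
  · rintro ⟨⟨a, b⟩, ⟨c, e⟩, ⟨f, g⟩, ⟨p, q⟩⟩ ht
    simp only [hT, Finset.mem_filter, Finset.mem_product, mem_siblings] at ht
    obtain ⟨⟨⟨h1, h2⟩, ⟨h3, h4⟩, ⟨h5, h6⟩, h7, h8⟩, h9⟩ := ht
    simp
    and_intros <;> grind

/-- The expected number of half-edges in bad edges is bounded. -/
lemma sum_badSet_le (hN : 16 ≤ Fintype.card (HalfEdge d))
    (hG : ((siblings d).card : ℝ) ≤ M * Fintype.card (HalfEdge d)) :
    ∑ τ : Config d, ((badSet τ).card : ℝ) ≤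
      (2 * M + (2 * M) ^ 2) * Fintype.card (Config d) := by
  have hN' : (0 : ℝ) < Fintype.card (HalfEdge d) := by
    have : 0 < Fintype.card (HalfEdge d) := by omega
    exact_mod_cast this
  have hdiv : 2 * ((siblings d).card / (Fintype.card (HalfEdge d) : ℝ)) ≤ 2 * M := by
    gcongr
    rwa [div_le_iff₀ hN']
  have h1 := sum_card_containing_le (k := 1) (siblings d) (fun t => [t]) (by norm_num) hN
    (fun t _ => rfl) (fun t ht => by simpa using (mem_siblings.1 ht).1)
  set T := (siblings d ×ˢ siblings d).filter fun t => t.1.1.1 ≠ t.2.1.1 with hT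
  have h2 := sum_card_containing_le (k := 2) T
    (fun t => [(t.1.1, t.2.1), (t.1.2, t.2.2)]) (by norm_num) hN (fun t _ => rfl) ?_
  · have h3 : (T.card : ℝ) * (2 / (Fintype.card (HalfEdge d) : ℝ)) ^ 2 ≤ (2 * M) ^ 2 := by
      calc _ ≤ ((siblings d).card : ℝ) ^ 2 * (2 / (Fintype.card (HalfEdge d) : ℝ)) ^ 2 := by
            gcongr
            have : T.card ≤ _ := Finset.card_filter_le _ _
            rw [Finset.card_product] at this
            rw [sq]; exact_mod_cast this
        _ = (2 * ((siblings d).card / (Fintype.card (HalfEdge d) : ℝ))) ^ 2 := by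
            rw [← mul_pow]; congr 1; ring
        _ ≤ _ := by gcongr
    have h4 : ((siblings d).card : ℝ) * (2 / (Fintype.card (HalfEdge d) : ℝ)) ^ 1 ≤ 2 * M := by
      rw [pow_one]; refine le_trans (le_of_eq ?_) hdiv; ring
    rw [add_mul]
    refine le_trans ?_ (add_le_add (h1.trans (mul_le_mul_of_nonneg_right h4 (Nat.cast_nonneg _)))
      (h2.trans (mul_le_mul_of_nonneg_right h3 (Nat.cast_nonneg _))))
    rw [← Finset.sum_add_distrib]
    refine Finset.sum_le_sum fun τ _ => ?_
    rw [← Nat.cast_add, Nat.cast_le]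
    -- A loop is a sibling pair joined to itself (`U₁`); a multiple edge comes from two sibling
    -- pairs joined to each other (`U₂`).
    set U₁ := (siblings d).filter fun t => τ ∈ containing [t]
    set U₂ := T.filter fun t => τ ∈ containing [(t.1.1, t.2.1), (t.1.2, t.2.2)]
    suffices hsub : badSet τ ⊆ U₁.image (fun t => t.1) ∪ U₂.image (fun t => t.1.1) from
      ((Finset.card_le_card hsub).trans (Finset.card_union_le _ _)).trans
        (Nat.add_le_add Finset.card_image_le Finset.card_image_le)
    intro a ha
    rw [mem_badSet] at ha
    rw [Finset.mem_union]
    by_cases hl : (τ.1 a).1 = a.1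
    · left
      refine Finset.mem_image.2 ⟨(a, τ.1 a), ?_, rfl⟩
      simp [U₁, mem_siblings, mem_containing, hl, (τ.partner_ne a).symm]
    · right
      obtain ⟨c, hc, hne⟩ := isBad_iff_exists.1 ha
      rw [mem_par] at hc
      refine Finset.mem_image.2 ⟨((a, c), (τ.1 a, τ.1 c)), ?_, rfl⟩
      simp [U₂, hT, mem_siblings, mem_containing, hc.1, hc.2, hne.symm, Ne.symm hl]
  · rintro ⟨⟨a, b⟩, ⟨c, e⟩⟩ ht
    simp only [hT, Finset.mem_filter, Finset.mem_product, mem_siblings] at ht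
    obtain ⟨⟨⟨h1, h2⟩, h3, h4⟩, h5⟩ := ht
    simp
    and_intros <;> grind

/-- Few configurations are not nice. -/
lemma card_not_nice_le (hΔ : ∀ i, d i ≤ Δ) (hN : 16 ≤ Fintype.card (HalfEdge d))
    (hG : ((siblings d).card : ℝ) ≤ M * Fintype.card (HalfEdge d)) :
    ((Finset.univ.filter fun τ : Config d => ¬ Nice τ).card : ℝ) ≤
      (8 * M ^ 2 + 4 * M) * ((Δ : ℝ) ^ 2 / Fintype.card (HalfEdge d)) *
        Fintype.card (Config d) := by
  have hN' : (0 : ℝ) < Fintype.card (HalfEdge d) := by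
    have : 0 < Fintype.card (HalfEdge d) := by omega
    exact_mod_cast this
  have hΔ' : ∀ i, (halfEdgesAt d i).card ≤ Δ := fun i => (card_halfEdgesAt i).trans_le (hΔ i)
  -- If τ is not nice, it contains two loops at one vertex, counted by `T₄`, or three parallel
  -- edges, counted by `T₆` as two triples of half-edges. Siblings contribute factors M N and the
  -- further half-edges factors Δ, so both expected numbers are of order Δ² / N.
  set T₃ := (siblings d).sigma fun p =>
    (halfEdgesAt d p.1.1).filter fun e => e ≠ p.1 ∧ e ≠ p.2 with hT₃
  set T₄ := (siblings d).sigma fun p => (halfEdgesAt d p.1.1 ×ˢ halfEdgesAt d p.1.1).filter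
    fun e => e.1 ≠ p.1 ∧ e.1 ≠ p.2 ∧ e.2 ≠ p.1 ∧ e.2 ≠ p.2 ∧ e.1 ≠ e.2 with hT₄
  set T₆ := (T₃ ×ˢ T₃).filter fun t => t.1.1.1.1 ≠ t.2.1.1.1 with hT₆
  have c3 : (T₃.card : ℝ) ≤ M * Fintype.card (HalfEdge d) * Δ := by
    refine le_trans ?_ (mul_le_mul_of_nonneg_right hG (Nat.cast_nonneg _))
    rw [hT₃, Finset.card_sigma, ← Nat.cast_mul, Nat.cast_le, ← smul_eq_mul]
    exact Finset.sum_le_card_nsmul _ _ _ fun p _ => (Finset.card_filter_le _ _).trans (hΔ' _)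
  have c4 : (T₄.card : ℝ) ≤ M * Fintype.card (HalfEdge d) * (Δ * Δ) := by
    refine le_trans ?_ (mul_le_mul_of_nonneg_right hG (by positivity))
    rw [hT₄, Finset.card_sigma, ← Nat.cast_mul, ← Nat.cast_mul, Nat.cast_le, ← smul_eq_mul]
    exact Finset.sum_le_card_nsmul _ _ _ fun p _ => (Finset.card_filter_le _ _).trans
      ((Finset.card_product _ _).trans_le (Nat.mul_le_mul (hΔ' _) (hΔ' _)))
  have h4 := sum_card_containing_le (k := 2) T₄
    (fun t => [t.1, t.2]) (by norm_num) hN (fun t _ => rfl) (by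
      rintro ⟨⟨a, b⟩, ⟨c, e⟩⟩ ht
      simp only [hT₄, Finset.mem_filter, Finset.mem_sigma, Finset.mem_product, mem_siblings] at ht
      simp
      and_intros <;> grind)
  have h6 := sum_card_containing_le (k := 3) T₆
    (fun t => [(t.1.1.1, t.2.1.1), (t.1.1.2, t.2.1.2), (t.1.2, t.2.2)]) (by norm_num) hN
    (fun t _ => rfl) (by
      rintro ⟨⟨⟨a, b⟩, c⟩, ⟨⟨e, f⟩, g⟩⟩ ht
      simp only [hT₆, hT₃, Finset.mem_filter, Finset.mem_sigma, Finset.mem_product,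
        mem_siblings, mem_halfEdgesAt] at ht
      simp
      and_intros <;> grind)
  have b4 : (T₄.card : ℝ) * (2 / (Fintype.card (HalfEdge d) : ℝ)) ^ 2 ≤
      4 * M * ((Δ : ℝ) ^ 2 / Fintype.card (HalfEdge d)) := by
    refine (mul_le_mul_of_nonneg_right c4 (by positivity)).trans_eq ?_
    field_simp; ring
  have b6 : (T₆.card : ℝ) * (2 / (Fintype.card (HalfEdge d) : ℝ)) ^ 3 ≤
      8 * M ^ 2 * ((Δ : ℝ) ^ 2 / Fintype.card (HalfEdge d)) := by
    have : (T₆.card : ℝ) ≤ (M * Fintype.card (HalfEdge d) * Δ) ^ 2 := by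
      have h : T₆.card ≤ _ := Finset.card_filter_le _ _
      rw [Finset.card_product] at h
      calc (T₆.card : ℝ) ≤ (T₃.card : ℝ) ^ 2 := by rw [sq]; exact_mod_cast h
        _ ≤ _ := by gcongr
    refine (mul_le_mul_of_nonneg_right this (by positivity)).trans_eq ?_
    field_simp; ring
  rw [add_mul, add_mul]
  refine le_trans ?_ (add_le_add (h6.trans (mul_le_mul_of_nonneg_right b6 (Nat.cast_nonneg _)))
    (h4.trans (mul_le_mul_of_nonneg_right b4 (Nat.cast_nonneg _))))
  rw [← Finset.sum_add_distrib, Finset.card_filter, Nat.cast_sum]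
  refine Finset.sum_le_sum fun τ _ => ?_
  split_ifs with hτ
  · simp only [Nat.cast_zero]; positivity
  simp only [Nice, not_forall, not_le] at hτ
  obtain ⟨a, ha⟩ := hτ
  rw [← Nat.cast_add, Nat.cast_le, Nat.one_le_iff_ne_zero]
  have aux : ∀ X : Finset (HalfEdge d), X.card ≤ 2 → ∃ c ∈ par τ a, c ∉ X := by
    intro X hX
    by_contra hcon
    push Not at hcon
    exact absurd (Finset.card_le_card hcon) (by omega)
  by_cases hl : (τ.1 a).1 = a.1
  · obtain ⟨c, hc, hcX⟩ := aux {a, τ.1 a} Finset.card_le_two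
    rw [mem_par] at hc
    simp only [Finset.mem_insert, Finset.mem_singleton, not_or] at hcX
    suffices h : 0 < (T₄.filter fun t => τ ∈ containing [t.1, t.2]).card by omega
    refine Finset.card_pos.2 ⟨⟨(a, τ.1 a), (c, τ.1 c)⟩, ?_⟩
    simp only [hT₄, Finset.mem_filter, Finset.mem_sigma, mem_siblings, Finset.mem_product,
      mem_halfEdgesAt, mem_containing, List.mem_cons, List.not_mem_nil, or_false,
      forall_eq_or_imp, forall_eq, and_true]
    refine ⟨⟨(τ.partner_ne a).symm, hl.symm⟩, ⟨hc.1, hc.2.trans hl⟩, hcX.1, hcX.2, ?_, ?_,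
      (τ.partner_ne c).symm⟩
    · exact fun h => hcX.2 (τ.partner_eq_iff.1 h)
    · exact fun h => hcX.1 (τ.1.injective h)
  · obtain ⟨c, hc, hcX⟩ := aux {a} (by simp)
    obtain ⟨e, he, heX⟩ := aux {a, c} Finset.card_le_two
    rw [mem_par] at hc he
    simp only [Finset.mem_insert, Finset.mem_singleton, not_or] at hcX heX
    suffices h : 0 < (T₆.filter fun t => τ ∈ containing
      [(t.1.1.1, t.2.1.1), (t.1.1.2, t.2.1.2), (t.1.2, t.2.2)]).card by omega
    refine Finset.card_pos.2 ⟨⟨⟨(a, c), e⟩, ⟨(τ.1 a, τ.1 c), τ.1 e⟩⟩, ?_⟩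
    simp only [hT₆, hT₃, Finset.mem_filter, Finset.mem_sigma, mem_siblings, Finset.mem_product,
      mem_halfEdgesAt, mem_containing, List.mem_cons, List.not_mem_nil, or_false,
      forall_eq_or_imp, forall_eq, and_true, ne_eq, EmbeddingLike.apply_eq_iff_eq]
    exact ⟨⟨⟨⟨Ne.symm hcX, hc.1.symm⟩, he.1, heX⟩, ⟨Ne.symm hcX, hc.2.symm⟩, he.2, heX⟩,
      Ne.symm hl⟩

end Moments

/-! ### Concentration of the number of reverse switchings for double edges -/

section Variance

variable {n : ℕ} {d : Fin n → ℕ}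

/-- The number of other half-edges at the same vertex. -/
def sibCount (a : HalfEdge d) : ℕ := (Finset.univ.filter fun b : HalfEdge d => b ≠ a ∧ b.1 = a.1).card

lemma sibCount_le {Δ : ℕ} (hΔ : ∀ i, d i ≤ Δ) (a : HalfEdge d) : sibCount a ≤ Δ := by
  refine le_trans (Finset.card_le_card fun b hb => ?_) ((card_halfEdgesAt a.1).trans_le (hΔ _))
  rw [Finset.mem_filter] at hb
  exact mem_halfEdgesAt.2 hb.2.2

lemma sum_sibCount : ∑ a : HalfEdge d, sibCount a = (siblings d).card := by
  unfold sibCount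
  rw [← Finset.card_sigma]
  refine Finset.card_bij' (fun x _ => (x.1, x.2)) (fun p _ => ⟨p.1, p.2⟩) ?_ ?_ (by simp) (by simp)
  · rintro ⟨a, b⟩ h
    simp only [Finset.mem_sigma, Finset.mem_univ, true_and, Finset.mem_filter] at h
    exact mem_siblings.2 ⟨Ne.symm h.1, h.2.symm⟩
  · rintro ⟨a, b⟩ h
    rw [mem_siblings] at h
    simpa using ⟨Ne.symm h.1, h.2.symm⟩

/-- The summation variable is a', a half-edge of the edge to be doubled; a and τ c are chosen
independently among the siblings of its two ends. -/
lemma card_multiTriples (τ : Config d) :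
    (multiTriples τ).card = ∑ a, sibCount a * sibCount (τ.1 a) := by
  unfold sibCount
  simp_rw [← Finset.card_product]
  rw [← Finset.card_sigma]
  refine Finset.card_bij' (fun p _ => ⟨p.2.1, p.1, τ.1 p.2.2⟩)
    (fun x _ => (x.2.1, x.1, τ.1 x.2.2)) ?_ ?_ (by simp) (by simp)
  · rintro ⟨a, a', c⟩ h
    rw [mem_multiTriples] at h
    simpa [and_assoc] using h
  · rintro ⟨a', a, c⟩ h
    simp only [Finset.mem_sigma, Finset.mem_univ, true_and, Finset.mem_product,
      Finset.mem_filter] at h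
    rw [mem_multiTriples]
    refine ⟨h.1.1, h.1.2, fun e => h.2.1 ?_, by simpa using h.2.2⟩
    simp only at e
    rw [← e, Config.partner_partner]

lemma sum_pair_eq (φ : HalfEdge d → HalfEdge d → ℝ) :
    ∑ τ : Config d, ∑ a, φ a (τ.1 a) = ∑ a, ∑ b, (containing [(a, b)]).card * φ a b := by
  rw [Finset.sum_comm]
  refine Finset.sum_congr rfl fun a _ => ?_
  have : ∀ τ : Config d, φ a (τ.1 a) = ∑ b, if τ.1 a = b then φ a b else 0 := by simp
  simp_rw [this]
  rw [Finset.sum_comm]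
  refine Finset.sum_congr rfl fun b _ => ?_
  rw [← Finset.sum_filter, Finset.sum_const, nsmul_eq_mul]
  congr 3
  ext τ; simp [mem_containing]

lemma card_containing_self (a : HalfEdge d) : (containing [(a, a)]).card = 0 := by
  rw [Finset.card_eq_zero, Finset.eq_empty_iff_forall_notMem]
  intro τ h
  exact τ.partner_ne a (mem_containing.1 h (a, a) (by simp))

variable (g : HalfEdge d → ℝ)

lemma sum_energy_eq (hN : 16 ≤ Fintype.card (HalfEdge d)) :
    ∑ τ : Config d, ∑ a, g a * g (τ.1 a) =
      (Fintype.card (Config d) : ℝ) / ((Fintype.card (HalfEdge d) : ℝ) - 1) *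
        ((∑ a, g a) ^ 2 - ∑ a, g a ^ 2) := by
  have hN' : (0 : ℝ) < (Fintype.card (HalfEdge d) : ℝ) - 1 := by
    have : (16 : ℝ) ≤ Fintype.card (HalfEdge d) := by exact_mod_cast hN
    linarith
  rw [sum_pair_eq fun a b => g a * g b]
  have : ∀ a b : HalfEdge d, ((containing [(a, b)]).card : ℝ) * (g a * g b) =
      (Fintype.card (Config d) : ℝ) / ((Fintype.card (HalfEdge d) : ℝ) - 1) *
        (g a * g b - if a = b then g a * g b else 0) := by
    intro a b
    split_ifs with h
    · subst h; rw [card_containing_self]; simp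
    · rw [sub_zero, ← card_containing_single h, Nat.cast_mul, Nat.cast_sub (by omega),
        Nat.cast_one, mul_div_cancel_right₀ _ hN'.ne']
  simp_rw [this, ← Finset.mul_sum, Finset.sum_sub_distrib]
  congr 1
  simp only [Finset.sum_ite_eq, Finset.mem_univ, if_true]
  rw [sq, Finset.sum_mul_sum]
  simp_rw [sq]

lemma sum_pair_le {φ : HalfEdge d → HalfEdge d → ℝ} (hφ : ∀ a b, 0 ≤ φ a b)
    (hN : 16 ≤ Fintype.card (HalfEdge d)) :
    ∑ τ : Config d, ∑ a, φ a (τ.1 a) ≤ (2 / (Fintype.card (HalfEdge d) : ℝ)) *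
      Fintype.card (Config d) * ∑ a, ∑ b, φ a b := by
  rw [sum_pair_eq, Finset.mul_sum]
  refine Finset.sum_le_sum fun a _ => ?_
  rw [Finset.mul_sum]
  refine Finset.sum_le_sum fun b _ => mul_le_mul_of_nonneg_right ?_ (hφ a b)
  by_cases h : a = b
  · subst h; rw [card_containing_self, Nat.cast_zero]; positivity
  · have h := card_containing_single h
    have hN' : (16 : ℝ) ≤ Fintype.card (HalfEdge d) := by exact_mod_cast hN
    rw [← h, Nat.cast_mul, Nat.cast_sub (by omega), Nat.cast_one, div_mul_eq_mul_div,
      le_div_iff₀ (by linarith)]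
    have : (0 : ℝ) ≤ (containing [(a, b)]).card := Nat.cast_nonneg _
    nlinarith

/-- Two prescribed disjoint edges occur together with probability at most 1 / (N - 4)². As g is
nonnegative, the sum may then be extended to all quadruples, where it factorises. -/
lemma sum_four_le (hg : ∀ a, 0 ≤ g a) (hN : 16 ≤ Fintype.card (HalfEdge d)) :
    ∑ τ : Config d, ∑ a, ∑ e ∈ otherHalfEdges τ a, (g a * g (τ.1 a)) * (g e * g (τ.1 e)) ≤
      (Fintype.card (Config d) : ℝ) / ((Fintype.card (HalfEdge d) : ℝ) - 4) ^ 2 *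
        (∑ a, g a) ^ 4 := by
  have hN' : (0 : ℝ) < (Fintype.card (HalfEdge d) : ℝ) - 4 := by
    have : (16 : ℝ) ≤ Fintype.card (HalfEdge d) := by exact_mod_cast hN
    linarith
  have h1 : ∀ τ : Config d, ∀ a, ∑ e ∈ otherHalfEdges τ a,
      (g a * g (τ.1 a)) * (g e * g (τ.1 e)) = ∑ e, ∑ b, ∑ f,
        if τ.1 a = b ∧ τ.1 e = f ∧ e ≠ a ∧ e ≠ b then (g a * g b) * (g e * g f) else 0 := by
    intro τ a
    rw [otherHalfEdges, Finset.sum_filter]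
    refine Finset.sum_congr rfl fun e _ => ?_
    rw [Finset.sum_eq_single (τ.1 a), Finset.sum_eq_single (τ.1 e)]
    · simp
    · intro f _ hf; rw [if_neg]; exact fun h => hf h.2.1.symm
    · simp
    · intro b _ hb
      refine Finset.sum_eq_zero fun f _ => ?_
      rw [if_neg]; exact fun h => hb h.1.symm
    · simp
  simp_rw [h1]
  have h2 : ∀ a e b f : HalfEdge d, ∑ τ : Config d,
      (if τ.1 a = b ∧ τ.1 e = f ∧ e ≠ a ∧ e ≠ b then (g a * g b) * (g e * g f) else 0) ≤
      (Fintype.card (Config d) : ℝ) / ((Fintype.card (HalfEdge d) : ℝ) - 4) ^ 2 *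
        ((g a * g b) * (g e * g f)) := by
    intro a e b f
    rw [← Finset.sum_filter, Finset.sum_const, nsmul_eq_mul]
    refine mul_le_mul_of_nonneg_right ?_ (mul_nonneg (mul_nonneg (hg _) (hg _))
      (mul_nonneg (hg _) (hg _)))
    rcases Finset.eq_empty_or_nonempty (Finset.univ.filter fun τ : Config d =>
      τ.1 a = b ∧ τ.1 e = f ∧ e ≠ a ∧ e ≠ b) with h | ⟨τ, hτ⟩
    · rw [h, Finset.card_empty]; simp only [Nat.cast_zero]; positivity
    · rw [Finset.mem_filter] at hτ
      obtain ⟨-, rfl, rfl, h3, h4⟩ := hτ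
      have h5 := card_containing_mul_le [(a, τ.1 a), (e, τ.1 e)] (by
        have h6 := τ.partner_ne a
        have h7 := τ.partner_ne e
        have h8 : a ≠ τ.1 e := fun h => h4 (τ.partner_eq_iff.1 h.symm)
        have h9 : τ.1 a ≠ τ.1 e := fun h => h3 (τ.1.injective h).symm
        simp
        exact ⟨⟨h6.symm, Ne.symm h3, h8⟩, ⟨Ne.symm h4, Ne.symm h3⟩, h7.symm⟩)
      have h6 : (((containing [(a, τ.1 a), (e, τ.1 e)]).card *
        (Fintype.card (HalfEdge d) - 2 * 2) ^ 2 : ℕ) : ℝ) ≤ Fintype.card (Config d) := by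
        exact_mod_cast h5
      rw [Nat.cast_mul, Nat.cast_pow, Nat.cast_sub (by omega)] at h6
      rw [le_div_iff₀ (by positivity)]
      refine le_trans ?_ h6
      push_cast
      norm_num
      gcongr
      intro ρ hρ
      rw [Finset.mem_filter] at hρ
      simp [mem_containing, hρ.2.1, hρ.2.2.1]
  calc _ = ∑ a, ∑ e, ∑ b, ∑ f, ∑ τ : Config d,
      (if τ.1 a = b ∧ τ.1 e = f ∧ e ≠ a ∧ e ≠ b then (g a * g b) * (g e * g f) else 0) := by
        rw [Finset.sum_comm]
        refine Finset.sum_congr rfl fun a _ => ?_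
        rw [Finset.sum_comm]
        refine Finset.sum_congr rfl fun e _ => ?_
        rw [Finset.sum_comm]
        refine Finset.sum_congr rfl fun b _ => ?_
        rw [Finset.sum_comm]
    _ ≤ ∑ a, ∑ e, ∑ b, ∑ f, (Fintype.card (Config d) : ℝ) /
          ((Fintype.card (HalfEdge d) : ℝ) - 4) ^ 2 * ((g a * g b) * (g e * g f)) :=
        Finset.sum_le_sum fun a _ => Finset.sum_le_sum fun e _ => Finset.sum_le_sum fun b _ =>
          Finset.sum_le_sum fun f _ => h2 a e b f
    _ = _ := by
        have : (∑ a, g a) ^ 4 = ∑ a, ∑ e, ∑ b, ∑ f, (g a * g b) * (g e * g f) := by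
          have e1 : ∀ a e b : HalfEdge d, ∑ f, (g a * g b) * (g e * g f) =
              (g a * g e * ∑ f, g f) * g b := by
            intro a e b; rw [← Finset.mul_sum, ← Finset.mul_sum]; ring
          have e2 : ∀ a e : HalfEdge d, ∑ b, (g a * g e * ∑ f, g f) * g b =
              (g a * (∑ f, g f) * (∑ f, g f)) * g e := by
            intro a e; rw [← Finset.mul_sum]; ring
          simp_rw [e1, e2, ← Finset.mul_sum, ← Finset.sum_mul]
          ring
        rw [this]
        simp_rw [Finset.mul_sum]

lemma sum_energy_sq_le (hg : ∀ a, 0 ≤ g a) (hN : 16 ≤ Fintype.card (HalfEdge d)) :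
    ∑ τ : Config d, (∑ a, g a * g (τ.1 a)) ^ 2 ≤ Fintype.card (Config d) *
      (4 * (∑ a, g a ^ 2) ^ 2 / Fintype.card (HalfEdge d) +
        (∑ a, g a) ^ 4 / ((Fintype.card (HalfEdge d) : ℝ) - 4) ^ 2) := by
  -- In the expanded square, the terms with e = a and e = τ a are equal; they give the factor 2.
  have h0 : ∀ τ : Config d, (∑ a, g a * g (τ.1 a)) ^ 2 = 2 * ∑ a, g a ^ 2 * g (τ.1 a) ^ 2 +
      ∑ a, ∑ e ∈ otherHalfEdges τ a, (g a * g (τ.1 a)) * (g e * g (τ.1 e)) := by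
    intro τ
    rw [sq, Finset.sum_mul_sum, Finset.mul_sum, ← Finset.sum_add_distrib]
    refine Finset.sum_congr rfl fun a _ => ?_
    have h1 : otherHalfEdges τ a = Finset.univ \ {a, τ.1 a} := by
      ext c; simp [mem_otherHalfEdges]
    rw [h1, ← Finset.sum_sdiff (Finset.subset_univ {a, τ.1 a}),
      Finset.sum_pair (τ.partner_ne a).symm, Config.partner_partner]
    ring
  simp_rw [h0]
  rw [Finset.sum_add_distrib, ← Finset.mul_sum, mul_add]
  apply add_le_add
  · have := sum_pair_le (φ := fun a b : HalfEdge d => g a ^ 2 * g b ^ 2)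
      (fun a b => by positivity) hN
    refine (mul_le_mul_of_nonneg_left this zero_le_two).trans_eq ?_
    rw [← Finset.sum_mul_sum]
    ring
  · refine (sum_four_le g hg hN).trans_eq ?_
    ring

/-- The left side is the mean squared deviation from G² / (N - 1). The terms in G⁴ are of order N²
but cancel up to order N, since N - 4 and N - 1 differ by a constant; the terms with Q are of order
at most N D² and N D. -/
lemma energy_bound {N M D G Q : ℝ} (hN : 16 ≤ N) (hM : 0 ≤ M) (hD : 0 ≤ D) (hG0 : 0 ≤ G)
    (hQ0 : 0 ≤ Q) (hG : G ≤ M * N) (hQG : Q ≤ D * G) :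
    (4 * Q ^ 2 / N + G ^ 4 / (N - 4) ^ 2) - 2 * (G ^ 2 / (N - 1)) *
      (G ^ 2 / (N - 1) - Q / (N - 1)) + (G ^ 2 / (N - 1)) ^ 2 ≤
      N * (4 * M ^ 2 * D ^ 2 + 96 * M ^ 4 + 8 * M ^ 3 * D) := by
  have hN0 : 0 < N := by linarith
  have hN1 : 0 < N - 1 := by linarith
  have hN4 : 0 < N - 4 := by linarith
  have hQ : Q ≤ D * (M * N) := hQG.trans (by gcongr)
  have i1 : 4 * Q ^ 2 / N ≤ N * (4 * M ^ 2 * D ^ 2) := by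
    rw [div_le_iff₀ hN0]
    calc 4 * Q ^ 2 ≤ 4 * (D * (M * N)) ^ 2 := by gcongr
      _ = _ := by ring
  have i2 : G ^ 4 / (N - 4) ^ 2 - (G ^ 2 / (N - 1)) ^ 2 ≤ N * (96 * M ^ 4) := by
    have e1 : G ^ 4 / (N - 4) ^ 2 - (G ^ 2 / (N - 1)) ^ 2 =
        G ^ 4 * (3 * (2 * N - 5) / ((N - 4) ^ 2 * (N - 1) ^ 2)) := by
      have := hN1.ne'
      have := hN4.ne'
      field_simp; ring
    have e2 : 3 * (2 * N - 5) / ((N - 4) ^ 2 * (N - 1) ^ 2) ≤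
        6 * N / ((N / 2) ^ 2 * (N / 2) ^ 2) := by
      apply div_le_div₀ (by linarith) (by linarith) (by positivity)
      gcongr <;> linarith
    rw [e1]
    calc _ ≤ (M * N) ^ 4 * (6 * N / ((N / 2) ^ 2 * (N / 2) ^ 2)) := by
          refine mul_le_mul (by gcongr) e2 ?_ (by positivity)
          exact div_nonneg (by linarith) (by positivity)
      _ = _ := by field_simp; ring
  have i3 : 2 * (G ^ 2 / (N - 1)) * (Q / (N - 1)) ≤ N * (8 * M ^ 3 * D) := by
    have hw' : G ^ 2 / (N - 1) ≤ (M * N) ^ 2 / (N / 2) := by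
      apply div_le_div₀ (by positivity) (by gcongr) (by linarith) (by linarith)
    have hq' : Q / (N - 1) ≤ D * (M * N) / (N / 2) :=
      div_le_div₀ (by positivity) hQ (by linarith) (by linarith)
    have : 0 ≤ Q / (N - 1) := div_nonneg hQ0 hN1.le
    have : 0 ≤ G ^ 2 / (N - 1) := by positivity
    calc 2 * (G ^ 2 / (N - 1)) * (Q / (N - 1)) ≤
        2 * ((M * N) ^ 2 / (N / 2)) * (D * (M * N) / (N / 2)) := by gcongr
      _ = _ := by field_simp; ring
  linarith

/-- Concentration of the number of ways to create a double edge. -/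
lemma sum_multiTriples_sub_sq_le {M : ℝ} {Δ : ℕ} (hΔ : ∀ i, d i ≤ Δ)
    (hN : 16 ≤ Fintype.card (HalfEdge d))
    (hG : ((siblings d).card : ℝ) ≤ M * Fintype.card (HalfEdge d)) :
    ∑ τ : Config d, ((multiTriples τ).card - ((siblings d).card : ℝ) ^ 2 /
      ((Fintype.card (HalfEdge d) : ℝ) - 1)) ^ 2 ≤
      Fintype.card (Config d) * (Fintype.card (HalfEdge d) *
        (4 * M ^ 2 * Δ ^ 2 + 96 * M ^ 4 + 8 * M ^ 3 * Δ)) := by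
  have hN' : (16 : ℝ) ≤ Fintype.card (HalfEdge d) := by exact_mod_cast hN
  set N : ℝ := ((Fintype.card (HalfEdge d) : ℕ) : ℝ) with hNdef
  set C : ℝ := ((Fintype.card (Config d) : ℕ) : ℝ) with hC
  set G : ℝ := (((siblings d).card : ℕ) : ℝ) with hGdef
  set g : HalfEdge d → ℝ := fun a => sibCount a with hg
  have hgG : ∑ a, g a = G := by rw [hg, hGdef, ← sum_sibCount]; push_cast; rfl
  set Q : ℝ := ∑ a, g a ^ 2 with hQ
  have hQ0 : 0 ≤ Q := Finset.sum_nonneg fun a _ => sq_nonneg _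
  have hG0 : 0 ≤ G := Nat.cast_nonneg _
  have hC0 : 0 ≤ C := Nat.cast_nonneg _
  have hQG : Q ≤ Δ * G := by
    rw [hQ, ← hgG, Finset.mul_sum]
    refine Finset.sum_le_sum fun a _ => ?_
    rw [sq]
    exact mul_le_mul_of_nonneg_right (Nat.cast_le.2 (sibCount_le hΔ a)) (Nat.cast_nonneg _)
  have hW : ∀ τ : Config d, ((multiTriples τ).card : ℝ) = ∑ a, g a * g (τ.1 a) := by
    intro τ; rw [card_multiTriples]; push_cast; rfl
  have h1 := sum_energy_eq g hN
  have h2 := sum_energy_sq_le g (fun a => Nat.cast_nonneg _) hN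
  rw [hgG] at h1 h2
  simp_rw [hW]
  set w := G ^ 2 / (N - 1) with hw
  have h3 : ∑ τ : Config d, (∑ a, g a * g (τ.1 a) - w) ^ 2 =
      ∑ τ : Config d, (∑ a, g a * g (τ.1 a)) ^ 2 - 2 * w * ∑ τ : Config d, ∑ a, g a * g (τ.1 a) +
      C * w ^ 2 := by
    simp_rw [sub_sq]
    rw [Finset.sum_add_distrib, Finset.sum_sub_distrib, Finset.sum_const, nsmul_eq_mul,
      Finset.card_univ, ← hC, Finset.mul_sum]
    congr 2
    exact Finset.sum_congr rfl fun τ _ => by ring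
  rw [h3, h1]
  have hM0 : 0 ≤ M := by
    by_contra h
    push Not at h
    nlinarith
  have e : C / (N - 1) * (G ^ 2 - Q) = C * (w - Q / (N - 1)) := by
    rw [hw]; ring
  rw [e]
  calc _ ≤ C * (4 * Q ^ 2 / N + G ^ 4 / (N - 4) ^ 2) - 2 * w * (C * (w - Q / (N - 1))) +
        C * w ^ 2 := by gcongr
    _ = C * ((4 * Q ^ 2 / N + G ^ 4 / (N - 4) ^ 2) - 2 * w * (w - Q / (N - 1)) + w ^ 2) := by ring
    _ ≤ _ := mul_le_mul_of_nonneg_left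
        (energy_bound hN' hM0 (Nat.cast_nonneg _) hG0 hQ0 hG hQG) hC0

lemma sum_abs_multiTriples_sub_le {M δ : ℝ} {Δ : ℕ} (hΔ : ∀ i, d i ≤ Δ)
    (hN : 16 ≤ Fintype.card (HalfEdge d))
    (hG : ((siblings d).card : ℝ) ≤ M * Fintype.card (HalfEdge d)) (hM : 0 ≤ M)
    (hδ : 1 ≤ δ * Fintype.card (HalfEdge d))
    (hΔN : (Δ : ℝ) ^ 2 ≤ δ * Fintype.card (HalfEdge d)) :
    ∑ τ : Config d, |(multiTriples τ).card - ((siblings d).card : ℝ) ^ 2 /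
      ((Fintype.card (HalfEdge d) : ℝ) - 1)| ≤
      √(δ * (4 * M ^ 2 + 96 * M ^ 4 + 8 * M ^ 3)) *
        (Fintype.card (Config d) * Fintype.card (HalfEdge d)) := by
  have h1 := sum_multiTriples_sub_sq_le hΔ hN hG
  set N : ℝ := ((Fintype.card (HalfEdge d) : ℕ) : ℝ) with hNdef
  set C : ℝ := ((Fintype.card (Config d) : ℕ) : ℝ) with hC
  have hN0 : 0 ≤ N := Nat.cast_nonneg _
  have hC0 : 0 ≤ C := Nat.cast_nonneg _
  have hΔ1 : (Δ : ℝ) ≤ δ * N := by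
    refine le_trans ?_ hΔN
    exact_mod_cast (Nat.le_self_pow two_ne_zero Δ)
  have h2 : C * (N * (4 * M ^ 2 * Δ ^ 2 + 96 * M ^ 4 + 8 * M ^ 3 * Δ)) ≤
      C * (N * (4 * M ^ 2 * (δ * N) + 96 * M ^ 4 * (δ * N) + 8 * M ^ 3 * (δ * N))) := by
    have : 96 * M ^ 4 ≤ 96 * M ^ 4 * (δ * N) := le_mul_of_one_le_right (by positivity) hδ
    have : 4 * M ^ 2 * Δ ^ 2 ≤ 4 * M ^ 2 * (δ * N) := by gcongr
    have : 8 * M ^ 3 * Δ ≤ 8 * M ^ 3 * (δ * N) := by gcongr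
    exact mul_le_mul_of_nonneg_left (mul_le_mul_of_nonneg_left (by linarith) hN0) hC0
  -- Cauchy–Schwarz turns the second moment, at most a constant times δ N² per configuration, into a
  -- bound for the absolute deviation; this is where the square root of δ arises.
  have h3 := sq_sum_le_card_mul_sum_sq (s := (Finset.univ : Finset (Config d)))
    (f := fun τ => |(multiTriples τ).card - ((siblings d).card : ℝ) ^ 2 / (N - 1)|)
  simp_rw [sq_abs] at h3
  rw [Finset.card_univ, ← hC] at h3
  have h4 : (∑ τ : Config d, |(multiTriples τ).card - ((siblings d).card : ℝ) ^ 2 / (N - 1)|) ^ 2 ≤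
      (C * N) ^ 2 * (δ * (4 * M ^ 2 + 96 * M ^ 4 + 8 * M ^ 3)) := by
    refine h3.trans ((mul_le_mul_of_nonneg_left (h1.trans h2) hC0).trans_eq ?_)
    ring
  refine (Real.le_sqrt_of_sq_le h4).trans_eq ?_
  rw [Real.sqrt_mul (by positivity), Real.sqrt_sq (by positivity), mul_comm]

end Variance

/-! ### Induction over the classes of nice configurations -/

section Induction

variable {n : ℕ} {d : Fin n → ℕ}

/-- Here a and b are the sizes of the upper and lower class, `VA` and `VB` their total values, `WB`
the number of good switchings, `VWB` the value of the lower class weighted by the number of reverse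
switchings, and w the typical such number. Up to errors of order η C N, the chain is t N `VA` ≥
`VWB` ≥ w `VB` ≥ w b u ≥ t N a u; division by t (N - 2) gives the claim. Errors are measured against
C rather than a, so small classes need no special care. -/
lemma step_bound {N m t a b C VA VB WB VWB e₁ e₂ w u E η M k : ℝ}
    (hN : 16 ≤ N) (ht : 1 ≤ t) (hm0 : 0 ≤ m) (hm : m ≤ η * N) (hη : 1 ≤ η * N) (ha0 : 0 ≤ a)
    (ha : a ≤ C) (hu0 : 0 ≤ u) (hu1 : u ≤ 1) (hw0 : 0 ≤ w) (hw : w ≤ M * N) (hE : 0 ≤ E)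
    (hk : 0 ≤ k) (he₁ : e₁ ≤ η * (C * N)) (he₂ : e₂ ≤ η * (C * N))
    (h1 : a * (t * (N - m)) ≤ WB) (h1' : WB ≤ w * b + e₁)
    (h2 : VWB ≤ t * ((N - 2) * (VA + a * (k * ((2 * m + 2) / (N - 2))))) + e₂)
    (h2' : w * VB - e₁ ≤ VWB) (h3 : b * u - E * (η * C) ≤ VB) :
    a * u - (8 + 2 * M * E + 8 * k) * (η * C) ≤ VA := by
  have hN2 : 0 < N - 2 := by linarith
  have hη0 : 0 < η := by
    by_contra h
    push Not at h
    nlinarith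
  have hC0 : 0 ≤ C := ha0.trans ha
  have hM0 : 0 ≤ M := by
    by_contra h
    push Not at h
    nlinarith
  have e : t * ((N - 2) * (VA + a * (k * ((2 * m + 2) / (N - 2))))) =
      t * (N - 2) * VA + t * (a * (k * (2 * m + 2))) := by
    field_simp
  rw [e] at h2
  set X := η * (C * N) with hX
  have hX0 : 0 ≤ X := by positivity
  have b1 : a * (k * (2 * m + 2)) ≤ 4 * k * X := by
    have : a * (k * (2 * m + 2)) ≤ C * (k * (4 * (η * N))) := by
      gcongr
      linarith
    exact this.trans_eq (by rw [hX]; ring)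
  have b2 : w * (E * (η * C)) ≤ M * E * X := by
    have : w * (E * (η * C)) ≤ (M * N) * (E * (η * C)) := by gcongr
    exact this.trans_eq (by rw [hX]; ring)
  have b3 : w * (b * u - E * (η * C)) ≤ w * VB := mul_le_mul_of_nonneg_left h3 hw0
  have b4 : u * (a * (t * (N - m))) ≤ u * (w * b + e₁) :=
    mul_le_mul_of_nonneg_left (h1.trans h1') hu0
  have b5 : u * e₁ ≤ X := by
    calc u * e₁ ≤ u * X := by gcongr
      _ ≤ 1 * X := by gcongr
      _ = X := one_mul X
  have b6 : u * (a * (t * m)) ≤ t * X := by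
    calc u * (a * (t * m)) ≤ 1 * (C * (t * (η * N))) := by gcongr
      _ = t * X := by rw [hX]; ring
  have b7 : 0 ≤ u * (a * t) := by positivity
  have key : t * (N - 2) * (a * u) - (3 * X + M * E * X + t * X + t * (4 * k * X)) ≤
      t * (N - 2) * VA := by
    have c1 : t * (a * (k * (2 * m + 2))) ≤ t * (4 * k * X) := by gcongr
    have c2 : u * (a * (t * (N - m))) =
        t * (N - 2) * (a * u) + 2 * (u * (a * t)) - u * (a * (t * m)) := by ring
    have c3 : w * (b * u - E * (η * C)) = u * (w * b) - w * (E * (η * C)) := by ring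
    have c4 : u * (w * b + e₁) = u * (w * b) + u * e₁ := by ring
    linarith
  have key2 : 3 * X + M * E * X + t * X + t * (4 * k * X) ≤ t * ((4 + M * E + 4 * k) * X) := by
    have : (3 + M * E) * X ≤ t * ((3 + M * E) * X) := le_mul_of_one_le_left (by positivity) ht
    linarith
  have key3 : (4 + M * E + 4 * k) * X ≤ (N - 2) * ((8 + 2 * M * E + 8 * k) * (η * C)) := by
    have : X ≤ (N - 2) * (2 * (η * C)) := by
      calc X = η * C * N := by rw [hX]; ring
        _ ≤ η * C * (2 * (N - 2)) := by gcongr; linarith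
        _ = _ := by ring
    calc (4 + M * E + 4 * k) * X ≤ (4 + M * E + 4 * k) * ((N - 2) * (2 * (η * C))) := by gcongr
      _ = _ := by ring
  have key4 : t * (N - 2) * (a * u - (8 + 2 * M * E + 8 * k) * (η * C)) ≤ t * (N - 2) * VA := by
    have := mul_le_mul_of_nonneg_left key3 (zero_le_one.trans ht)
    linarith
  exact le_of_mul_le_mul_left key4 (by positivity)

/-- The constants in the error terms. -/
noncomputable def errConst (M : ℝ) : ℕ → ℝ
  | 0 => 0
  | k + 1 => 8 + 2 * M * errConst M k + 8 * (k + 1)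

lemma errConst_nonneg {M : ℝ} (hM : 0 ≤ M) (k : ℕ) : 0 ≤ errConst M k := by
  induction k with
  | zero => rfl
  | succ k ih => unfold errConst; positivity

lemma exists_goodSwitch {K m : ℕ} (hG : MostlyGood d K m) (hm : m < Fintype.card (HalfEdge d))
    {σ : Config d} (hσ : Nice σ) (hK : (badSet σ).card ≤ K) {a : HalfEdge d} (ha : IsBad σ a) :
    ∃ c, GoodSwitch σ a c := by
  obtain ⟨X, hXm, hX⟩ := hG σ hσ hK a ha
  by_contra hcon
  push Not at hcon
  have : (Finset.univ : Finset (HalfEdge d)) ⊆ X := fun c _ => by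
    by_contra h
    exact hcon c (hX c h)
  have := Finset.card_le_card this
  rw [Finset.card_univ] at this
  omega

/-- A good switching at a loop exists and lowers the count by exactly 2, so the count was at least
2. -/
lemma two_le_of_mem_niceClass {K m l l' : ℕ} (hG : MostlyGood d K m)
    (hm : m < Fintype.card (HalfEdge d)) (hK : l + l' ≤ K) {σ : Config d}
    (hσ : σ ∈ niceClass d l l') (hl : l ≠ 0) : 2 ≤ l := by
  have hb := card_badSet_of_mem_niceClass hσ
  rw [mem_niceClass] at hσ
  obtain ⟨a, ha⟩ := Finset.card_ne_zero.1 (hσ.2.1.trans_ne hl)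
  rw [mem_loops] at ha
  obtain ⟨c, hc⟩ := exists_goodSwitch hG hm hσ.1 (hb.trans_le hK) (isBad_of_loop ha)
  have := hc.card_loops_of_loop ha
  omega

lemma four_le_of_mem_niceClass {K m l l' : ℕ} (hG : MostlyGood d K m)
    (hm : m < Fintype.card (HalfEdge d)) (hK : l + l' ≤ K) {σ : Config d}
    (hσ : σ ∈ niceClass d l l') (hl : l' ≠ 0) : 4 ≤ l' := by
  have hb := card_badSet_of_mem_niceClass hσ
  rw [mem_niceClass] at hσ
  obtain ⟨a, ha⟩ := Finset.card_ne_zero.1 (hσ.2.2.trans_ne hl)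
  rw [mem_multiples] at ha
  obtain ⟨c, hc⟩ := exists_goodSwitch hG hm hσ.1 (hb.trans_le hK) ha.1
  have := hc.card_loops_of_not_loop ha.2
  omega

lemma isSimple_iff_mem_niceClass {σ : Config d} : IsSimple σ ↔ σ ∈ niceClass d 0 0 := by
  constructor
  · intro h
    have h0 := isSimple_iff_badSet.1 h
    have h1 := card_loops_add_card_multiples σ
    rw [h0, Finset.card_empty] at h1
    rw [mem_niceClass]
    refine ⟨fun a => ?_, by omega, by omega⟩
    have := h a
    rw [isBad_iff_card] at this
    omega
  · intro h
    have := card_badSet_of_mem_niceClass h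
    rw [isSimple_iff_badSet, ← Finset.card_eq_zero, this]

/-- The degree sequence is regular enough for switchings to be well-behaved on configurations
with at most `K` half-edges in bad edges. -/
structure Regular (d : Fin n → ℕ) (K m Δ : ℕ) (M η : ℝ) : Prop where
  le_max : ∀ i, d i ≤ Δ
  mostlyGood : MostlyGood d K m
  exceptional_lt : m < Fintype.card (HalfEdge d)
  large : 16 ≤ Fintype.card (HalfEdge d)
  siblings_le : ((siblings d).card : ℝ) ≤ M * Fintype.card (HalfEdge d)
  one_le : 1 ≤ M
  exceptional_le : (m : ℝ) ≤ η * Fintype.card (HalfEdge d)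
  one_le_error : 1 ≤ η * Fintype.card (HalfEdge d)
  error_le : 3 * (K * (Δ : ℝ) ^ 2) + (2 * M) ^ 3 + (2 * M) ^ 4 ≤ η * Fintype.card (HalfEdge d)
  deviation_le : ∑ τ : Config d, |(multiTriples τ).card - ((siblings d).card : ℝ) ^ 2 /
      ((Fintype.card (HalfEdge d) : ℝ) - 1)| ≤
      η * (Fintype.card (Config d) * Fintype.card (HalfEdge d))

variable {S : Set (SimpleGraph (Fin n))} {K m : ℕ} {M η u : ℝ} {Δ : ℕ}

lemma Regular.pos (h : Regular d K m Δ M η) : 0 < η := by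
  by_contra hη
  push Not at hη
  have h1 := h.one_le_error
  have : η * (Fintype.card (HalfEdge d) : ℝ) ≤ 0 := mul_nonpos_of_nonpos_of_nonneg hη
    (Nat.cast_nonneg _)
  linarith

lemma cast_card_le_config (A : Finset (Config d)) : (A.card : ℝ) ≤ Fintype.card (Config d) := by
  exact_mod_cast Finset.card_le_univ A

lemma sum_cast_le_sum_univ (A : Finset (Config d)) (f : Config d → ℕ) :
    ∑ τ ∈ A, (f τ : ℝ) ≤ ∑ τ, (f τ : ℝ) :=
  Finset.sum_le_sum_of_subset_of_nonneg (Finset.subset_univ A) fun _ _ _ => Nat.cast_nonneg _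

lemma Regular.sum_error_le (h : Regular d K m Δ M η) {l l' : ℕ} (hK : l + l' ≤ K)
    (A : Finset (Config d)) : ∑ τ ∈ A,
      ((3 * ((l + l') * (Δ * Δ)) + ((triangles τ).card + (fourCycles τ).card) : ℕ) : ℝ) ≤
      η * (Fintype.card (Config d) * Fintype.card (HalfEdge d)) := by
  push_cast
  rw [Finset.sum_add_distrib, Finset.sum_add_distrib, Finset.sum_const, nsmul_eq_mul]
  have i1 := (sum_cast_le_sum_univ A fun τ => (triangles τ).card).trans
    (sum_triangles_le h.large h.siblings_le)
  have i5 := (sum_cast_le_sum_univ A fun τ => (fourCycles τ).card).trans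
    (sum_fourCycles_le h.large h.siblings_le)
  have i2 : (A.card : ℝ) * (3 * ((l + l') * (Δ * Δ))) ≤
      Fintype.card (Config d) * (3 * (K * (Δ : ℝ) ^ 2)) := by
    rw [sq]
    have h1 := cast_card_le_config A
    have h2 : ((l : ℝ) + l') ≤ K := by exact_mod_cast hK
    gcongr
  have i3 := mul_le_mul_of_nonneg_left h.error_le
    (Nat.cast_nonneg (Fintype.card (Config d)) : (0 : ℝ) ≤ _)
  calc _ ≤ Fintype.card (Config d) * (3 * (K * (Δ : ℝ) ^ 2)) +
        ((2 * M) ^ 3 * Fintype.card (Config d) + (2 * M) ^ 4 * Fintype.card (Config d)) :=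
        add_le_add i2 (add_le_add i1 i5)
    _ = Fintype.card (Config d) * (3 * (K * (Δ : ℝ) ^ 2) + (2 * M) ^ 3 + (2 * M) ^ 4) := by ring
    _ ≤ _ := i3
    _ = _ := by ring

/-- In `step_bound`, w is the number of sibling pairs and `e₁` is 0, as there is no fluctuation. The
bound M N for w is weakened to 2 M² N to give the same constants as for double edges. -/
lemma Regular.step_loops (h : Regular d K m Δ M η) (hu0 : 0 ≤ u) (hu1 : u ≤ 1) {k l l' : ℕ}
    (hK : l + 2 + l' ≤ K) {E : ℝ} (hE : 0 ≤ E)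
    (ih : (niceClass d l l').card * u - E * (η * Fintype.card (Config d)) ≤
      ∑ σ ∈ niceClass d l l', value S k σ) :
    (niceClass d (l + 2) l').card * u -
      (8 + 2 * (2 * M ^ 2) * E + 8 * (k + 1)) * (η * Fintype.card (Config d)) ≤
      ∑ σ ∈ niceClass d (l + 2) l', value S (k + 1) σ := by
  have hN' : (16 : ℝ) ≤ Fintype.card (HalfEdge d) := by exact_mod_cast h.large
  have hη0 := h.pos
  have hA : ∀ σ ∈ niceClass d (l + 2) l', Nice σ ∧ (badSet σ).card ≤ K ∧
      (loops σ).card = l + 2 ∧ loops σ ⊆ badSet σ := fun σ hσ =>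
    ⟨(mem_niceClass.1 hσ).1, (card_badSet_of_mem_niceClass hσ).trans_le hK,
      (mem_niceClass.1 hσ).2.1, loops_subset_badSet σ⟩
  have h1 := card_goodSwitches_ge h.mostlyGood hA
  have h1' := card_goodSwitches_loops_le (d := d) l l'
  have h2 := sum_goodSwitches_le (S := S) (k := k) h.mostlyGood
    (lt_of_lt_of_le (by norm_num) h.large) hA
  have h2' := sum_loopPairs_le (d := d) l l' (S := S) (k := k) h.le_max
  simp_rw [card_loopPairs] at h1' h2'
  rw [Finset.sum_const, smul_eq_mul] at h1'
  rw [← Finset.sum_mul] at h2'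
  have h1'' : ((goodSwitches (niceClass d (l + 2) l') loops).card : ℝ) ≤
    (niceClass d l l').card * (siblings d).card := by exact_mod_cast h1'
  have he : ∑ τ ∈ niceClass d l l',
      ((3 * ((l + l') * (Δ * Δ)) + (triangles τ).card : ℕ) : ℝ) ≤
      η * (Fintype.card (Config d) * Fintype.card (HalfEdge d)) := by
    refine le_trans (Finset.sum_le_sum fun τ _ => ?_)
      (h.sum_error_le (l := l) (l' := l') (by omega) (niceClass d l l'))
    exact Nat.cast_le.2 (by omega)
  have hs : ((siblings d).card : ℝ) ≤ 2 * M ^ 2 * Fintype.card (HalfEdge d) := by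
    refine h.siblings_le.trans ?_
    gcongr
    nlinarith [h.one_le]
  have ht : (1 : ℝ) ≤ (l + 2 : ℕ) := by exact_mod_cast (by omega : 1 ≤ l + 2)
  have h3 : ((siblings d).card : ℝ) * ∑ σ ∈ niceClass d l l', value S k σ - 0 ≤
      ∑ σ ∈ niceClass d l l', value S k σ * (siblings d).card := by
    rw [← Finset.sum_mul, sub_zero, mul_comm]
  rw [← Finset.sum_mul] at h3
  have h4 : ((goodSwitches (niceClass d (l + 2) l') loops).card : ℝ) ≤
    (siblings d).card * (niceClass d l l').card + 0 := by rw [add_zero, mul_comm]; exact h1''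
  have hCN : 0 ≤ η * ((Fintype.card (Config d) : ℝ) * Fintype.card (HalfEdge d)) := by positivity
  exact step_bound hN' ht (Nat.cast_nonneg _) h.exceptional_le h.one_le_error (Nat.cast_nonneg _)
    (cast_card_le_config _) hu0 hu1 (Nat.cast_nonneg _) hs hE (by positivity) hCN he h1 h4
    (h2'.trans (add_le_add_left h2 _)) h3 ih

lemma Regular.step_multiples (h : Regular d K m Δ M η) (hu0 : 0 ≤ u) (hu1 : u ≤ 1) {k l l' : ℕ}
    (hK : l + (l' + 4) ≤ K) {E : ℝ} (hE : 0 ≤ E)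
    (ih : (niceClass d l l').card * u - E * (η * Fintype.card (Config d)) ≤
      ∑ σ ∈ niceClass d l l', value S k σ) :
    (niceClass d l (l' + 4)).card * u -
      (8 + 2 * (2 * M ^ 2) * E + 8 * (k + 1)) * (η * Fintype.card (Config d)) ≤
      ∑ σ ∈ niceClass d l (l' + 4), value S (k + 1) σ := by
  have hN' : (16 : ℝ) ≤ Fintype.card (HalfEdge d) := by exact_mod_cast h.large
  have hη0 := h.pos
  have hA : ∀ σ ∈ niceClass d l (l' + 4), Nice σ ∧ (badSet σ).card ≤ K ∧
      (multiples σ).card = l' + 4 ∧ multiples σ ⊆ badSet σ := fun σ hσ =>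
    ⟨(mem_niceClass.1 hσ).1, (card_badSet_of_mem_niceClass hσ).trans_le hK,
      (mem_niceClass.1 hσ).2.2, Finset.sdiff_subset⟩
  have h1 := card_goodSwitches_ge h.mostlyGood hA
  have h1' := card_goodSwitches_multiples_le (d := d) l l'
  have h2 := sum_goodSwitches_le (S := S) (k := k) h.mostlyGood
    (lt_of_lt_of_le (by norm_num) h.large) hA
  have h2' := sum_multiTriples_le (d := d) l l' (S := S) (k := k) h.le_max
  have h1'' : ((goodSwitches (niceClass d l (l' + 4)) multiples).card : ℝ) ≤
    ∑ τ ∈ niceClass d l l', ((multiTriples τ).card : ℝ) := by exact_mod_cast h1'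
  have he := h.sum_error_le (l := l) (l' := l') (by omega) (niceClass d l l')
  set w : ℝ := ((siblings d).card : ℝ) ^ 2 / ((Fintype.card (HalfEdge d) : ℝ) - 1) with hw
  have hw0 : 0 ≤ w := div_nonneg (sq_nonneg _) (by linarith)
  have hWB := (Finset.sum_le_sum_of_subset_of_nonneg (Finset.subset_univ (niceClass d l l'))
    fun τ _ _ => abs_nonneg _).trans h.deviation_le
  rw [← hw] at hWB
  have ht : (1 : ℝ) ≤ (l' + 4 : ℕ) := by exact_mod_cast (by omega : 1 ≤ l' + 4)
  have hwM : w ≤ 2 * M ^ 2 * Fintype.card (HalfEdge d) := by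
    rw [hw, div_le_iff₀ (by linarith)]
    have h1 : ((siblings d).card : ℝ) ^ 2 ≤ (M * Fintype.card (HalfEdge d)) ^ 2 :=
      pow_le_pow_left₀ (Nat.cast_nonneg _) h.siblings_le 2
    have h2 : 0 ≤ M ^ 2 * (Fintype.card (HalfEdge d) : ℝ) := by positivity
    have h3 : (Fintype.card (HalfEdge d) : ℝ) ≤ 2 * ((Fintype.card (HalfEdge d) : ℝ) - 1) := by
      linarith
    calc _ ≤ _ := h1
      _ = M ^ 2 * (Fintype.card (HalfEdge d) : ℝ) * Fintype.card (HalfEdge d) := by ring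
      _ ≤ M ^ 2 * (Fintype.card (HalfEdge d) : ℝ) * (2 * ((Fintype.card (HalfEdge d) : ℝ) - 1)) :=
        mul_le_mul_of_nonneg_left h3 h2
      _ = _ := by ring
  have h5 : ∑ τ ∈ niceClass d l l', ((multiTriples τ).card : ℝ) ≤ w * (niceClass d l l').card +
      ∑ τ ∈ niceClass d l l', |(multiTriples τ).card - w| := by
    rw [mul_comm, ← nsmul_eq_mul, ← Finset.sum_const, ← Finset.sum_add_distrib]
    refine Finset.sum_le_sum fun τ _ => ?_
    linarith [le_abs_self ((multiTriples τ).card - w)]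
  -- Values lie in [0, 1], so replacing the number of triples by its typical value w costs at most
  -- the absolute deviation.
  have h6 : w * ∑ σ ∈ niceClass d l l', value S k σ -
      ∑ τ ∈ niceClass d l l', |(multiTriples τ).card - w| ≤
      ∑ τ ∈ niceClass d l l', value S k τ * (multiTriples τ).card := by
    rw [Finset.mul_sum, ← Finset.sum_sub_distrib]
    refine Finset.sum_le_sum fun τ _ => ?_
    have j1 := neg_abs_le ((multiTriples τ).card - w)
    have j2 := value_nonneg (S := S) k τ
    have j3 := mul_le_of_le_one_left (abs_nonneg ((multiTriples τ).card - w))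
      (value_le_one (S := S) k τ)
    have j4 := mul_le_mul_of_nonneg_left j1 j2
    linarith
  exact step_bound hN' ht (Nat.cast_nonneg _) h.exceptional_le h.one_le_error (Nat.cast_nonneg _)
    (cast_card_le_config _) hu0 hu1 hw0 hwM hE (by positivity) hWB he (h1.trans h1'') h5
    (h2'.trans (add_le_add_left h2 _)) h6 ih

/-- By induction on the number of bad half-edges, each class of nice configurations ends in `S`
with probability close to at least `u`, if this holds for the class of simple configurations. -/
lemma Regular.niceClass_value_ge (h : Regular d K m Δ M η) (hu0 : 0 ≤ u) (hu1 : u ≤ 1)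
    (hu : (niceClass d 0 0).card * u ≤ ∑ σ ∈ niceClass d 0 0, value S 0 σ)
    (k l l' : ℕ) (hk : l + l' ≤ k) (hK : l + l' ≤ K) :
    (niceClass d l l').card * u - errConst (2 * M ^ 2) k * (η * Fintype.card (Config d)) ≤
      ∑ σ ∈ niceClass d l l', value S k σ := by
  have hM2 : (0 : ℝ) ≤ 2 * M ^ 2 := by positivity
  have herr : ∀ k, 0 ≤ errConst (2 * M ^ 2) k * (η * Fintype.card (Config d)) := fun k =>
    mul_nonneg (errConst_nonneg hM2 k) (mul_nonneg h.pos.le (Nat.cast_nonneg _))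
  have hzero : ∀ k, (niceClass d 0 0).card * u -
      errConst (2 * M ^ 2) k * (η * Fintype.card (Config d)) ≤
      ∑ σ ∈ niceClass d 0 0, value S k σ := by
    intro k
    have h2 : ∑ σ ∈ niceClass d 0 0, value S k σ = ∑ σ ∈ niceClass d 0 0, value S 0 σ := by
      refine Finset.sum_congr rfl fun σ hσ => ?_
      have := isSimple_iff_mem_niceClass.2 hσ
      rw [value_of_isSimple this, value_of_isSimple this]
    linarith [herr k]
  induction k generalizing l l' with
  | zero =>
    obtain ⟨rfl, rfl⟩ : l = 0 ∧ l' = 0 := by omega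
    exact hzero 0
  | succ k ih =>
    -- For an empty class the bound is trivial; a member of the class is needed to see that a whole
    -- loop or double edge can be taken off the counts. As k bounds the number of bad half-edges, it
    -- leaves more than enough steps.
    rcases (niceClass d l l').eq_empty_or_nonempty with he | ⟨σ, hσ⟩
    · rw [he]; simpa using herr (k + 1)
    by_cases hl : l = 0
    · by_cases hl' : l' = 0
      · subst hl hl'; exact hzero _
      obtain ⟨l', rfl⟩ := Nat.exists_eq_add_of_le'
        (four_le_of_mem_niceClass h.mostlyGood h.exceptional_lt hK hσ hl')
      exact h.step_multiples hu0 hu1 hK (errConst_nonneg hM2 k) (ih l l' (by omega) (by omega))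
    · obtain ⟨l, rfl⟩ := Nat.exists_eq_add_of_le'
        (two_le_of_mem_niceClass h.mostlyGood h.exceptional_lt hK hσ hl)
      exact h.step_loops hu0 hu1 hK (errConst_nonneg hM2 k) (ih l l' (by omega) (by omega))

/-- The average value over all configurations. -/
lemma Regular.sum_value_ge (h : Regular d K m Δ M η) (hu0 : 0 ≤ u) (hu1 : u ≤ 1)
    (hu : (niceClass d 0 0).card * u ≤ ∑ σ ∈ niceClass d 0 0, value S 0 σ) :
    (u - (8 * M ^ 2 + 4 * M) * ((Δ : ℝ) ^ 2 / Fintype.card (HalfEdge d)) -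
      (2 * M + (2 * M) ^ 2) / (K + 1) -
      (K + 1) ^ 2 * errConst (2 * M ^ 2) K * η) * Fintype.card (Config d) ≤
      ∑ σ : Config d, value S K σ := by
  set C : ℝ := ((Fintype.card (Config d) : ℕ) : ℝ) with hC
  set P := (Finset.range (K + 1) ×ˢ Finset.range (K + 1)).filter fun p => p.1 + p.2 ≤ K with hP
  have hM2 : (0 : ℝ) ≤ 2 * M ^ 2 := by positivity
  have hE := mul_nonneg (errConst_nonneg hM2 K) (mul_nonneg h.pos.le (Nat.cast_nonneg _ : 0 ≤ C))
  set T := Finset.univ.filter fun σ : Config d => Nice σ ∧ (badSet σ).card ≤ K with hT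
  have hdisj : ∀ p ∈ P, ∀ q ∈ P, p ≠ q →
      Disjoint (niceClass d p.1 p.2) (niceClass d q.1 q.2) := by
    rintro ⟨a, b⟩ _ ⟨a', b'⟩ _ hne
    refine Finset.disjoint_left.2 fun σ h1 h2 => hne ?_
    rw [mem_niceClass] at h1 h2
    exact Prod.ext (h1.2.1.symm.trans h2.2.1) (h1.2.2.symm.trans h2.2.2)
  have hTP : T = P.biUnion fun p => niceClass d p.1 p.2 := by
    ext σ
    simp only [hT, hP, Finset.mem_filter, Finset.mem_univ, true_and, Finset.mem_biUnion,
      Finset.mem_product, Finset.mem_range, Prod.exists, mem_niceClass]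
    constructor
    · rintro ⟨h1, h2⟩
      have h3 := card_loops_add_card_multiples σ
      exact ⟨_, _, ⟨⟨by omega, by omega⟩, by omega⟩, h1, rfl, rfl⟩
    · rintro ⟨a, b, ⟨-, h1⟩, h2, rfl, rfl⟩
      rw [card_loops_add_card_multiples] at h1
      exact ⟨h2, h1⟩
  have h1 : (T.card : ℝ) * u - (K + 1) ^ 2 * (errConst (2 * M ^ 2) K * (η * C)) ≤
      ∑ σ ∈ T, value S K σ := by
    rw [hTP, Finset.sum_biUnion hdisj, Finset.card_biUnion hdisj, Nat.cast_sum, Finset.sum_mul]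
    have hPc : (P.card : ℝ) ≤ (K + 1) ^ 2 := by
      have : P.card ≤ (K + 1) * (K + 1) := (Finset.card_filter_le _ _).trans_eq (by simp)
      rw [sq]; exact_mod_cast this
    have : ∑ p ∈ P, ((niceClass d p.1 p.2).card * u - errConst (2 * M ^ 2) K * (η * C)) ≤
        ∑ p ∈ P, ∑ σ ∈ niceClass d p.1 p.2, value S K σ :=
      Finset.sum_le_sum fun p hp => h.niceClass_value_ge hu0 hu1 hu K p.1 p.2
        (Finset.mem_filter.1 hp).2 (Finset.mem_filter.1 hp).2
    refine le_trans ?_ this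
    rw [Finset.sum_sub_distrib, Finset.sum_const, nsmul_eq_mul]
    gcongr
  have h2 : ∑ σ ∈ T, value S K σ ≤ ∑ σ : Config d, value S K σ :=
    Finset.sum_le_sum_of_subset_of_nonneg (Finset.subset_univ _) fun _ _ _ => value_nonneg _ _
  have h3 : C ≤ T.card + (Finset.univ.filter fun τ : Config d => ¬ Nice τ).card +
      (Finset.univ.filter fun τ : Config d => K + 1 ≤ (badSet τ).card).card := by
    rw [hC, ← Finset.card_univ]
    have : (Finset.univ : Finset (Config d)) ⊆ (T ∪ Finset.univ.filter fun τ : Config d => ¬ Nice τ)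
        ∪ (Finset.univ.filter fun τ : Config d => K + 1 ≤ (badSet τ).card) := by
      intro σ _
      simp only [hT, Finset.mem_union, Finset.mem_filter, Finset.mem_univ, true_and]
      by_cases hn : Nice σ
      · rcases le_or_gt (badSet σ).card K with hb | hb
        · exact Or.inl (Or.inl ⟨hn, hb⟩)
        · exact Or.inr hb
      · exact Or.inl (Or.inr hn)
    have h4 := (Finset.card_le_card this).trans ((Finset.card_union_le _ _).trans
      (Nat.add_le_add_right (Finset.card_union_le _ _) _))
    exact_mod_cast h4
  have h4 := card_not_nice_le h.le_max h.large h.siblings_le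
  -- Markov's inequality for the number of bad half-edges.
  have h5 : ((Finset.univ.filter fun τ : Config d => K + 1 ≤ (badSet τ).card).card : ℝ) ≤
      (2 * M + (2 * M) ^ 2) / (K + 1) * C := by
    rw [div_mul_eq_mul_div, le_div_iff₀ (by positivity)]
    refine le_trans ?_ (sum_badSet_le h.large h.siblings_le)
    refine le_trans ?_ (Finset.sum_le_sum_of_subset_of_nonneg (Finset.subset_univ
      (Finset.univ.filter fun τ : Config d => K + 1 ≤ (badSet τ).card))
      fun _ _ _ => Nat.cast_nonneg _)
    rw [← nsmul_eq_mul]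
    refine Finset.card_nsmul_le_sum _ _ _ fun τ hτ => ?_
    exact_mod_cast (Finset.mem_filter.1 hτ).2
  have h6 : C * u - (C - T.card) ≤ T.card * u := by
    have : (C - T.card) * u ≤ (C - T.card) * 1 :=
      mul_le_mul_of_nonneg_left hu1 (sub_nonneg.2 (cast_card_le_config T))
    linarith
  have e : (u - (8 * M ^ 2 + 4 * M) * ((Δ : ℝ) ^ 2 / Fintype.card (HalfEdge d)) -
      (2 * M + (2 * M) ^ 2) / (K + 1) - (K + 1) ^ 2 * errConst (2 * M ^ 2) K * η) * C =
      C * u - (8 * M ^ 2 + 4 * M) * ((Δ : ℝ) ^ 2 / Fintype.card (HalfEdge d)) * C -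
      (2 * M + (2 * M) ^ 2) / (K + 1) * C -
      (K + 1) ^ 2 * (errConst (2 * M ^ 2) K * (η * C)) := by ring
  rw [e]
  linarith

end Induction

/-! ### Choice of the constants -/

section Finite

/-- The adversarial value is at least the uniform probability, up to a small error. -/
theorem exists_value_bound {M ε : ℝ} (hM : 1 ≤ M) (hε : 0 < ε) :
    ∃ (K : ℕ) (δ : ℝ), 0 < δ ∧ ∀ (n : ℕ) (d : Fin n → ℕ) (Δ : ℕ), (∀ i, d i ≤ Δ) →
      1 ≤ δ * Fintype.card (HalfEdge d) → (Δ : ℝ) ^ 2 ≤ δ * Fintype.card (HalfEdge d) →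
      ((siblings d).card : ℝ) ≤ M * Fintype.card (HalfEdge d) →
      ∀ (S : Set (SimpleGraph (Fin n))) (u : ℝ), 0 ≤ u → u ≤ 1 →
        (niceClass d 0 0).card * u ≤ ∑ σ ∈ niceClass d 0 0, value S 0 σ →
        (u - ε) * Fintype.card (Config d) ≤ ∑ σ : Config d, value S K σ := by
  have hM0 : 0 ≤ M := by linarith
  -- The error ε is split in three. K controls the configurations with many bad half-edges; then η
  -- controls the errors accumulated in the induction, and finally δ depends on both.
  obtain ⟨K, hK⟩ := exists_nat_gt ((2 * M + (2 * M) ^ 2) / (ε / 3))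
  have hK' : (2 * M + (2 * M) ^ 2) / (K + 1) ≤ ε / 3 := by
    rw [div_lt_iff₀ (by positivity)] at hK
    rw [div_le_iff₀ (by positivity)]
    nlinarith
  set E := errConst (2 * M ^ 2) K with hE
  have hE0 : 0 ≤ E := errConst_nonneg (by positivity) K
  set η := min (1 / 2) (ε / (3 * ((K + 1) ^ 2 * E + 1))) with hη
  have hη0 : 0 < η := lt_min (by norm_num) (by positivity)
  have hη1 : η ≤ 1 / 2 := min_le_left _ _
  have hη2 : (K + 1) ^ 2 * E * η ≤ ε / 3 := by
    have h1 : η ≤ ε / (3 * ((K + 1) ^ 2 * E + 1)) := min_le_right _ _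
    rw [le_div_iff₀ (by positivity)] at h1
    linarith
  have hηsq : η ^ 2 ≤ η := by nlinarith
  set c := 4 * M ^ 2 + 96 * M ^ 4 + 8 * M ^ 3 with hc
  set B : ℝ := (K + 4) + (3 * K + (2 * M) ^ 3 + (2 * M) ^ 4) + c + (8 * M ^ 2 + 4 * M) + 16 with hB
  have hc0 : 0 ≤ c := by positivity
  have hB0 : 0 < B := by positivity
  -- B exceeds every constant needed below. The square of η is required because δ enters the
  -- concentration bound through its square root.
  set δ := min (η ^ 2 / B) (ε / 3 / B) with hδ
  have hδ0 : 0 < δ := lt_min (by positivity) (by positivity)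
  have hδ1 : δ * B ≤ η ^ 2 := by
    have : δ ≤ η ^ 2 / B := min_le_left _ _
    rwa [le_div_iff₀ hB0] at this
  have hδ2 : δ * B ≤ ε / 3 := by
    have : δ ≤ ε / 3 / B := min_le_right _ _
    rwa [le_div_iff₀ hB0] at this
  have hsub : ∀ x : ℝ, x ≤ B → δ * x ≤ δ * B := fun x hx => mul_le_mul_of_nonneg_left hx hδ0.le
  have hK0 : (0 : ℝ) ≤ K := Nat.cast_nonneg K
  have p3 : (0 : ℝ) ≤ (2 * M) ^ 3 := by positivity
  have p4 : (0 : ℝ) ≤ (2 * M) ^ 4 := by positivity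
  have p2 : (0 : ℝ) ≤ 8 * M ^ 2 + 4 * M := by positivity
  refine ⟨K, δ, hδ0, fun n d Δ hΔ h1 h2 h3 S u hu0 hu1 hu => ?_⟩
  set N : ℝ := ((Fintype.card (HalfEdge d) : ℕ) : ℝ) with hN
  have hN0 : 0 ≤ N := Nat.cast_nonneg _
  have hΔ1 : (Δ : ℝ) ≤ δ * N := by
    refine le_trans ?_ h2
    exact_mod_cast (Nat.le_self_pow two_ne_zero Δ)
  have hηN : ∀ x : ℝ, x ≤ B → x * (δ * N) ≤ η * N := fun x hx => by
    calc x * (δ * N) = (δ * x) * N := by ring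
      _ ≤ η * N := mul_le_mul_of_nonneg_right ((hsub x hx).trans (hδ1.trans hηsq)) hN0
  have h16 : 16 ≤ N := by
    have a1 : δ * 16 ≤ 1 := (hsub 16 (by linarith)).trans (by linarith)
    nlinarith
  have hNat : 16 ≤ Fintype.card (HalfEdge d) := Nat.ofNat_le_cast.1 h16
  have hm : ((K + 2 * (Δ + Δ * Δ) : ℕ) : ℝ) ≤ η * N := by
    refine le_trans ?_ (hηN (K + 4) (by linarith))
    have : (K : ℝ) ≤ K * (δ * N) := le_mul_of_one_le_right hK0 h1
    push_cast
    nlinarith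
  have hreg : Regular d K (K + 2 * (Δ + Δ * Δ)) Δ M η :=
    { le_max := hΔ
      mostlyGood := fun σ hσ hb a ha => exists_exceptional hΔ hσ hb ha
      exceptional_lt := by
        have : ((K + 2 * (Δ + Δ * Δ) : ℕ) : ℝ) < N := by nlinarith
        exact Nat.cast_lt.1 this
      large := hNat
      siblings_le := h3
      one_le := hM
      exceptional_le := hm
      one_le_error := by
        have := hηN 1 (by linarith)
        linarith
      error_le := by
        refine le_trans ?_ (hηN (3 * K + (2 * M) ^ 3 + (2 * M) ^ 4) (by linarith))
        have a1 : (2 * M) ^ 3 ≤ (2 * M) ^ 3 * (δ * N) := le_mul_of_one_le_right p3 h1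
        have a2 : (2 * M) ^ 4 ≤ (2 * M) ^ 4 * (δ * N) := le_mul_of_one_le_right p4 h1
        have a3 : (K : ℝ) * Δ ^ 2 ≤ K * (δ * N) := mul_le_mul_of_nonneg_left h2 hK0
        linarith
      deviation_le := by
        refine (sum_abs_multiTriples_sub_le hΔ hNat h3 hM0 h1 h2).trans ?_
        refine mul_le_mul_of_nonneg_right ?_ (by positivity)
        rw [Real.sqrt_le_left hη0.le]
        exact (hsub c (by linarith)).trans hδ1 }
  refine le_trans ?_ (hreg.sum_value_ge hu0 hu1 hu)
  refine mul_le_mul_of_nonneg_right ?_ (Nat.cast_nonneg _)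
  have h5 : (8 * M ^ 2 + 4 * M) * ((Δ : ℝ) ^ 2 / N) ≤ ε / 3 := by
    have : (Δ : ℝ) ^ 2 / N ≤ δ := by rwa [div_le_iff₀ (by linarith)]
    calc _ ≤ (8 * M ^ 2 + 4 * M) * δ := mul_le_mul_of_nonneg_left this p2
      _ = δ * (8 * M ^ 2 + 4 * M) := by ring
      _ ≤ _ := (hsub _ (by linarith)).trans hδ2
  linarith

end Finite

/-! ### The value bounds the switching process from below -/

section Runs

variable {n : ℕ} {d : Fin n → ℕ}

/-- The mean of a function under a probability mass function. -/
noncomputable def pmfMean {α : Type*} (p : PMF α) (F : α → ℝ≥0∞) : ℝ≥0∞ := ∑' x, p x * F x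

lemma pmfMean_pure {α : Type*} (a : α) (F : α → ℝ≥0∞) : pmfMean (PMF.pure a) F = F a := by
  unfold pmfMean
  rw [tsum_eq_single a]
  · simp
  · intro b hb; simp [PMF.pure_apply, hb]

lemma pmfMean_bind {α β : Type*} (p : PMF α) (f : α → PMF β) (F : β → ℝ≥0∞) :
    pmfMean (p.bind f) F = pmfMean p fun a => pmfMean (f a) F := by
  unfold pmfMean
  simp_rw [PMF.bind_apply, ← ENNReal.tsum_mul_right, ← ENNReal.tsum_mul_left]
  rw [ENNReal.tsum_comm]
  simp_rw [mul_assoc]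

lemma pmfMean_map {α β : Type*} (p : PMF α) (f : α → β) (F : β → ℝ≥0∞) :
    pmfMean (p.map f) F = pmfMean p fun a => F (f a) := by
  rw [PMF.map, pmfMean_bind]
  simp_rw [Function.comp_def, pmfMean_pure]

lemma pmfMean_uniformOfFinset {α : Type*} [Fintype α] (s : Finset α) (hs : s.Nonempty)
    (F : α → ℝ≥0∞) :
    pmfMean (PMF.uniformOfFinset s hs) F = (s.card : ℝ≥0∞)⁻¹ * ∑ a ∈ s, F a := by
  classical
  unfold pmfMean
  rw [tsum_fintype, Finset.mul_sum]
  simp_rw [PMF.uniformOfFinset_apply, ite_mul, zero_mul]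
  rw [← Finset.sum_filter]
  congr 1
  ext; simp

lemma le_pmfMean {α : Type*} (p : PMF α) {F : α → ℝ≥0∞} {c : ℝ≥0∞}
    (h : ∀ a ∈ p.support, c ≤ F a) : c ≤ pmfMean p F := by
  unfold pmfMean
  calc c = ∑' a, p a * c := by rw [ENNReal.tsum_mul_right, p.tsum_coe, one_mul]
    _ ≤ ∑' a, p a * F a := by
      refine ENNReal.tsum_le_tsum fun a => ?_
      by_cases ha : p a = 0
      · simp [ha]
      · gcongr; exact h a ((PMF.mem_support_iff _ _).2 ha)

lemma pmfMean_mono {α : Type*} (p : PMF α) {F F' : α → ℝ≥0∞} (h : ∀ a, F a ≤ F' a) :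
    pmfMean p F ≤ pmfMean p F' :=
  ENNReal.tsum_le_tsum fun a => by gcongr; exact h a

variable {S : Set (SimpleGraph (Fin n))}

/-- The value is a minimum over bad edges, hence at most the mean over any random choice of a bad
edge, whatever the history. -/
lemma value_succ_le_pmfMean_step (R : BadEdgeRule d) (k : ℕ) (s : History d × Config d) :
    ENNReal.ofReal (value S (k + 1) s.2) ≤
      pmfMean (step R s) fun s' => ENNReal.ofReal (value S k s'.2) := by
  unfold step
  split_ifs with hs
  · rw [pmfMean_pure, value_of_isSimple hs, value_of_isSimple hs]
  · rw [pmfMean_bind]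
    refine le_pmfMean _ fun a ha => ?_
    have hle := value_succ_le (S := S) (R.isBad_of_mem_support _ _ _ a ha) k
    split_ifs with hc
    · rw [pmfMean_map, pmfMean_uniformOfFinset]
      refine (ENNReal.ofReal_le_ofReal hle).trans_eq ?_
      unfold switchAvg
      rw [← card_otherHalfEdges s.2 a, ENNReal.ofReal_mul (by positivity),
        ENNReal.ofReal_inv_of_pos (by exact_mod_cast hc.card_pos), ENNReal.ofReal_natCast,
        ENNReal.ofReal_sum_of_nonneg fun _ _ => value_nonneg _ _]
    -- With no other edge the process stalls, but the mean over the empty set is 0, so the value is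
    -- 0 too.
    · rw [Finset.not_nonempty_iff_eq_empty] at hc
      unfold switchAvg at hle
      rw [hc, Finset.sum_empty, mul_zero] at hle
      rw [ENNReal.ofReal_of_nonpos hle]
      exact zero_le

lemma value_le_pmfMean_run (R : BadEdgeRule d) (σ : Config d) (j k : ℕ) :
    ENNReal.ofReal (value S (j + k) σ) ≤
      pmfMean (run R σ j) fun s => ENNReal.ofReal (value S k s.2) := by
  induction j generalizing k with
  | zero => rw [run, pmfMean_pure, zero_add]
  | succ j ih =>
    rw [run, pmfMean_bind, show j + 1 + k = j + (k + 1) by ring]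
    exact (ih (k + 1)).trans (pmfMean_mono _ fun s => value_succ_le_pmfMean_step R k s)

lemma value_le_run (R : BadEdgeRule d) (σ : Config d) (k : ℕ) : ENNReal.ofReal (value S k σ) ≤
    (run R σ k).toOuterMeasure {s | IsSimple s.2 ∧ toGraph s.2 ∈ S} := by
  classical
  refine (value_le_pmfMean_run R σ k 0).trans_eq ?_
  rw [PMF.toOuterMeasure_apply, pmfMean]
  refine tsum_congr fun s => ?_
  by_cases h : IsSimple s.2 ∧ toGraph s.2 ∈ S
  · rw [Set.indicator_of_mem (by exact h), value, if_pos h]; simp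
  · rw [Set.indicator_of_notMem (by exact h), value, if_neg h]; simp

lemma toOuterMeasure_le_sum {α ι : Type*} (p : PMF α) (T : Finset ι) (A : ι → Set α) {B : Set α}
    (h : B ⊆ ⋃ i ∈ T, A i) : p.toOuterMeasure B ≤ ∑ i ∈ T, p.toOuterMeasure (A i) :=
  (measure_mono h).trans (measure_biUnion_finset_le T A)

/-- The switched configuration model gives each set of graphs at least the average value. -/
theorem sum_value_le_switchedLaw (R : BadEdgeRule d) (k : ℕ) :
    ENNReal.ofReal ((∑ σ : Config d, value S k σ) / Fintype.card (Config d)) ≤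
      switchedLaw R S := by
  classical
  set T : Finset (SimpleGraph (Fin n)) := Finset.univ.filter (· ∈ S) with hT
  have h1 : ∑ H ∈ T, endProb R H ≤ switchedLaw R S := by
    unfold switchedLaw
    refine le_trans ?_ (Measure.le_sum_apply _ _)
    refine le_trans ?_ (ENNReal.sum_le_tsum T)
    refine Finset.sum_le_sum fun H hH => ?_
    rw [Measure.smul_apply, smul_eq_mul]
    have h2 : 1 ≤ Measure.dirac H S := by
      refine le_trans ?_ Measure.le_dirac_apply
      rw [Set.indicator_of_mem (Finset.mem_filter.1 hH).2]; rfl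
    -- The first round alone suffices for a lower bound: it is the term m = 0, so restarts never
    -- need to be analysed.
    have h3 : endProb R H ≤ switchedProb R H := by
      unfold switchedProb
      refine le_trans ?_ (ENNReal.le_tsum 0)
      simp
    calc endProb R H = endProb R H * 1 := (mul_one _).symm
      _ ≤ _ := mul_le_mul' h3 h2
  refine le_trans ?_ h1
  unfold endProb
  simp_rw [tsum_fintype]
  rw [Finset.sum_comm, div_eq_inv_mul, ENNReal.ofReal_mul (by positivity),
    ENNReal.ofReal_sum_of_nonneg fun _ _ => value_nonneg _ _, Finset.mul_sum]
  refine Finset.sum_le_sum fun σ _ => ?_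
  rw [← Finset.mul_sum, Nat.card_eq_fintype_card]
  have hpos : 0 < Fintype.card (Config d) := Fintype.card_pos_iff.2 ⟨σ⟩
  rw [ENNReal.ofReal_inv_of_pos (by exact_mod_cast hpos), ENNReal.ofReal_natCast]
  gcongr
  calc ENNReal.ofReal (value S k σ) ≤ _ := value_le_run R σ k
    _ ≤ ∑ H ∈ T, (run R σ k).toOuterMeasure {s | IsSimple s.2 ∧ toGraph s.2 = H} := by
      refine toOuterMeasure_le_sum _ _ _ fun s hs => ?_
      simp only [Set.mem_iUnion]
      exact ⟨toGraph s.2, by simpa [hT] using hs.2, hs.1, rfl⟩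
    _ ≤ _ := Finset.sum_le_sum fun H _ =>
      le_iSup (fun k => (run R σ k).toOuterMeasure {s | IsSimple s.2 ∧ toGraph s.2 = H}) k

end Runs

/-! ### Each graph comes from equally many simple configurations -/

section Fibres

variable {n : ℕ} {d : Fin n → ℕ}

lemma eq_of_isSimple {σ : Config d} (hσ : IsSimple σ) {a b : HalfEdge d} (h1 : b.1 = a.1)
    (h2 : (σ.1 b).1 = (σ.1 a).1) : b = a :=
  eq_of_mem_par (hσ a) (mem_par.2 ⟨h1, h2⟩)

/-- The half-edges at `i` correspond to the neighbours of `i` in the graph. -/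
noncomputable def neighborEquiv {σ : Config d} (hσ : IsSimple σ) (i : Fin n) :
    Fin (d i) ≃ (toGraph σ).neighborSet i :=
  Equiv.ofBijective (fun k => ⟨(σ.1 ⟨i, k⟩).1,
    ⟨fun h => hσ ⟨i, k⟩ (isBad_of_loop h.symm), ⟨i, k⟩, rfl, rfl⟩⟩) (by
    constructor
    · intro k k' h
      have := eq_of_isSimple hσ (a := ⟨i, k'⟩) (b := ⟨i, k⟩) rfl (congrArg Subtype.val h)
      simpa using this
    · rintro ⟨j, -, ⟨i', k⟩, rfl, h⟩
      exact ⟨k, Subtype.ext h⟩)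

lemma hasDegrees_toGraph {σ : Config d} (hσ : IsSimple σ) : HasDegrees d (toGraph σ) := by
  intro i
  rw [← Nat.card_coe_set_eq, ← Nat.card_congr (neighborEquiv hσ i), Nat.card_eq_fintype_card,
    Fintype.card_fin]

/-- Labellings of the neighbours in a graph by half-edges. -/
abbrev Labelling (d : Fin n → ℕ) (H : SimpleGraph (Fin n)) : Type :=
  ∀ i, Fin (d i) ≃ H.neighborSet i

/-- The labelling given by a configuration. -/
noncomputable def toLabelling (H : SimpleGraph (Fin n))
    (σ : {σ : Config d // IsSimple σ ∧ toGraph σ = H}) : Labelling d H :=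
  fun i => (neighborEquiv σ.2.1 i).trans (Equiv.setCongr (by rw [σ.2.2]))

lemma toLabelling_apply (H : SimpleGraph (Fin n))
    (σ : {σ : Config d // IsSimple σ ∧ toGraph σ = H}) (a : HalfEdge d) :
    (toLabelling H σ a.1 a.2 : Fin n) = (σ.1.1 a).1 := rfl

/-- In a simple configuration, the partner of a is determined by its vertex: it is the only
half-edge there whose partner lies at the vertex of a. -/
lemma toLabelling_injective (H : SimpleGraph (Fin n)) :
    Function.Injective (toLabelling (d := d) H) := by
  intro σ σ' h
  have h1 : ∀ a, (σ.1.1 a).1 = (σ'.1.1 a).1 := fun a => by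
    rw [← toLabelling_apply, ← toLabelling_apply, h]
  apply Subtype.ext; apply Subtype.ext; ext1 a
  apply eq_of_isSimple σ'.2.1 (h1 a)
  rw [← h1 (σ.1.1 a), Config.partner_partner, Config.partner_partner]

/-- The partner of the half-edge at i labelled j is the half-edge at j labelled i. -/
lemma toLabelling_surjective (H : SimpleGraph (Fin n)) :
    Function.Surjective (toLabelling (d := d) H) := by
  intro g
  set t : HalfEdge d → Fin n := fun a => (g a.1 a.2 : Fin n) with ht
  have hadj : ∀ a, H.Adj a.1 (t a) := fun a => (g a.1 a.2).2
  have hext : ∀ a b : HalfEdge d, a.1 = b.1 → t a = t b → a = b := by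
    rintro ⟨i, k⟩ ⟨j, k'⟩ h1 h2
    obtain rfl : i = j := h1
    have : k = k' := (g i).injective (Subtype.ext h2)
    rw [this]
  set φ : HalfEdge d → HalfEdge d := fun a => ⟨t a, (g (t a)).symm ⟨a.1, (hadj a).symm⟩⟩ with hφ
  have hφ1 : ∀ a, (φ a).1 = t a := fun a => rfl
  have hφt : ∀ a, t (φ a) = a.1 := fun a => by
    simp [ht, hφ]
  have hinv : Function.Involutive φ := fun a => hext _ _ (by rw [hφ1, hφt]) (by rw [hφt, hφ1])
  have hne : ∀ a, φ a ≠ a := fun a h => (hadj a).ne (by rw [← hφ1, h])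
  set σ : Config d := ⟨hinv.toPerm φ, fun a => ⟨hinv a, hne a⟩⟩ with hσ
  have hσa : ∀ a, σ.1 a = φ a := fun a => rfl
  have hs : IsSimple σ := by
    intro a h
    obtain ⟨c, hc, hca⟩ := isBad_iff_exists.1 h
    rw [mem_par, hσa, hσa, hφ1, hφ1] at hc
    exact hca (hext c a hc.1 hc.2)
  have hG : toGraph σ = H := by
    ext i j
    constructor
    · rintro ⟨-, a, rfl, rfl⟩
      exact hadj a
    · intro h
      refine ⟨h.ne, ⟨i, (g i).symm ⟨j, h⟩⟩, rfl, ?_⟩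
      rw [hσa, hφ1]
      simp [ht]
  refine ⟨⟨σ, hs, hG⟩, ?_⟩
  funext i
  ext k
  rfl

/-- All graphs with the given degrees come from the same number of configurations. -/
lemma card_fibre_eq {H H' : SimpleGraph (Fin n)} (hH : HasDegrees d H) (hH' : HasDegrees d H') :
    Nat.card {σ : Config d // IsSimple σ ∧ toGraph σ = H} =
      Nat.card {σ : Config d // IsSimple σ ∧ toGraph σ = H'} := by
  rw [Nat.card_congr (Equiv.ofBijective _ ⟨toLabelling_injective H, toLabelling_surjective H⟩),
    Nat.card_congr (Equiv.ofBijective _ ⟨toLabelling_injective H', toLabelling_surjective H'⟩)]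
  have e : ∀ i, Nonempty (H.neighborSet i ≃ H'.neighborSet i) := fun i =>
    ⟨(Finite.equivFinOfCardEq ((Nat.card_coe_set_eq _).trans (hH i))).trans
      (Finite.equivFinOfCardEq ((Nat.card_coe_set_eq _).trans (hH' i))).symm⟩
  exact Nat.card_congr (Equiv.piCongrRight fun i => Equiv.equivCongr (Equiv.refl _) (e i).some)

end Fibres

/-! ### The uniform law, existence of configurations and sibling pairs -/

section Law

variable {n : ℕ} {d : Fin n → ℕ}

lemma measurableSet_graphs (S : Set (SimpleGraph (Fin n))) : MeasurableSet S :=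
  ⟨SimpleGraph.Adj '' S, (Set.toFinite _).measurableSet,
    Set.preimage_image_eq _ fun _ _ h => SimpleGraph.ext h⟩

open Classical in
lemma card_simple_mem (S : Set (SimpleGraph (Fin n))) {H₀ : SimpleGraph (Fin n)}
    (h₀ : HasDegrees d H₀) : ((niceClass d 0 0).filter (toGraph · ∈ S)).card =
      (Finset.univ.filter fun H : SimpleGraph (Fin n) => HasDegrees d H ∧ H ∈ S).card *
        Nat.card {σ : Config d // IsSimple σ ∧ toGraph σ = H₀} := by
  rw [Finset.card_eq_sum_card_fiberwise (f := toGraph)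
    (t := Finset.univ.filter fun H : SimpleGraph (Fin n) => HasDegrees d H ∧ H ∈ S)]
  · refine Finset.sum_const_nat fun H hH => ?_
    rw [Finset.mem_filter] at hH
    rw [card_fibre_eq h₀ hH.2.1, Nat.card_eq_fintype_card, Fintype.card_subtype]
    congr 1
    ext σ
    simp only [Finset.mem_filter, Finset.mem_univ, true_and, ← isSimple_iff_mem_niceClass]
    constructor
    · rintro ⟨⟨h1, -⟩, h2⟩; exact ⟨h1, h2⟩
    · rintro ⟨h1, h2⟩; exact ⟨⟨h1, h2 ▸ hH.2.2⟩, h2⟩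
  · intro σ hσ
    simp only [Finset.coe_filter, Set.mem_ofPred_eq, ← isSimple_iff_mem_niceClass] at hσ
    simpa using ⟨hasDegrees_toGraph hσ.1, hσ.2⟩

open Classical in
lemma uniformLaw_apply (S : Set (SimpleGraph (Fin n))) : uniformLaw d S =
    ((Finset.univ.filter fun H : SimpleGraph (Fin n) => HasDegrees d H ∧ H ∈ S).card : ℝ≥0∞) /
      (Finset.univ.filter fun H : SimpleGraph (Fin n) => HasDegrees d H).card := by
  have h := uniformOn_apply_finset' (Ω := SimpleGraph (Fin n))
    (s := Finset.univ.filter fun H : SimpleGraph (Fin n) => HasDegrees d H)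
    (t := Finset.univ.filter (· ∈ S)) (measurableSet_graphs _) (measurableSet_graphs _)
  rw [← Finset.filter_and] at h
  simpa [uniformLaw] using h

lemma isProbabilityMeasure_uniformLaw (hd : IsGraphic d) :
    IsProbabilityMeasure (uniformLaw d) := by
  classical
  obtain ⟨H, hH⟩ := hd
  constructor
  rw [uniformLaw_apply]
  simp only [Set.mem_univ, and_true]
  refine ENNReal.div_self ?_ (ENNReal.natCast_ne_top _)
  exact Nat.cast_ne_zero.2 (Finset.card_ne_zero_of_mem (Finset.mem_filter.2 ⟨Finset.mem_univ H, hH⟩))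

/-- A uniformly random simple configuration projects to a uniformly random graph. -/
lemma card_niceClass_mul_uniformLaw (hd : IsGraphic d) (S : Set (SimpleGraph (Fin n))) :
    (niceClass d 0 0).card * (uniformLaw d S).toReal = ∑ σ ∈ niceClass d 0 0, value S 0 σ := by
  classical
  obtain ⟨H, hH⟩ := hd
  have h1 : ∑ σ ∈ niceClass d 0 0, value S 0 σ =
      (((niceClass d 0 0).filter (toGraph · ∈ S)).card : ℝ) := by
    rw [Finset.card_filter, Nat.cast_sum]
    refine Finset.sum_congr rfl fun σ hσ => ?_
    rw [value_of_isSimple (isSimple_iff_mem_niceClass.2 hσ)]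
    split_ifs <;> simp
  have h2 := card_simple_mem Set.univ hH
  simp only [Set.mem_univ, and_true, Finset.filter_true] at h2
  have h3 : ((Finset.univ.filter fun H : SimpleGraph (Fin n) => HasDegrees d H).card : ℝ) ≠ 0 :=
    Nat.cast_ne_zero.2 (Finset.card_ne_zero_of_mem (Finset.mem_filter.2 ⟨Finset.mem_univ H, hH⟩))
  rw [h1, card_simple_mem S hH, h2, uniformLaw_apply, ENNReal.toReal_div, ENNReal.toReal_natCast,
    ENNReal.toReal_natCast]
  push_cast
  field_simp

lemma niceClass_eq_empty (hd : ¬ IsGraphic d) : niceClass d 0 0 = ∅ :=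
  Finset.eq_empty_of_forall_notMem fun _ hσ =>
    hd ⟨_, hasDegrees_toGraph (isSimple_iff_mem_niceClass.2 hσ)⟩

lemma value_empty (k : ℕ) (σ : Config d) : value ∅ k σ = 0 := by
  induction k generalizing σ with
  | zero => simp [value]
  | succ k ih =>
    by_cases h : IsSimple σ
    · simp [value, h]
    · obtain ⟨a, -, h'⟩ := exists_value_succ_eq (S := ∅) h k
      rw [h', switchAvg]
      simp [ih]

lemma card_halfEdge : Fintype.card (HalfEdge d) = ∑ i, d i := by simp

lemma nonempty_config (h : Even (∑ i, d i)) : Nonempty (Config d) := by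
  have e := Fintype.equivFinOfCardEq (card_halfEdge (d := d))
  -- Numbering the half-edges from 0 to N - 1, pair k with N - 1 - k; a fixed point would make N
  -- odd.
  refine ⟨⟨(e.trans Fin.revPerm).trans e.symm, fun a => ⟨by simp, fun ha => ?_⟩⟩⟩
  obtain ⟨m, hm⟩ := h
  have h1 : Fin.rev (e a) = e a := by
    simpa [Equiv.symm_apply_eq] using ha
  have h2 := congrArg Fin.val h1
  rw [Fin.val_rev] at h2
  have := (e a).isLt
  omega

lemma card_siblings_le : (siblings d).card ≤ ∑ i, d i ^ 2 := by
  have h : ∀ a : HalfEdge d, sibCount a ≤ d a.1 := fun a => by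
    refine le_trans (Finset.card_le_card fun b hb => ?_) (card_halfEdgesAt a.1).le
    rw [Finset.mem_filter] at hb
    exact mem_halfEdgesAt.2 hb.2.2
  rw [← sum_sibCount]
  refine (Finset.sum_le_sum fun a _ => h a).trans_eq ?_
  rw [Fintype.sum_sigma]
  simp [sq]

end Law

/-! ### Asymptotic comparison of the two laws -/

section Limit

/-- Under the conditions on the degrees, the switched model dominates the uniform distribution up
to a vanishing error, uniformly in the rule and in the event. -/
theorem eventually_uniformLaw_le (d : (n : ℕ) → Fin n → ℕ)
    (heven : ∀ n, Even (∑ i, d n i))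
    (hsum : (fun n : ℕ => ∑ i, (d n i : ℝ)) =Θ[atTop] fun n : ℕ => (n : ℝ))
    (hsq : (fun n : ℕ => ∑ i, (d n i : ℝ) ^ 2) =O[atTop] fun n : ℕ => (n : ℝ))
    (hmax : (fun n : ℕ => ((Finset.univ.sup (d n) : ℕ) : ℝ)) =o[atTop] fun n : ℕ => √(n : ℝ))
    {ε : ℝ} (hε : 0 < ε) (hε1 : ε < 1) :
    ∀ᶠ n in atTop, IsGraphic (d n) ∧ ∀ (R : BadEdgeRule (d n)) (S : Set (SimpleGraph (Fin n))),
      uniformLaw (d n) S ≤ switchedLaw R S + ENNReal.ofReal ε := by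
  obtain ⟨c, hc, hcn⟩ := hsum.2.exists_pos
  obtain ⟨b, hb, hbn⟩ := hsq.exists_pos
  -- Eventually the sum of squares is at most b n and n is at most c N, so b c bounds the number of
  -- sibling pairs per half-edge; adding 1 ensures M ≥ 1.
  obtain ⟨K, δ, hδ, hbound⟩ := exists_value_bound (M := b * c + 1) (by nlinarith [mul_pos hb hc]) hε
  have hlarge : ∀ᶠ n : ℕ in atTop, c / δ ≤ n := tendsto_natCast_atTop_atTop.eventually_ge_atTop _
  filter_upwards [hcn.bound, hbn.bound, hmax.def (Real.sqrt_pos.2 (div_pos hδ hc)), hlarge]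
    with n h1 h2 h3 h4
  have hN : ((Fintype.card (HalfEdge (d n)) : ℕ) : ℝ) = ∑ i, (d n i : ℝ) := by
    rw [card_halfEdge]; push_cast; rfl
  have hn0 : (0 : ℝ) ≤ n := Nat.cast_nonneg n
  rw [Real.norm_of_nonneg hn0, Real.norm_of_nonneg (by positivity)] at h1 h2
  rw [Real.norm_of_nonneg (Nat.cast_nonneg _), Real.norm_of_nonneg (Real.sqrt_nonneg _)] at h3
  rw [← hN] at h1
  have hδn : δ / c * n ≤ δ * Fintype.card (HalfEdge (d n)) := by
    rw [div_mul_eq_mul_div, div_le_iff₀ hc]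
    nlinarith
  have hΔ : ((Finset.univ.sup (d n) : ℕ) : ℝ) ^ 2 ≤ δ * Fintype.card (HalfEdge (d n)) := by
    refine le_trans ?_ hδn
    calc _ ≤ (√(δ / c) * √(n : ℝ)) ^ 2 := pow_le_pow_left₀ (Nat.cast_nonneg _) h3 2
      _ = δ / c * n := by rw [mul_pow, Real.sq_sqrt (by positivity), Real.sq_sqrt hn0]
  have h1N : 1 ≤ δ * Fintype.card (HalfEdge (d n)) := by
    refine le_trans ?_ hδn
    rw [div_le_iff₀ hδ] at h4
    rw [div_mul_eq_mul_div, le_div_iff₀ hc]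
    linarith
  have hsib : ((siblings (d n)).card : ℝ) ≤ (b * c + 1) * Fintype.card (HalfEdge (d n)) := by
    have a1 : ((siblings (d n)).card : ℝ) ≤ ∑ i, (d n i : ℝ) ^ 2 := by
      exact_mod_cast card_siblings_le (d := d n)
    have a2 : (0 : ℝ) ≤ Fintype.card (HalfEdge (d n)) := Nat.cast_nonneg _
    nlinarith
  have hmain := hbound n (d n) (Finset.univ.sup (d n))
    (fun i => Finset.le_sup (Finset.mem_univ i)) h1N hΔ hsib
  have := nonempty_config (heven n)
  have hC : (0 : ℝ) < Fintype.card (Config (d n)) := Nat.cast_pos.2 Fintype.card_pos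
  have hlaw : ∀ (R : BadEdgeRule (d n)) (S : Set (SimpleGraph (Fin n))) (u : ℝ), 0 ≤ u → u ≤ 1 →
      (niceClass (d n) 0 0).card * u ≤ ∑ σ ∈ niceClass (d n) 0 0, value S 0 σ →
      ENNReal.ofReal (u - ε) ≤ switchedLaw R S := fun R S u hu0 hu1 hu =>
    (ENNReal.ofReal_le_ofReal ((le_div_iff₀ hC).2 (hmain S u hu0 hu1 hu))).trans
      (sum_value_le_switchedLaw R K)
  -- Without simple configurations the hypothesis on u holds for u = 1 and the empty set S, whose
  -- value is 0; this contradicts the bound as ε < 1.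
  have hgr : IsGraphic (d n) := by
    by_contra hd
    have h5 := hmain ∅ 1 zero_le_one le_rfl (by simp [niceClass_eq_empty hd])
    have h6 : ∑ σ : Config (d n), value ∅ K σ = 0 :=
      Finset.sum_eq_zero fun σ _ => value_empty K σ
    rw [h6] at h5
    nlinarith
  refine ⟨hgr, fun R S => ?_⟩
  have := isProbabilityMeasure_uniformLaw hgr
  have h7 := hlaw R S (uniformLaw (d n) S).toReal ENNReal.toReal_nonneg measureReal_le_one
    (card_niceClass_mul_uniformLaw hgr S).le
  calc uniformLaw (d n) S = ENNReal.ofReal ((uniformLaw (d n) S).toReal - ε + ε) := by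
        rw [sub_add_cancel, ENNReal.ofReal_toReal (measure_ne_top _ _)]
    _ ≤ _ := ENNReal.ofReal_add_le
    _ ≤ _ := by gcongr

/-- If one probability measure dominates another up to an error on all events, then the other
dominates it up to the same error. -/
lemma measure_le_add_of_le_add {α : Type*} [MeasurableSpace α] (μ ν : Measure α)
    [IsProbabilityMeasure μ] [IsProbabilityMeasure ν] {ε : ℝ≥0∞} {S : Set α}
    (hS : MeasurableSet S) (h : μ Sᶜ ≤ ν Sᶜ + ε) : ν S ≤ μ S + ε := by
  have h1 : ν S + ν Sᶜ = μ S + μ Sᶜ := by rw [prob_add_prob_compl hS, prob_add_prob_compl hS]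
  have h2 : ν S + ν Sᶜ ≤ μ S + ε + ν Sᶜ := by
    rw [h1, add_assoc, add_comm ε]
    gcongr
  exact (ENNReal.add_le_add_iff_right (measure_ne_top _ _)).1 h2

lemma le_liminf_of_forall_eventually_le_add {u v : ℕ → ℝ≥0∞} {a : ℝ≥0∞}
    (ha : a ≤ liminf v atTop)
    (h : ∀ ε : ℝ, 0 < ε → ε < 1 → ∀ᶠ n in atTop, v n ≤ u n + ENNReal.ofReal ε) :
    a ≤ liminf u atTop := by
  refine ha.trans (ENNReal.le_of_forall_pos_le_add fun ε hε _ => ?_)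
  have hε' : 0 < min (ε : ℝ) (1 / 2) := lt_min (by exact_mod_cast hε) (by norm_num)
  have h1 := h _ hε' ((min_le_right _ _).trans_lt (by norm_num))
  calc liminf v atTop ≤ liminf (fun n => u n + ε) atTop := by
        refine liminf_le_liminf (h1.mono fun n hn => hn.trans ?_)
        gcongr
        exact ENNReal.ofReal_le_of_le_toReal (min_le_left _ _)
    _ = liminf u atTop + ε := liminf_add_const atTop u ε (by isBoundedDefault) (by isBoundedDefault)

end Limit

end ConfigModel

/-! ### Transfer of convergence to the uniform graph -/

theorem corollary1
    (d : (n : ℕ) → Fin n → ℕ)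
    (heven : ∀ n, Even (∑ i, d n i))
    (hsum : (fun n : ℕ => ∑ i, (d n i : ℝ)) =Θ[atTop] fun n : ℕ => (n : ℝ))
    (hsq : (fun n : ℕ => ∑ i, (d n i : ℝ) ^ 2) =O[atTop] fun n : ℕ => (n : ℝ))
    (hmax : (fun n : ℕ => ((Finset.univ.sup (d n) : ℕ) : ℝ)) =o[atTop] fun n : ℕ => √(n : ℝ))
    (R : (n : ℕ) → ConfigModel.BadEdgeRule (d n))
    {Ω : ℕ → Type*} [∀ n, MeasurableSpace (Ω n)]
    (P : (n : ℕ) → Measure (Ω n)) [∀ n, IsProbabilityMeasure (P n)]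
    {Ω' : ℕ → Type*} [∀ n, MeasurableSpace (Ω' n)]
    (P' : (n : ℕ) → Measure (Ω' n)) [∀ n, IsProbabilityMeasure (P' n)]
    (G : (n : ℕ) → Ω n → SimpleGraph (Fin n)) (hGm : ∀ n, Measurable (G n))
    (hG : ∀ n, ConfigModel.IsGraphic (d n) →
      HasLaw (G n) (ConfigModel.uniformLaw (d n)) (P n))
    (Ghat : (n : ℕ) → Ω' n → SimpleGraph (Fin n)) (hGhatm : ∀ n, Measurable (Ghat n))
    (hGhat : ∀ n, ConfigModel.IsGraphic (d n) →
      HasLaw (Ghat n) (ConfigModel.switchedLaw (R n)) (P' n))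
    {E : Type*} [MetricSpace E] [MeasurableSpace E] [BorelSpace E]
    (f : (n : ℕ) → SimpleGraph (Fin n) → E) :
    (∀ a : E,
      ConfigModel.TendstoInProbability P' (fun n ω => f n (Ghat n ω)) a →
      ConfigModel.TendstoInProbability P (fun n ω => f n (G n ω)) a) ∧
    (∀ (Ω₀ : Type*) [MeasurableSpace Ω₀] (Q : Measure Ω₀) [IsProbabilityMeasure Q] (Y : Ω₀ → E),
      TendstoInDistribution (fun n ω => f n (Ghat n ω)) atTop Y P' Q →
      TendstoInDistribution (fun n ω => f n (G n ω)) atTop Y P Q) := by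
  have hle : ∀ ε : ℝ, 0 < ε → ε < 1 → ∀ᶠ n in atTop, ∀ S : Set (SimpleGraph (Fin n)),
      P n (G n ⁻¹' S) ≤ P' n (Ghat n ⁻¹' S) + ENNReal.ofReal ε := by
    intro ε hε hε1
    filter_upwards [ConfigModel.eventually_uniformLaw_le d heven hsum hsq hmax hε hε1]
      with n ⟨hgr, hn⟩ S
    have hS := ConfigModel.measurableSet_graphs S
    rw [← Measure.map_apply (hGm n) hS, ← Measure.map_apply (hGhatm n) hS,
      (hG n hgr).map_eq, (hGhat n hgr).map_eq]
    exact hn (R n) S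
  constructor
  · intro a ha ε hε
    rw [ENNReal.tendsto_nhds_zero]
    intro c hc
    obtain ⟨e, he0, hec⟩ := ENNReal.lt_iff_exists_nnreal_btwn.1 (ENNReal.half_pos hc.ne')
    have he0' : (0 : ℝ) < e := by exact_mod_cast he0
    -- Half of c is spent on the difference of the laws and half on the assumed convergence; the
    -- minimum with 1/2 meets the condition ε < 1 of `hle`.
    have hε' : 0 < min (e : ℝ) (1 / 2) := lt_min he0' (by norm_num)
    filter_upwards [hle _ hε' ((min_le_right _ _).trans_lt (by norm_num)),
      ENNReal.tendsto_nhds_zero.1 (ha ε hε) (c / 2) (ENNReal.half_pos hc.ne')] with n h1 h2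
    refine (h1 {H | ε ≤ dist (f n H) a}).trans ?_
    calc _ ≤ c / 2 + c / 2 := by
          refine add_le_add h2 (le_trans ?_ hec.le)
          exact ENNReal.ofReal_le_of_le_toReal (min_le_left _ _)
      _ = c := ENNReal.add_halves c
  · intro Ω₀ _ Q _ Y hY
    have hf : ∀ n, Measurable (f n) := fun n S _ => ConfigModel.measurableSet_graphs _
    refine ⟨fun n => ((hf n).comp (hGm n)).aemeasurable, hY.aemeasurable_limit, ?_⟩
    -- By the portmanteau theorem it suffices to bound the liminf over open sets from below. This
    -- needs the switched law to be dominated by the uniform one, the opposite of `hle`, which is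
    -- therefore applied to the complement.
    refine tendsto_of_forall_isOpen_le_liminf' fun O hO => ?_
    refine ConfigModel.le_liminf_of_forall_eventually_le_add
      (ProbabilityMeasure.le_liminf_measure_open_of_tendsto hY.tendsto hO) fun ε hε hε1 => ?_
    filter_upwards [hle ε hε hε1] with n hn
    have hfO : MeasurableSet (f n ⁻¹' O) := ConfigModel.measurableSet_graphs _
    have e1 : (P n).map (fun ω => f n (G n ω)) O = (P n).map (G n) (f n ⁻¹' O) :=
      (Measure.map_apply ((hf n).comp (hGm n)) hO.measurableSet).trans
        (Measure.map_apply (hGm n) hfO).symm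
    have e2 : (P' n).map (fun ω => f n (Ghat n ω)) O = (P' n).map (Ghat n) (f n ⁻¹' O) :=
      (Measure.map_apply ((hf n).comp (hGhatm n)) hO.measurableSet).trans
        (Measure.map_apply (hGhatm n) hfO).symm
    have i1 := Measure.isProbabilityMeasure_map (μ := P n) (hGm n).aemeasurable
    have i2 := Measure.isProbabilityMeasure_map (μ := P' n) (hGhatm n).aemeasurable
    simp only [ProbabilityMeasure.coe_mk, e1, e2]
    refine ConfigModel.measure_le_add_of_le_add _ _ hfO ?_
    rw [Measure.map_apply (hGm n) hfO.compl, Measure.map_apply (hGhatm n) hfO.compl]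
    exact hn _
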